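/- **Setting.** Let $\Omega\subset\mathbb R^3$ be a compact, simply connected polyhedron with $\Omega=\overline{\operatorname{int}\Omega}$ whose boundary is $\partial\Omega=\bigcup_{i=1}^I\overline{F_i}$, where every patch $F_i$ is an open flat (not necessarily convex) quadrilateral bounded by a simple polygonal chain $\partial F_i$, and two different closed patches are disjoint or meet in exactly one common edge or exactly one common vertex. Let $\nu_1,\dots,\nu_N$ be the vertices, and let $\kappa_i\colon[0,1]^2\to\overline{F_i}$ be bi-Lipschitz bijections mapping $(0,1)^2$ onto $F_i$. Put $\langle u,v\rangle=\sum_i\int_{[0,1]^2}(u\circ\kappa_i)\,\overline{(v\circ\kappa_i)}$. $L_p(\partial\Omega)$ and areas $|\cdot|$ refer to the surface measure. $C^\infty_{\rm pw}(\partial\Omega)$ is the set of continuous $u\colon\partial\Omega\to\mathbb C$ with $u|_{\overline{F_i}}\in C^\infty(\overline{F_i})$ for all $i$. If $\nu_n$ is a corner of $F_i$, let $\Gamma^{n,i}$ be the infinite open plane sector with apex $\nu_n$ spanned by $F_i$ at $\nu_n$ (a face of the boundary of the tangent cone $\mathcal C_n$ at $\nu_n$), with opening angle $\gamma_{n,i}\in(0,2\pi)$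 and polar coordinates $(r,\phi)$, $r>0$, $0<\phi<\gamma_{n,i}$. *Resolution of unity.* Fix non-negative $\varphi_1,\dots,\varphi_N\in C^\infty_{\rm pw}(\partial\Omega)$ with $\sum_n\varphi_n=1$, a constant $C_1>0$, and relatively open sets $\nu_n\in U_{n,0}\subsetneq U_{n,1}\subsetneq\partial\Omega$ such that $\varphi_n=1$ on $U_{n,0}$, $\varphi_n=0$ on $\partial\Omega\setminus U_{n,1}$, $\operatorname{dist}(U_{n,1},F_\ell)\ge C_1$ whenever $\nu_n\notin\overline{F_\ell}$, and, whenever $\nu_n$ is a corner of $F_i$, $\operatorname{dist}(U_{n,1}\cap\Gamma^{n,i},F_i\setminus\Gamma^{n,i})\ge C_1$ and $U_{n,1}\cap\overline{F_i}\subset\overline{\Gamma^{n,i}}$. *Weighted Sobolev spaces.* For $k\in\mathbb N$, $0\le\rho\le k$, $q=q(\phi)=\min\{\phi,\gamma_{n,i}-\phi\}$ and $f$ on $\partial\mathcal C_n=\bigcup_i\overline{\Gamma^{n,i}}$ put $$\|f\,|\,X^k_\rho(\partial\mathcal C_n)\|=\|f\,|\,L_2(\partial\mathcal C_n)\|+\sum_i\sum_{1\le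 a+b\le k}\big\|r^{-\rho}(1+r)^\rho(qr)^a q^{b-\rho}\,\partial_r^a\partial_\phi^b f\,\big|\,L_2(\Gamma^{n,i})\big\|$$ with weak derivatives. Let $\|u\,|\,X^k_\rho(\partial\Omega)\|=\sum_n\|\varphi_nu\,|\,X^k_\rho(\partial\mathcal C_n)\|$, where $\varphi_n u|_{\overline{F_i}}$ is regarded as a function on $\overline{\Gamma^{n,i}}$, extended by zero. $X^k_\rho(\partial\Omega)$ consists of all $u\in L_2(\partial\Omega)$ of finite norm that are limits, in this norm, of functions in $C^\infty_{\rm pw}(\partial\Omega)$. *Wavelets.* Let $\Psi$ be a wavelet basis whose duals have $\tilde d\in\mathbb N$ vanishing moments. That is: there are $j^*\in\mathbb N_0$, finitely many primal and dual generators $\phi_\eta,\tilde\phi_\eta$, and primal and dual wavelets $\psi_{j,\xi},\tilde\psi_{j,\xi}$ ($j\ge j^*$, $\xi\in\nabla_j$), such that generators and wavelets together form two Riesz bases of $L_2(\partial\Omega)$, biorthogonal with respect to $\langle\cdot,\cdot\rangle$. With constants independent of $j\ge j^*$, $\xi$, $i$ and $x$, the following holds. 1. The finite index set $\nabla_j$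 of level $j$ (whose elements have locations on $\partial\Omega$, also denoted by $\xi$) is a union $\bigcup_i\nabla_j^{F_i}$ with locations of $\nabla_j^{F_i}$ in $\overline{F_i}$ and $\#\nabla_j^{F_i}\sim2^{2j}$. 2. $\|\tilde\psi_{j,\xi}\,|\,L_2(\partial\Omega)\|\sim1$. 3. $\xi\in\operatorname{supp}\tilde\psi_{j,\xi}$, $|\operatorname{supp}\tilde\psi_{j,\xi}|\sim2^{-2j}$, and $\operatorname{supp}\tilde\psi_{j,\xi}$ is contained in a connected subset of $\partial\Omega$ of diameter $\lesssim2^{-j}$. 4. $\int_{[0,1]^2}P\,\overline{\tilde\psi_{j,\xi}\circ\kappa_i}=0$ for all polynomials $P$ of total degree less than $\tilde d$, whenever $\operatorname{supp}\tilde\psi_{j,\xi}\subset F_i$. 5. With $E=\bigcup_i\partial F_i$: for each $C>0$ the number of $\xi\in\nabla_j$ with $0<\operatorname{dist}(\operatorname{supp}\tilde\psi_{j,\xi},E)\le C2^{-j}$ is $\lesssim2^j$, for some $C$ it is also $\gtrsim2^j$; and the number of $\xi\in\nabla_j$ with $\operatorname{supp}\tilde\psi_{j,\xi}\cap E\ne\emptyset$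 is $\lesssim2^j$. 6. $\#\{\xi\in\nabla_j : x\in\operatorname{supp}\tilde\psi_{j,\xi}\}\lesssim1$ for $x\in\partial\Omega$. *Besov-type spaces.* A tuple $(\alpha,p,q)$ is admissible if $\frac12\le\frac1p\le\frac\alpha2+\frac12$ and $0<q\le\infty$, with $q\le2$ if $\frac1p=\frac\alpha2+\frac12$. Let $P(u)=\sum_\eta\langle u,\tilde\phi_\eta\rangle\phi_\eta$. For admissible $(\alpha,p,q)$ with $q<\infty$, $B^\alpha_{\Psi,q}(L_p(\partial\Omega))$ is the set of $u\in L_2(\partial\Omega)$ for which $$\|u\,|\,B^\alpha_{\Psi,q}(L_p(\partial\Omega))\|=\|P(u)\,|\,L_p(\partial\Omega)\|+\Big(\sum_{j\ge j^*}2^{j(\alpha+2(\frac12-\frac1p))q}\Big[\sum_{\xi\in\nabla_j}|\langle u,\tilde\psi_{j,\xi}\rangle|^p\Big]^{q/p}\Big)^{1/q}$$ is finite (with a supremum over $j$ for $q=\infty$). **Theorem.** Let $k\in\{1,\dots,\tilde d\}$, let the $\kappa_i$ be $C^k$ on $(0,1)^2$ with bounded derivatives up to order $k$, let $\rho\in(0,k)$,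 and let $(s,p,p)$ be admissible with $s>0$. Put $\alpha^*=\min\{\rho,\,k-\rho,\,s-(\frac1p-\frac12)\}$, and let $\frac1\tau=\frac\alpha2+\frac12$ with $0\le\alpha<2\alpha^*$. Then $(\alpha,\tau,\tau)$ is admissible, $B^s_{\Psi,p}(L_p(\partial\Omega))\cap X^k_\rho(\partial\Omega)\subset B^\alpha_{\Psi,\tau}(L_\tau(\partial\Omega))$, and there is a constant $C$ such that for all $u$ in this intersection $$\|u\,|\,B^\alpha_{\Psi,\tau}(L_\tau(\partial\Omega))\|\le C\max\big\{\|u\,|\,B^s_{\Psi,p}(L_p(\partial\Omega))\|,\ \|u\,|\,X^k_\rho(\partial\Omega)\|\big\}.$$ -/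

import Mathlib

open MeasureTheory Set
open scoped ENNReal NNReal ContDiff

noncomputable section

namespace PolySurf

/-- Euclidean three-space. -/
abbrev E3 := EuclideanSpace ℝ (Fin 3)

/-- The distance of two sets. -/
def setDist (A B : Set E3) : ℝ≥0∞ := ⨅ x ∈ A, Metric.infEDist x B

/-! ### Planar quadrilaterals -/

/-- The oriented area of the parallelogram spanned by two planar vectors. -/
def cross (z w : ℂ) : ℝ := z.re * w.im - z.im * w.re

/-- The open quadrilateral with corners `q 0, q 1, q 2, q 3`, cut by the diagonal from `q 0` to
`q 2` into two triangles. It is used for corners in counterclockwise order such that this diagonal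
runs inside; every simple quadrilateral, convex or not, can be labelled in this way. -/
def quad (q : Fin 4 → ℂ) : Set ℂ :=
  interior (convexHull ℝ {q 0, q 1, q 2} ∪ convexHull ℝ {q 0, q 2, q 3})

/-- The interior angle, in `(0, 2π)`, of a counterclockwise quadrilateral at the corner `q v`. -/
def interiorAngle (q : Fin 4 → ℂ) (v : Fin 4) : ℝ :=
  let a := Complex.arg ((q (v + 3) - q v) / (q (v + 1) - q v))
  if 0 < a then a else a + 2 * Real.pi

/-- Planar polar coordinates `(r, φ)` centred at the corner `q v`; the angle is measured
counterclockwise from the edge that joins `q v` to `q (v + 1)`. -/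
def cornerPolar (q : Fin 4 → ℂ) (v : Fin 4) (x : ℝ × ℝ) : ℂ :=
  q v + ((q (v + 1) - q v) / (‖q (v + 1) - q v‖ : ℂ)) *
    ((x.1 : ℂ) * Complex.exp ((x.2 : ℂ) * Complex.I))

/-- The closed unit square. -/
def square : Set (ℝ × ℝ) := Icc 0 1 ×ˢ Icc 0 1

/-- The open unit square. -/
def openSquare : Set (ℝ × ℝ) := Ioo 0 1 ×ˢ Ioo 0 1

/-- A flat quadrilateral patch in `ℝ³`: a planar quadrilateral with counterclockwise corners `q`,
placed in space by an affine isometry `chart`, with a parametrization `param` over the unit square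
(a bi-Lipschitz homeomorphism onto the closed quadrilateral; higher smoothness is the predicate
`Surface.ParamSmooth`). -/
structure Patch where
  chart : ℂ →ᵃⁱ[ℝ] E3
  q : Fin 4 → ℂ
  ccw_left : 0 < cross (q 1 - q 0) (q 2 - q 0)
  ccw_right : 0 < cross (q 2 - q 0) (q 3 - q 0)
  param : ℝ × ℝ → ℂ
  param_bij : BijOn param square (closure (quad q))
  param_interior : param '' openSquare = quad q
  param_bilip : ∃ L : ℝ, 0 < L ∧ ∀ x ∈ square, ∀ y ∈ square,
    dist (param x) (param y) ≤ L * dist x y ∧ dist x y ≤ L * dist (param x) (param y)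

namespace Patch

/-- The open patch, as a subset of `ℝ³`. -/
def face (F : Patch) : Set E3 := F.chart '' quad F.q

/-- The relative boundary of the patch (a closed polygonal chain). -/
def rim (F : Patch) : Set E3 := F.chart '' frontier (quad F.q)

/-- The corners of the patch. -/
def corner (F : Patch) (v : Fin 4) : E3 := F.chart (F.q v)

/-- The parametrization of the closed patch over the unit square. -/
def kappa (F : Patch) (x : ℝ × ℝ) : E3 := F.chart (F.param x)

/-- The edge joining the corners `v` and `v + 1`. -/
def edge (F : Patch) (v : Fin 4) : Set E3 := segment ℝ (F.corner v) (F.corner (v + 1))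

end Patch

/-! ### Polyhedral surfaces -/

/-- A compact, simply connected polyhedron `Ω` whose boundary is decomposed into finitely many
quadrilateral patches; two different closed patches have empty intersection, or meet in exactly one
common vertex or one common edge. `ν` lists the vertices without repetition and
`vert i v` is the number of the corner `v` of the patch `i`. -/
structure Surface where
  Ω : Set E3
  isCompact : IsCompact Ω
  regular : closure (interior Ω) = Ω
  simplyConnected : SimplyConnectedSpace Ω
  I : ℕ
  patch : Fin I → Patch
  frontier_eq : frontier Ω = ⋃ i, closure (patch i).face
  inter : ∀ i l, i ≠ l →
    closure (patch i).face ∩ closure (patch l).face = ∅ ∨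
    (∃ v w, (patch i).corner v = (patch l).corner w ∧
      closure (patch i).face ∩ closure (patch l).face = {(patch i).corner v}) ∨
    (∃ v w, (patch i).edge v = (patch l).edge w ∧
      closure (patch i).face ∩ closure (patch l).face = (patch i).edge v)
  N : ℕ
  ν : Fin N → E3
  ν_injective : Function.Injective ν
  vert : Fin I → Fin 4 → Fin N
  vert_surj : ∀ n, ∃ i v, vert i v = n
  ν_vert : ∀ i v, ν (vert i v) = (patch i).corner v

/-- The open strip of polar coordinates `(r, φ)` of an infinite plane sector of opening `γ`. -/
def strip (γ : ℝ) : Set (ℝ × ℝ) := Ioi 0 ×ˢ Ioo 0 γ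

/-- The planar Lebesgue measure `r dr dφ` of the sector of opening `γ` in polar coordinates. -/
def polarMeasure (γ : ℝ) : Measure (ℝ × ℝ) :=
  (volume.restrict (strip γ)).withDensity fun x => ENNReal.ofReal x.1

/-- `∂_r^a ∂_φ^b η`. -/
def polarPartial (a b : ℕ) (η : ℝ × ℝ → ℝ) (x : ℝ × ℝ) : ℝ :=
  iteratedDeriv a (fun r => iteratedDeriv b (fun φ => η (r, φ)) x.2) x.1

/-- `g` is the weak derivative `∂_r^a ∂_φ^b f` on the strip `(0, ∞) × (0, γ)`. -/
def IsWeakPolarDeriv (γ : ℝ) (a b : ℕ) (f g : ℝ × ℝ → ℂ) : Prop :=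
  LocallyIntegrableOn f (strip γ) ∧ LocallyIntegrableOn g (strip γ) ∧
  ∀ η : ℝ × ℝ → ℝ, ContDiff ℝ ∞ η → HasCompactSupport η → tsupport η ⊆ strip γ →
    ∫ x in strip γ, (polarPartial a b η x : ℂ) * f x =
      (-1) ^ (a + b) * ∫ x in strip γ, (η x : ℂ) * g x

/-- The weight `r^{-μ} (1+r)^μ (q r)^a q^{b-ρ}` with `q = min {φ, γ - φ}`. -/
def polarWeight (γ ρ μ : ℝ) (a b : ℕ) (x : ℝ × ℝ) : ℝ :=
  x.1 ^ (-μ) * (1 + x.1) ^ μ * (min x.2 (γ - x.2) * x.1) ^ a *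
    (min x.2 (γ - x.2)) ^ ((b : ℝ) - ρ)

/-- The weighted `L₂`-norm over the sector of the weak derivative `∂_r^a ∂_φ^b f`; it is `∞` if
there is no such weak derivative (which is otherwise unique up to null sets). -/
def weightedDerivNorm (γ ρ μ : ℝ) (a b : ℕ) (f : ℝ × ℝ → ℂ) : ℝ≥0∞ :=
  ⨅ (g : ℝ × ℝ → ℂ) (_ : IsWeakPolarDeriv γ a b f g),
    eLpNorm (fun x => (polarWeight γ ρ μ a b x : ℂ) * g x) 2 (polarMeasure γ)

namespace Surface

variable (S : Surface)

/-- The surface `∂Ω`. -/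
def bdry : Set E3 := frontier S.Ω

/-- The union of the boundaries of all patches. -/
def skeleton : Set E3 := ⋃ i, (S.patch i).rim

/-- The parametrizations are `C^k` in the open square, with bounded derivatives up to order `k`. -/
def ParamSmooth (k : ℕ) : Prop :=
  ∀ i, ContDiffOn ℝ k (S.patch i).param openSquare ∧
    ∀ m ≤ k, ∃ C : ℝ, ∀ x ∈ openSquare, ‖iteratedFDeriv ℝ m (S.patch i).param x‖ ≤ C

/-- The surface measure: planar Lebesgue measure on every patch (the edges are null sets). -/
def σ : Measure E3 :=
  ∑ i, Measure.map (S.patch i).chart (volume.restrict (quad (S.patch i).q))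

/-- The inner product `∑ᵢ ⟨u ∘ κᵢ, v ∘ κᵢ⟩` with the `L₂`-inner product of the unit square. -/
def pairing (u v : E3 → ℂ) : ℂ :=
  ∑ i, ∫ x in square, u ((S.patch i).kappa x) * star (v ((S.patch i).kappa x))

/-- Patchwise smooth functions: continuous on the surface and smooth on every closed patch. -/
def PwSmooth (u : E3 → ℂ) : Prop :=
  ContinuousOn u S.bdry ∧
    ∀ i, ContDiffOn ℝ ∞ (fun z => u ((S.patch i).chart z)) (closure (quad (S.patch i).q))

/-- The pairs (patch, corner) located at the vertex `n`. They enumerate the faces of the tangent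
cone at that vertex: the patch `i` with corner `v` spans the face `coneFace i v`. -/
def corners (n : Fin S.N) : Finset (Fin S.I × Fin 4) :=
  Finset.univ.filter fun c => S.vert c.1 c.2 = n

/-- The opening angle of the cone face at the corner `v` of the patch `i`. -/
def angle (i : Fin S.I) (v : Fin 4) : ℝ := interiorAngle (S.patch i).q v

/-- Polar coordinates of the plane sector spanned by the patch `i` at its corner `v`. -/
def facePoint (i : Fin S.I) (v : Fin 4) (x : ℝ × ℝ) : E3 :=
  (S.patch i).chart (cornerPolar (S.patch i).q v x)

/-- The infinite open plane sector spanned by the patch `i` at its corner `v`: a face of the tangent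
cone at that corner. -/
def coneFace (i : Fin S.I) (v : Fin 4) : Set E3 := S.facePoint i v '' strip (S.angle i v)

/-- A special resolution of unity subordinate to the vertices. -/
structure Resolution where
  φ : Fin S.N → E3 → ℝ
  U₀ : Fin S.N → Set E3
  U₁ : Fin S.N → Set E3
  C₁ : ℝ
  C₁_pos : 0 < C₁
  smooth : ∀ n, S.PwSmooth fun x => (φ n x : ℂ)
  nonneg : ∀ n, ∀ x ∈ S.bdry, 0 ≤ φ n x
  sum_eq_one : ∀ x ∈ S.bdry, ∑ n, φ n x = 1
  isOpen_U₀ : ∀ n, ∃ O, IsOpen O ∧ U₀ n = O ∩ S.bdry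
  isOpen_U₁ : ∀ n, ∃ O, IsOpen O ∧ U₁ n = O ∩ S.bdry
  vertex_mem : ∀ n, S.ν n ∈ U₀ n
  U₀_ssubset : ∀ n, U₀ n ⊂ U₁ n
  U₁_ssubset : ∀ n, U₁ n ⊂ S.bdry
  far_patches : ∀ n l, S.ν n ∉ closure (S.patch l).face →
    ∀ x ∈ U₁ n, ∀ y ∈ (S.patch l).face, C₁ ≤ dist x y
  far_outside : ∀ n, ∀ c ∈ S.corners n,
    ∀ x ∈ U₁ n ∩ S.coneFace c.1 c.2, ∀ y ∈ (S.patch c.1).face \ S.coneFace c.1 c.2, C₁ ≤ dist x y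
  in_cone : ∀ n, ∀ c ∈ S.corners n,
    U₁ n ∩ closure (S.patch c.1).face ⊆ closure (S.coneFace c.1 c.2)
  eq_one : ∀ n, ∀ x ∈ U₀ n, φ n x = 1
  eq_zero : ∀ n, ∀ x ∈ S.bdry \ U₁ n, φ n x = 0

/-! ### Weighted Sobolev spaces -/

/-- The norm of `X^k_{ρ,μ}` on the boundary of the tangent cone at the vertex `n`, for a function
given facewise in polar coordinates: `f i v` is its representation on the face `coneFace i v`. -/
def coneNorm (n : Fin S.N) (k : ℕ) (ρ μ : ℝ) (f : Fin S.I → Fin 4 → ℝ × ℝ → ℂ) : ℝ≥0∞ :=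
  (∑ c ∈ S.corners n,
      eLpNorm (f c.1 c.2) 2 (polarMeasure (S.angle c.1 c.2)) ^ (2 : ℝ)) ^ (1 / 2 : ℝ) +
    ∑ c ∈ S.corners n,
      ∑ β ∈ (Finset.range (k + 1) ×ˢ Finset.range (k + 1)).filter
          (fun β => 1 ≤ β.1 + β.2 ∧ β.1 + β.2 ≤ k),
        weightedDerivNorm (S.angle c.1 c.2) ρ μ β.1 β.2 (f c.1 c.2)

/-- A function on the surface as a function on the cone faces, in polar coordinates: on a face it is
given by its values on the patch that spans the face, and extended by zero. -/
def facewise (g : E3 → ℂ) (i : Fin S.I) (v : Fin 4) (x : ℝ × ℝ) : ℂ :=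
  (closure (S.patch i).face).indicator g (S.facePoint i v x)

variable {S} in
/-- The norm of `X^k_ρ(∂Ω)`. -/
def Resolution.xNorm (R : S.Resolution) (k : ℕ) (ρ : ℝ) (u : E3 → ℂ) : ℝ≥0∞ :=
  ∑ n, S.coneNorm n k ρ ρ (S.facewise fun x => (R.φ n x : ℂ) * u x)

variable {S} in
/-- Membership in `X^k_ρ(∂Ω)`, the closure of the patchwise smooth functions in this norm. -/
def Resolution.MemX (R : S.Resolution) (k : ℕ) (ρ : ℝ) (u : E3 → ℂ) : Prop :=
  MemLp u 2 S.σ ∧ R.xNorm k ρ u < ⊤ ∧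
    ∀ ε : ℝ≥0∞, 0 < ε → ∃ w, S.PwSmooth w ∧ R.xNorm k ρ (u - w) < ε

/-! ### Wavelet bases -/

/-- A Riesz basis of `L₂(∂Ω)`. -/
def IsRieszBasis {J : Type} (f : J → E3 → ℂ) : Prop :=
  (∀ a, MemLp (f a) 2 S.σ) ∧
  (∃ c C : ℝ, 0 < c ∧ 0 < C ∧ ∀ (A : Finset J) (t : J → ℂ),
    ENNReal.ofReal (c * ∑ a ∈ A, ‖t a‖ ^ 2) ≤ eLpNorm (∑ a ∈ A, t a • f a) 2 S.σ ^ 2 ∧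
    eLpNorm (∑ a ∈ A, t a • f a) 2 S.σ ^ 2 ≤ ENNReal.ofReal (C * ∑ a ∈ A, ‖t a‖ ^ 2)) ∧
  ∀ u, MemLp u 2 S.σ → ∀ ε : ℝ≥0∞, 0 < ε →
    ∃ (A : Finset J) (t : J → ℂ), eLpNorm (u - ∑ a ∈ A, t a • f a) 2 S.σ < ε

/-- The (closed) support of a function on the surface. -/
def supp (u : E3 → ℂ) : Set E3 := closure {x | x ∈ S.bdry ∧ u x ≠ 0}

/-- A biorthogonal wavelet basis on the surface whose dual wavelets have `d` vanishing moments.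
`gen`, `dgen` are the finitely many primal and dual generators of the coarsest level `j₀ - 1`;
the wavelets of level `j ≥ j₀` are numbered by `Fin (num j)`, and `grid j ξ` is the grid point with
number `ξ`. -/
structure WaveletBasis (d : ℕ) where
  numGen : ℕ
  gen : Fin numGen → E3 → ℂ
  dgen : Fin numGen → E3 → ℂ
  j₀ : ℕ
  num : ℕ → ℕ
  ψ : (j : ℕ) → Fin (num j) → E3 → ℂ
  ψd : (j : ℕ) → Fin (num j) → E3 → ℂ
  primal_riesz : S.IsRieszBasis
    (Sum.elim gen fun a : Σ j : Ici j₀, Fin (num j) => ψ a.1 a.2)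
  dual_riesz : S.IsRieszBasis
    (Sum.elim dgen fun a : Σ j : Ici j₀, Fin (num j) => ψd a.1 a.2)
  biorthogonal_same : ∀ a : Fin numGen ⊕ Σ j : Ici j₀, Fin (num j),
    S.pairing (Sum.elim gen (fun a => ψ a.1 a.2) a) (Sum.elim dgen (fun a => ψd a.1 a.2) a) = 1
  biorthogonal_ne : ∀ a b : Fin numGen ⊕ Σ j : Ici j₀, Fin (num j), a ≠ b →
    S.pairing (Sum.elim gen (fun a => ψ a.1 a.2) a) (Sum.elim dgen (fun a => ψd a.1 a.2) b) = 0
  /- the index sets, split according to the patches -/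
  grid : (j : ℕ) → Fin (num j) → E3
  nabla : (j : ℕ) → Fin S.I → Finset (Fin (num j))
  nabla_cover : ∀ j ≥ j₀, ∀ ξ, ∃ i, ξ ∈ nabla j i
  grid_mem_patch : ∀ j ≥ j₀, ∀ i, ∀ ξ ∈ nabla j i, grid j ξ ∈ closure (S.patch i).face
  nabla_card : ∃ c C : ℝ, 0 < c ∧ ∀ j ≥ j₀, ∀ i,
    c * 2 ^ (2 * j) ≤ ((nabla j i).card : ℝ) ∧ ((nabla j i).card : ℝ) ≤ C * 2 ^ (2 * j)
  /- normalization of the dual wavelets -/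
  normalized : ∃ c C : ℝ, 0 < c ∧ ∀ j ≥ j₀, ∀ ξ,
    ENNReal.ofReal c ≤ eLpNorm (ψd j ξ) 2 S.σ ∧ eLpNorm (ψd j ξ) 2 S.σ ≤ ENNReal.ofReal C
  /- supports of the dual wavelets: area and diameter (measured along the surface, so that a support
  is contained in a connected piece of the surface of that diameter) -/
  grid_mem_supp : ∀ j ≥ j₀, ∀ ξ, grid j ξ ∈ S.supp (ψd j ξ)
  supp_area : ∃ c C : ℝ, 0 < c ∧ ∀ j ≥ j₀, ∀ ξ,
    ENNReal.ofReal (c * (1 / 2) ^ (2 * j)) ≤ S.σ (S.supp (ψd j ξ)) ∧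
    S.σ (S.supp (ψd j ξ)) ≤ ENNReal.ofReal (C * (1 / 2) ^ (2 * j))
  supp_diam : ∃ C : ℝ, ∀ j ≥ j₀, ∀ ξ, ∃ K : Set E3, IsConnected K ∧ K ⊆ S.bdry ∧
    S.supp (ψd j ξ) ⊆ K ∧ Metric.diam K ≤ C * (1 / 2) ^ j
  /- vanishing moments of the dual wavelets supported in the interior of a patch -/
  moments : ∀ j ≥ j₀, ∀ ξ, ∀ i, S.supp (ψd j ξ) ⊆ (S.patch i).face →
    ∀ P : MvPolynomial (Fin 2) ℂ, P.totalDegree < d →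
      ∫ x in square, MvPolynomial.eval ![(x.1 : ℂ), (x.2 : ℂ)] P *
        star (ψd j ξ ((S.patch i).kappa x)) = 0
  /- number of dual wavelets near and at the patch boundaries -/
  near_upper : ∀ C : ℝ, 0 < C → ∃ C' : ℝ, ∀ j ≥ j₀,
    ({ξ | 0 < setDist (S.supp (ψd j ξ)) S.skeleton ∧
      setDist (S.supp (ψd j ξ)) S.skeleton ≤ ENNReal.ofReal (C * (1 / 2) ^ j)}.ncard : ℝ)
        ≤ C' * 2 ^ j
  near_lower : ∃ C c : ℝ, 0 < c ∧ ∀ j ≥ j₀, c * 2 ^ j ≤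
    ({ξ | 0 < setDist (S.supp (ψd j ξ)) S.skeleton ∧
      setDist (S.supp (ψd j ξ)) S.skeleton ≤ ENNReal.ofReal (C * (1 / 2) ^ j)}.ncard : ℝ)
  touching : ∃ C : ℝ, ∀ j ≥ j₀,
    ({ξ | (S.supp (ψd j ξ) ∩ S.skeleton).Nonempty}.ncard : ℝ) ≤ C * 2 ^ j
  /- finite overlap -/
  overlap : ∃ C : ℕ, ∀ j ≥ j₀, ∀ x ∈ S.bdry, {ξ | x ∈ S.supp (ψd j ξ)}.ncard ≤ C

end Surface

/-! ### Besov-type spaces -/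

/-- Admissible parameters `(α, p, q)`; `q = ∞` is allowed unless `1/p = α/2 + 1/2`. -/
def Admissible (α p : ℝ) (q : ℝ≥0∞) : Prop :=
  1 / 2 ≤ 1 / p ∧ 1 / p ≤ α / 2 + 1 / 2 ∧ 0 < q ∧ (1 / p = α / 2 + 1 / 2 → q ≤ 2)

namespace Surface.WaveletBasis

variable {S : Surface} {d : ℕ} (Ψ : S.WaveletBasis d)

/-- The biorthogonal projector onto the span of the generators. -/
def proj (u : E3 → ℂ) : E3 → ℂ := ∑ a, S.pairing u (Ψ.dgen a) • Ψ.gen a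

/-- `∑_ξ |⟨u, ψd j ξ⟩|^p`, the contribution of the level `j`. -/
def levelSum (p : ℝ) (u : E3 → ℂ) (j : ℕ) : ℝ≥0∞ :=
  ∑ ξ, ‖S.pairing u (Ψ.ψd j ξ)‖ₑ ^ p

/-- The (quasi-)norm of the Besov-type space `B^α_{Ψ,q}(L_p(∂Ω))`. -/
def besovNorm (α p : ℝ) (q : ℝ≥0∞) (u : E3 → ℂ) : ℝ≥0∞ :=
  eLpNorm (Ψ.proj u) (ENNReal.ofReal p) S.σ +
    if q = ⊤ then
      ⨆ j : Ici Ψ.j₀, ENNReal.ofReal ((2 : ℝ) ^ ((j : ℕ) * (α + 2 * (1 / 2 - 1 / p)))) *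
        Ψ.levelSum p u j ^ (1 / p)
    else
      (∑' j : Ici Ψ.j₀,
        ENNReal.ofReal ((2 : ℝ) ^ ((j : ℕ) * (α + 2 * (1 / 2 - 1 / p)) * q.toReal)) *
          Ψ.levelSum p u j ^ (q.toReal / p)) ^ (1 / q.toReal)

/-- Membership in `B^α_{Ψ,q}(L_p(∂Ω))`. -/
def MemBesov (α p : ℝ) (q : ℝ≥0∞) (u : E3 → ℂ) : Prop :=
  MemLp u 2 S.σ ∧ Ψ.besovNorm α p q u < ⊤

end Surface.WaveletBasis

end PolySurf

end

/-! On the line `1 / τ = α / 2 + 1 / 2` the level weights of the target quasi-norm are all `1`.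
Apart from the coarse projection, the target is therefore the plain `ℓ_τ` quasi-norm of the wavelet
coefficients. The projection is harmless: it has finitely many terms, the surface has finite
measure, and the `L₂`-norm is bounded by the weighted Sobolev norm
(`Resolution.exists_eLpNorm_le_xNorm`).

If `p ≤ τ`, the nesting of `ℓ_p` in `ℓ_τ` suffices, because admissibility makes the weights of the
source norm at least `1` (`tsum_levelSum_le_of_le`). If `τ < p`, each level, of mesh size `h =
2^{-j}`, is split according to the distance of the supports from the patch boundaries.

Near the boundaries there are only `O(2^j)` wavelets, and Hölder's inequality against the `ℓ_p`-norm
yields `h ^ (τ (s + 1 - 1/p) - 1)` (`sum_le_of_card_le`). The exponent is positive exactly when `α <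
2 (s - (1/p - 1/2))`.

Away from them a support lies in one patch, at distance about `δ ≥ h` from its rim. Vanishing
moments allow subtraction of a polynomial in the parameter square, so a coefficient is at most a
multiple of `h ^ k δ ^ (-(k - ρ))` times a local `L₂`-norm of `dist ^ (k - ρ) |D^k (u ∘ κ)|`
(`IsInterior.enorm_pairing_sq_le`, `IsInterior.lintegral_le`). Hölder's inequality with exponents `2
/ (2 - τ)` and `2 / τ` separates the powers of `δ` from these local energies
(`exists_patch_sum_le`). The energies overlap finitely often. The sum of `δ ^ (-e)`, `e = 2 (k - ρ)
τ / (2 - τ)`, compares with an integral of a power of the distance to the rim and is `O(h ^ (-1 -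
e))` if `e > 1`, that is, if `α < 2 (k - ρ)`. The result is `h ^ (ρ τ - 1 + τ / 2)`, with positive
exponent exactly when `α < 2 ρ`. Both contributions are then summed over `j` as geometric series.

The global energy is controlled by the weighted Sobolev norm
(`Resolution.exists_lintegral_kappa_le`). Where a vertex cut-off lives, the distance to the rim is
at most a constant times `r q`, and a Cartesian derivative of order `m` is `r ^ (-m)` times polar
derivatives `r ^ a ∂_r^a ∂_φ^b`; the powers of `q` then cancel. All of this is done for patchwise
smooth functions, whose weak derivatives are classical, and carried over by density, the
coefficients being continuous in `L₂`. -/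

noncomputable section

namespace PolySurf

/-! ### Partial derivatives in the plane -/

section Partial

variable {V : Type*} [NormedAddCommGroup V] [NormedSpace ℝ V]

/-- The directional derivative as an operator on functions of two real variables. -/
def pd (v : ℝ × ℝ) (F : ℝ × ℝ → V) (x : ℝ × ℝ) : V := fderiv ℝ F x v

/-- The partial derivative `∂₁^a ∂₂^b`. -/
def mixedPd (a b : ℕ) (F : ℝ × ℝ → V) : ℝ × ℝ → V :=
  (pd (1, 0))^[a] ((pd (0, 1))^[b] F)

variable {U : Set (ℝ × ℝ)} {F G : ℝ × ℝ → V}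

theorem contDiffOn_pd (hU : IsOpen U) (hF : ContDiffOn ℝ ∞ F U) (v : ℝ × ℝ) :
    ContDiffOn ℝ ∞ (pd v F) U :=
  (hF.fderiv_of_isOpen hU (m := ∞) (by simp)).clm_apply contDiffOn_const

theorem contDiffOn_pd_iterate (hU : IsOpen U) (hF : ContDiffOn ℝ ∞ F U) (v : ℝ × ℝ) (a : ℕ) :
    ContDiffOn ℝ ∞ ((pd v)^[a] F) U := by
  induction a with
  | zero => exact hF
  | succ a ih => rw [Function.iterate_succ_apply']; exact contDiffOn_pd hU ih v

theorem contDiffOn_mixedPd (hU : IsOpen U) (hF : ContDiffOn ℝ ∞ F U) (a b : ℕ) :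
    ContDiffOn ℝ ∞ (mixedPd a b F) U :=
  contDiffOn_pd_iterate hU (contDiffOn_pd_iterate hU hF _ b) _ a

theorem pd_congr (hU : IsOpen U) (h : EqOn F G U) (v : ℝ × ℝ) : EqOn (pd v F) (pd v G) U := by
  intro x hx
  have : F =ᶠ[nhds x] G := h.eventuallyEq_of_mem (hU.mem_nhds hx)
  simp only [pd, this.fderiv_eq]

theorem pd_iterate_congr (hU : IsOpen U) (h : EqOn F G U) (v : ℝ × ℝ) (a : ℕ) :
    EqOn ((pd v)^[a] F) ((pd v)^[a] G) U := by
  induction a with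
  | zero => exact h
  | succ a ih => simp only [Function.iterate_succ_apply']; exact pd_congr hU ih v

theorem two_le_infty : (2 : WithTop ℕ∞) ≤ ((⊤ : ℕ∞) : WithTop ℕ∞) :=
  show ((2 : ℕ∞) : WithTop ℕ∞) ≤ ((⊤ : ℕ∞) : WithTop ℕ∞) from WithTop.coe_le_coe.2 le_top

theorem pd_comm (hU : IsOpen U) (hF : ContDiffOn ℝ ∞ F U) (v w : ℝ × ℝ) :
    EqOn (pd v (pd w F)) (pd w (pd v F)) U := by
  intro x hx
  have hx' : ContDiffAt ℝ ∞ F x := hF.contDiffAt (hU.mem_nhds hx)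
  have hd : DifferentiableAt ℝ (fderiv ℝ F) x :=
    (hx'.fderiv_right (m := 1) (by rw [one_add_one_eq_two]; exact two_le_infty)).differentiableAt (by simp)
  have key : ∀ v w : ℝ × ℝ, pd v (pd w F) x = fderiv ℝ (fderiv ℝ F) x v w := by
    intro v w
    have h1 : HasFDerivAt (fun y => fderiv ℝ F y w)
        ((ContinuousLinearMap.apply ℝ V w).comp (fderiv ℝ (fderiv ℝ F) x)) x :=
      (ContinuousLinearMap.apply ℝ V w).hasFDerivAt.comp x hd.hasFDerivAt
    change fderiv ℝ (fun y => fderiv ℝ F y w) x v = _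
    rw [h1.fderiv]; rfl
  rw [key, key]
  exact (hx'.isSymmSndFDerivAt (by simpa using two_le_infty)).eq v w

theorem pd_iterate_comm (hU : IsOpen U) (hF : ContDiffOn ℝ ∞ F U) (v w : ℝ × ℝ) (a : ℕ) :
    EqOn (pd v ((pd w)^[a] F)) ((pd w)^[a] (pd v F)) U := by
  induction a with
  | zero => exact fun _ _ => rfl
  | succ a ih =>
    simp only [Function.iterate_succ_apply']
    exact (pd_comm hU (contDiffOn_pd_iterate hU hF w a) v w).trans (pd_congr hU ih w)

/-- Partial derivatives of a smooth function commute, so any word in the two basis directions can be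
sorted; only the number of occurrences of each direction matters. -/
theorem iteratedFDeriv_basis_eq_mixedPd (hU : IsOpen U) (hF : ContDiffOn ℝ ∞ F U) (m : ℕ)
    (v : Fin m → ℝ × ℝ) (hv : ∀ i, v i = (1, 0) ∨ v i = (0, 1)) :
    ∃ a b, a + b = m ∧ ∀ x ∈ U, iteratedFDeriv ℝ m F x v = mixedPd a b F x := by
  induction m with
  | zero => exact ⟨0, 0, rfl, fun x _ => by simp [mixedPd]⟩
  | succ m ih =>
    obtain ⟨a, b, hab, h⟩ := ih (Fin.tail v) (fun i => hv _)
    have h0 : ∀ x ∈ U, iteratedFDeriv ℝ (m + 1) F x v = pd (v 0) (mixedPd a b F) x := by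
      intro x hx
      have hx' : ContDiffAt ℝ ∞ F x := hF.contDiffAt (hU.mem_nhds hx)
      have hd : DifferentiableAt ℝ (iteratedFDeriv ℝ m F) x :=
        hx'.differentiableAt_iteratedFDeriv (by exact_mod_cast ENat.natCast_lt_top m)
      have h1 : HasFDerivAt (fun y => iteratedFDeriv ℝ m F y (Fin.tail v))
          ((ContinuousMultilinearMap.apply ℝ (fun _ : Fin m => ℝ × ℝ) V (Fin.tail v)).comp
            (fderiv ℝ (iteratedFDeriv ℝ m F) x)) x :=
        (ContinuousMultilinearMap.apply ℝ (fun _ : Fin m => ℝ × ℝ) V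
          (Fin.tail v)).hasFDerivAt.comp x hd.hasFDerivAt
      have h2 := pd_congr hU (F := fun y => iteratedFDeriv ℝ m F y (Fin.tail v))
        (G := mixedPd a b F) (fun y hy => h y hy) (v 0) hx
      rw [← h2, iteratedFDeriv_succ_apply_left]
      simp only [pd]
      rw [h1.fderiv]; rfl
    rcases hv 0 with h1 | h1
    · refine ⟨a + 1, b, by omega, fun x hx => ?_⟩
      rw [h0 x hx, h1]
      simp only [mixedPd, Function.iterate_succ_apply']
    · refine ⟨a, b + 1, by omega, fun x hx => ?_⟩
      rw [h0 x hx, h1]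
      simp only [mixedPd]
      rw [pd_iterate_comm hU (contDiffOn_pd_iterate hU hF _ b) _ _ a hx,
        Function.iterate_succ_apply']

/-- Here `s` is the set of slots that receive the first basis vector. The expansion serves twice: to
bound operator norms by mixed partials, and to exhibit Taylor terms as polynomials. -/
theorem multilinear_expand {m : ℕ} (T : ContinuousMultilinearMap ℝ (fun _ : Fin m => ℝ × ℝ) V)
    (v : Fin m → ℝ × ℝ) :
    T v = ∑ s : Finset (Fin m), ((∏ i, if i ∈ s then (v i).1 else (v i).2) : ℝ) •
      T (s.piecewise (fun _ => (1, 0)) (fun _ => (0, 1))) := by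
  have h1 : v = (fun i => (v i).1 • ((1, 0) : ℝ × ℝ)) + (fun i => (v i).2 • ((0, 1) : ℝ × ℝ)) := by
    ext i <;> simp
  conv_lhs => rw [h1]
  rw [← T.coe_coe, MultilinearMap.map_add_univ]
  refine Finset.sum_congr rfl fun s _ => ?_
  rw [← MultilinearMap.map_smul_univ]
  congr 1
  ext i <;> by_cases h : i ∈ s <;> simp [Finset.piecewise, h]

theorem norm_iteratedFDeriv_le_of_mixedPd (hU : IsOpen U) (hF : ContDiffOn ℝ ∞ F U) (m : ℕ)
    {x : ℝ × ℝ} (hx : x ∈ U) {M : ℝ} (hM : ∀ a b, a + b = m → ‖mixedPd a b F x‖ ≤ M) :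
    ‖iteratedFDeriv ℝ m F x‖ ≤ 2 ^ m * M := by
  have hM0 : 0 ≤ M := (norm_nonneg _).trans (hM 0 m (by simp))
  refine ContinuousMultilinearMap.opNorm_le_bound (by positivity) fun v => ?_
  rw [multilinear_expand]
  refine (norm_sum_le _ _).trans ?_
  have : ∀ s ∈ (Finset.univ : Finset (Finset (Fin m))),
      ‖((∏ i, if i ∈ s then (v i).1 else (v i).2) : ℝ) •
        iteratedFDeriv ℝ m F x (s.piecewise (fun _ => (1, 0)) (fun _ => (0, 1)))‖ ≤
        M * ∏ i, ‖v i‖ := by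
    intro s _
    rw [norm_smul, mul_comm]
    gcongr
    · obtain ⟨a, b, hab, h⟩ := iteratedFDeriv_basis_eq_mixedPd hU hF m
        (s.piecewise (fun _ => ((1, 0) : ℝ × ℝ)) (fun _ => (0, 1)))
        (fun i => by by_cases h : i ∈ s <;> simp [h])
      rw [h x hx]; exact hM a b hab
    · rw [Real.norm_eq_abs, Finset.abs_prod]
      refine Finset.prod_le_prod (fun _ _ => abs_nonneg _) fun i _ => ?_
      split_ifs
      · exact norm_fst_le (v i)
      · exact norm_snd_le (v i)
  refine (Finset.sum_le_sum this).trans ?_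
  -- The factor `2 ^ m` is the number of subsets of the `m` slots.
  simp [mul_assoc]

end Partial

/-! ### Weak derivatives in polar coordinates -/

section Weak

theorem polarPartial_eq_mixedPd (a b : ℕ) {η : ℝ × ℝ → ℝ} (hη : ContDiff ℝ ∞ η) :
    polarPartial a b η = mixedPd a b η := by
  have key : ∀ (m : ℕ) (ζ : ℝ × ℝ → ℝ), ContDiff ℝ ∞ ζ →
      (∀ x : ℝ × ℝ, iteratedDeriv m (fun φ => ζ (x.1, φ)) x.2 = (pd (0, 1))^[m] ζ x) ∧
      (∀ x : ℝ × ℝ, iteratedDeriv m (fun r => ζ (r, x.2)) x.1 = (pd (1, 0))^[m] ζ x) := by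
    intro m ζ hζ
    have hc : ∀ v n, Differentiable ℝ ((pd v)^[n] ζ) := fun v n =>
      (contDiffOn_univ.1 (contDiffOn_pd_iterate isOpen_univ hζ.contDiffOn v n)).differentiable
        (by simp)
    induction m with
    | zero => simp
    | succ m ih =>
      constructor
      · intro x
        rw [iteratedDeriv_succ, Function.iterate_succ_apply']
        have : iteratedDeriv m (fun φ => ζ (x.1, φ)) = fun φ => (pd (0, 1))^[m] ζ (x.1, φ) := by
          ext φ; exact ih.1 (x.1, φ)
        rw [this]
        have h2 : HasDerivAt (fun φ : ℝ => (x.1, φ)) ((0 : ℝ), (1 : ℝ)) x.2 :=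
          (hasDerivAt_const _ _).prodMk (hasDerivAt_id _)
        exact ((hc (0, 1) m (x.1, x.2)).hasFDerivAt.comp_hasDerivAt x.2 h2).deriv
      · intro x
        rw [iteratedDeriv_succ, Function.iterate_succ_apply']
        have : iteratedDeriv m (fun r => ζ (r, x.2)) = fun r => (pd (1, 0))^[m] ζ (r, x.2) := by
          ext r; exact ih.2 (r, x.2)
        rw [this]
        have h2 : HasDerivAt (fun r : ℝ => (r, x.2)) ((1 : ℝ), (0 : ℝ)) x.1 :=
          (hasDerivAt_id _).prodMk (hasDerivAt_const _ _)
        exact ((hc (1, 0) m (x.1, x.2)).hasFDerivAt.comp_hasDerivAt x.1 h2).deriv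
  ext x
  have h1 : ∀ r φ : ℝ, iteratedDeriv b (fun φ => η (r, φ)) φ = (pd (0, 1))^[b] η (r, φ) :=
    fun r φ => (key b η hη).1 (r, φ)
  simp only [polarPartial, h1]
  exact (key a _ (contDiffOn_univ.1
    (contDiffOn_pd_iterate isOpen_univ hη.contDiffOn (0, 1) b))).2 x

theorem tsupport_pd_subset (v : ℝ × ℝ) (η : ℝ × ℝ → ℝ) : tsupport (pd v η) ⊆ tsupport η := by
  refine (closure_mono ?_).trans (tsupport_fderiv_subset ℝ (f := η))
  intro x hx
  simp only [Function.mem_support, pd] at hx ⊢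
  intro h; simp [h] at hx

theorem continuous_mul_of_tsupport {P : Set (ℝ × ℝ)} (hP : IsOpen P) {f : ℝ × ℝ → ℂ}
    (hf : ContinuousOn f P) {η : ℝ × ℝ → ℝ} (hη : Continuous η) (hs : tsupport η ⊆ P) :
    Continuous fun x => (η x : ℂ) * f x := by
  refine continuous_of_tsupport fun x hx => ?_
  have hx' : x ∈ P := hs (closure_mono (fun y hy => by
    simp only [Function.mem_support] at hy ⊢; intro h; simp [h] at hy) hx)
  exact (Complex.continuous_ofReal.comp hη).continuousAt.mul (hf.continuousAt (hP.mem_nhds hx'))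

theorem integrable_mul_of_tsupport {P : Set (ℝ × ℝ)} (hP : IsOpen P) {f : ℝ × ℝ → ℂ}
    (hf : ContinuousOn f P) {η : ℝ × ℝ → ℝ} (hη : Continuous η) (hc : HasCompactSupport η)
    (hs : tsupport η ⊆ P) : Integrable fun x => (η x : ℂ) * f x := by
  refine (continuous_mul_of_tsupport hP hf hη hs).integrable_of_hasCompactSupport ?_
  refine hc.mono fun y hy => ?_
  simp only [Function.mem_support] at hy ⊢; intro h; simp [h] at hy

theorem integral_pd_mul {P : Set (ℝ × ℝ)} (hP : IsOpen P) {f : ℝ × ℝ → ℂ}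
    (hf : ContDiffOn ℝ ∞ f P) {η : ℝ × ℝ → ℝ} (hη : ContDiff ℝ ∞ η) (hc : HasCompactSupport η)
    (hs : tsupport η ⊆ P) (v : ℝ × ℝ) :
    ∫ x, ((pd v η x : ℝ) : ℂ) * f x = - ∫ x, (η x : ℂ) * pd v f x := by
  have hη' : Continuous (pd v η) :=
    (contDiffOn_univ.1 (contDiffOn_pd isOpen_univ hη.contDiffOn v)).continuous
  have hs' := (tsupport_pd_subset v η).trans hs
  have hc' : HasCompactSupport (pd v η) := hc.of_isClosed_subset (isClosed_tsupport _)
    (tsupport_pd_subset v η)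
  -- This form of integration by parts asks for differentiability of `f` only on the support of `η`,
  -- so the behaviour of `f` outside `P` is irrelevant.
  have := integral_bilinear_hasFDerivAt_right_eq_neg_left_of_integrable (μ := volume)
    (f := f) (f' := fderiv ℝ f) (g := η) (g' := fderiv ℝ η) (v := v)
    (B := (ContinuousLinearMap.lsmul ℝ ℝ (E := ℂ)).flip)
    (by simpa [pd] using
      integrable_mul_of_tsupport hP (contDiffOn_pd hP hf v).continuousOn hη.continuous hc hs)
    (by simpa [pd] using integrable_mul_of_tsupport hP hf.continuousOn hη' hc' hs')
    (by simpa using integrable_mul_of_tsupport hP hf.continuousOn hη.continuous hc hs)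
    (fun x hx => ((hf.contDiffAt (hP.mem_nhds (hs hx))).differentiableAt (by simp)).hasFDerivAt)
    (fun x hx => (hη.contDiffAt.differentiableAt (by simp)).hasFDerivAt)
  simpa [pd] using this

theorem integral_pd_iterate_mul {P : Set (ℝ × ℝ)} (hP : IsOpen P) (v : ℝ × ℝ) (a : ℕ)
    {η : ℝ × ℝ → ℝ} (hη : ContDiff ℝ ∞ η) (hc : HasCompactSupport η) (hs : tsupport η ⊆ P)
    {f : ℝ × ℝ → ℂ} (hf : ContDiffOn ℝ ∞ f P) :
    ∫ x, (((pd v)^[a] η x : ℝ) : ℂ) * f x = (-1) ^ a * ∫ x, (η x : ℂ) * (pd v)^[a] f x := by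
  induction a generalizing η with
  | zero => simp
  | succ a ih =>
    have h1 : ContDiff ℝ ∞ (pd v η) :=
      contDiffOn_univ.1 (contDiffOn_pd isOpen_univ hη.contDiffOn v)
    have := ih h1 (hc.of_isClosed_subset (isClosed_tsupport _) (tsupport_pd_subset v η))
      ((tsupport_pd_subset v η).trans hs)
    rw [Function.iterate_succ_apply, this,
      integral_pd_mul hP (contDiffOn_pd_iterate hP hf v a) hη hc hs, pow_succ]
    simp only [Function.iterate_succ_apply']
    ring

theorem integral_mixedPd_mul {P : Set (ℝ × ℝ)} (hP : IsOpen P) (a b : ℕ)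
    {η : ℝ × ℝ → ℝ} (hη : ContDiff ℝ ∞ η) (hc : HasCompactSupport η) (hs : tsupport η ⊆ P)
    {f : ℝ × ℝ → ℂ} (hf : ContDiffOn ℝ ∞ f P) :
    ∫ x, ((mixedPd a b η x : ℝ) : ℂ) * f x = (-1) ^ (a + b) * ∫ x, (η x : ℂ) * mixedPd a b f x := by
  have hsupp : ∀ n : ℕ, tsupport ((pd (0, 1))^[n] η) ⊆ tsupport η := by
    intro n
    induction n with
    | zero => exact subset_rfl
    | succ n ih => rw [Function.iterate_succ_apply']; exact (tsupport_pd_subset _ _).trans ih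
  have h1 : ContDiff ℝ ∞ ((pd (0, 1))^[b] η) :=
    contDiffOn_univ.1 (contDiffOn_pd_iterate isOpen_univ hη.contDiffOn _ b)
  unfold mixedPd
  rw [integral_pd_iterate_mul hP (1, 0) a h1
    (hc.of_isClosed_subset (isClosed_tsupport _) (hsupp b)) ((hsupp b).trans hs) hf,
    integral_pd_iterate_mul hP (0, 1) b hη hc hs (contDiffOn_pd_iterate hP hf _ a), pow_add,
    mul_assoc]
  congr 2
  refine integral_congr_ae (Filter.Eventually.of_forall fun x => ?_)
  -- Integrating by parts twice leaves the derivatives of `f` in the opposite order. They commute on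
  -- `P`, and off the support of `η` the integrand vanishes.
  by_cases hx : x ∈ tsupport η
  · have : ∀ n : ℕ, EqOn ((pd (0, 1))^[n] ((pd (1, 0))^[a] f)) ((pd (1, 0))^[a] ((pd (0, 1))^[n] f))
        P := by
      intro n
      induction n with
      | zero => exact fun _ _ => rfl
      | succ n ih =>
        simp only [Function.iterate_succ_apply']
        exact (pd_congr hP ih _).trans (pd_iterate_comm hP (contDiffOn_pd_iterate hP hf _ n) _ _ a)
    simp only [this b (hs hx)]
  · simp [image_eq_zero_of_notMem_tsupport hx]

/-- On an open set where the function is smooth, a weak derivative is the classical one. -/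
theorem IsWeakPolarDeriv.ae_eq_mixedPd {γ : ℝ} {a b : ℕ} {f g : ℝ × ℝ → ℂ}
    (h : IsWeakPolarDeriv γ a b f g) {P : Set (ℝ × ℝ)} (hP : IsOpen P) (hPs : P ⊆ strip γ)
    (hf : ContDiffOn ℝ ∞ f P) : ∀ᵐ x, x ∈ P → g x = mixedPd a b f x := by
  have hm : ContinuousOn (mixedPd a b f) P := (contDiffOn_mixedPd hP hf a b).continuousOn
  have hg : LocallyIntegrableOn g P := h.2.1.mono_set hPs
  have hd : LocallyIntegrableOn (fun x => g x - mixedPd a b f x) P :=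
    hg.sub (hm.locallyIntegrableOn hP.measurableSet)
  -- Fundamental lemma of the calculus of variations on `P`: weak and classical derivative have the
  -- same integrals against test functions supported there.
  have := hP.ae_eq_zero_of_integral_contDiff_smul_eq_zero hd (fun η hη hc hs => ?_)
  · filter_upwards [this] with x hx hxP using sub_eq_zero.1 (hx hxP)
  have h1 := h.2.2 η hη hc (hs.trans hPs)
  have restr : ∀ (F : ℝ × ℝ → ℂ) (ζ : ℝ × ℝ → ℝ), tsupport ζ ⊆ tsupport η →
      ∫ x in strip γ, (ζ x : ℂ) * F x = ∫ x, (ζ x : ℂ) * F x := by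
    intro F ζ hζ
    refine setIntegral_eq_integral_of_forall_compl_eq_zero fun x hx => ?_
    rw [image_eq_zero_of_notMem_tsupport (fun hx' => hx (hPs (hs (hζ hx'))))]
    simp
  have hsupp : tsupport (mixedPd a b η) ⊆ tsupport η := by
    have : ∀ (v : ℝ × ℝ) (ζ : ℝ × ℝ → ℝ) (n : ℕ), tsupport ((pd v)^[n] ζ) ⊆ tsupport ζ := by
      intro v ζ n
      induction n with
      | zero => exact subset_rfl
      | succ n ih => rw [Function.iterate_succ_apply']; exact (tsupport_pd_subset _ _).trans ih
    exact (this _ _ a).trans (this _ _ b)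
  rw [polarPartial_eq_mixedPd a b hη, restr _ _ hsupp, restr _ _ subset_rfl,
    integral_mixedPd_mul hP a b hη hc hs hf] at h1
  have h2 := mul_left_cancel₀ (pow_ne_zero _ (by norm_num)) h1
  have i1 : Integrable fun x => (η x : ℂ) * g x := by
    have h3 : IntegrableOn (fun x => (η x : ℂ) * g x) (tsupport η) :=
      (hg.integrableOn_compact_subset hs hc).continuousOn_mul
        (Complex.continuous_ofReal.comp hη.continuous).continuousOn hc
    refine (integrableOn_iff_integrable_of_support_subset fun x hx => ?_).1 h3
    by_contra h4
    simp [image_eq_zero_of_notMem_tsupport h4] at hx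
  have i2 := integrable_mul_of_tsupport hP hm hη.continuous hc hs
  calc ∫ x, η x • (g x - mixedPd a b f x)
      = ∫ x, ((η x : ℂ) * g x - (η x : ℂ) * mixedPd a b f x) := by
        congr 1; ext x; simp [mul_sub]
    _ = 0 := by rw [integral_sub i1 i2, h2, sub_self]

end Weak

/-! ### Local polynomial approximation -/

theorem lintegral_mul_sq_le {X : Type*} [MeasurableSpace X] {μ : Measure X} {f g : X → ℝ≥0∞}
    (hf : AEMeasurable f μ) (hg : AEMeasurable g μ) :
    (∫⁻ x, f x * g x ∂μ) ^ 2 ≤ (∫⁻ x, f x ^ 2 ∂μ) * ∫⁻ x, g x ^ 2 ∂μ := by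
  have := ENNReal.lintegral_mul_le_Lp_mul_Lq μ (p := 2) (q := 2) (by constructor <;> norm_num) hf hg
  simp only [Pi.mul_apply, ENNReal.rpow_ofNat] at this
  calc _ ≤ ((∫⁻ x, f x ^ 2 ∂μ) ^ (1 / 2 : ℝ) * (∫⁻ x, g x ^ 2 ∂μ) ^ (1 / 2 : ℝ)) ^ 2 := by gcongr
    _ = _ := by
      rw [mul_pow, ← ENNReal.rpow_natCast, ← ENNReal.rpow_natCast, ← ENNReal.rpow_mul,
        ← ENNReal.rpow_mul]
      norm_num

/-- The factor `4` bounds the planar Jacobian `t ^ (-2)` for `t ≥ 1 / 2`. -/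
theorem lintegral_comp_add_smul {g : ℝ × ℝ → ℝ≥0∞} (hg : Measurable g) (c : ℝ × ℝ) {t : ℝ}
    (ht : 1 / 2 ≤ t) : ∫⁻ x, g (c + t • x) ≤ 4 * ∫⁻ x, g x := by
  have h0 : t ≠ 0 := by linarith
  have h1 : ∫⁻ x, g (c + t • x) = ∫⁻ z, g (c + z) ∂(Measure.map (fun x : ℝ × ℝ => t • x) volume) := by
    rw [lintegral_map (f := fun z => g (c + z)) (hg.comp (by fun_prop)) (by fun_prop)]
  rw [h1, Measure.map_addHaar_smul _ h0, lintegral_smul_measure, smul_eq_mul,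
    lintegral_add_left_eq_self g c]
  gcongr
  rw [show (4 : ℝ≥0∞) = ENNReal.ofReal 4 by simp]
  refine ENNReal.ofReal_le_ofReal ?_
  simp only [Module.finrank_prod, Module.finrank_self]
  rw [abs_of_pos (by positivity), inv_le_comm₀ (by positivity) (by norm_num)]
  norm_num
  nlinarith

theorem iteratedDeriv_comp_line {U : Set (ℝ × ℝ)} (hU : IsOpen U) {H : ℝ × ℝ → ℂ} {k : ℕ}
    (hH : ContDiffOn ℝ k H U) (y v : ℝ × ℝ) {m : ℕ} (hm : m ≤ k) :
    ∀ t : ℝ, y + t • v ∈ U → iteratedDeriv m (fun t : ℝ => H (y + t • v)) t =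
      iteratedFDeriv ℝ m H (y + t • v) (fun _ => v) := by
  induction m with
  | zero => simp
  | succ m ih =>
    intro t ht
    have hd : DifferentiableAt ℝ (iteratedFDeriv ℝ m H) (y + t • v) :=
      (hH.contDiffAt (hU.mem_nhds ht)).differentiableAt_iteratedFDeriv
        (by exact_mod_cast hm)
    have hl : HasDerivAt (fun t : ℝ => y + t • v) v t := by
      simpa using ((hasDerivAt_id t).smul_const v).const_add y
    have hc : Continuous fun t : ℝ => y + t • v := by fun_prop
    have he : iteratedDeriv m (fun t : ℝ => H (y + t • v)) =ᶠ[nhds t]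
        fun t => iteratedFDeriv ℝ m H (y + t • v) (fun _ => v) := by
      filter_upwards [(hU.preimage hc).mem_nhds ht] with s hs using ih (by omega) s hs
    have h1 : HasFDerivAt (fun y => iteratedFDeriv ℝ m H y (fun _ => v))
        ((ContinuousMultilinearMap.apply ℝ (fun _ : Fin m => ℝ × ℝ) ℂ (fun _ => v)).comp
          (fderiv ℝ (iteratedFDeriv ℝ m H) (y + t • v))) (y + t • v) :=
      (ContinuousMultilinearMap.apply ℝ (fun _ : Fin m => ℝ × ℝ) ℂ
        (fun _ => v)).hasFDerivAt.comp _ hd.hasFDerivAt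
    rw [iteratedDeriv_succ, he.deriv_eq, iteratedFDeriv_succ_apply_left]
    exact (h1.comp_hasDerivAt t hl).deriv

/-- The Taylor polynomial of degree `n` with centre `y`. -/
def taylorPoly (H : ℝ × ℝ → ℂ) (n : ℕ) (y : ℝ × ℝ) : MvPolynomial (Fin 2) ℂ :=
  ∑ m ∈ Finset.range (n + 1), ∑ s : Finset (Fin m),
    MvPolynomial.C ((m.factorial : ℂ)⁻¹ *
      iteratedFDeriv ℝ m H y (s.piecewise (fun _ => (1, 0)) (fun _ => (0, 1)))) *
    ∏ i, if i ∈ s then MvPolynomial.X 0 - MvPolynomial.C (y.1 : ℂ)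
      else MvPolynomial.X 1 - MvPolynomial.C (y.2 : ℂ)

theorem totalDegree_taylorPoly_lt (H : ℝ × ℝ → ℂ) (n : ℕ) (y : ℝ × ℝ) :
    (taylorPoly H n y).totalDegree < n + 1 := by
  refine Nat.lt_succ_of_le ?_
  refine MvPolynomial.totalDegree_finsetSum_le fun m hm => ?_
  refine MvPolynomial.totalDegree_finsetSum_le fun s _ => ?_
  refine (MvPolynomial.totalDegree_mul _ _).trans ?_
  rw [MvPolynomial.totalDegree_C, zero_add]
  refine (MvPolynomial.totalDegree_finsetProd _ _).trans ?_
  have : ∀ i ∈ (Finset.univ : Finset (Fin m)), MvPolynomial.totalDegree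
      (if i ∈ s then MvPolynomial.X 0 - MvPolynomial.C (y.1 : ℂ)
      else MvPolynomial.X 1 - MvPolynomial.C (y.2 : ℂ) : MvPolynomial (Fin 2) ℂ) ≤ 1 := by
    intro i _
    split_ifs <;>
    · refine (MvPolynomial.totalDegree_sub _ _).trans ?_
      simp
  refine (Finset.sum_le_sum this).trans ?_
  simp only [Finset.mem_range] at hm
  simp; omega

theorem eval_taylorPoly (H : ℝ × ℝ → ℂ) (n : ℕ) (y x : ℝ × ℝ) :
    MvPolynomial.eval ![(x.1 : ℂ), (x.2 : ℂ)] (taylorPoly H n y) =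
      ∑ m ∈ Finset.range (n + 1), (m.factorial : ℝ)⁻¹ •
        iteratedFDeriv ℝ m H y (fun _ => x - y) := by
  simp only [taylorPoly, map_sum]
  refine Finset.sum_congr rfl fun m _ => ?_
  rw [multilinear_expand, Finset.smul_sum]
  refine Finset.sum_congr rfl fun s _ => ?_
  rw [map_mul, MvPolynomial.eval_C, map_prod]
  have : ∀ i : Fin m, (MvPolynomial.eval ![(x.1 : ℂ), (x.2 : ℂ)]) (if i ∈ s then
      MvPolynomial.X 0 - MvPolynomial.C (y.1 : ℂ) else MvPolynomial.X 1 - MvPolynomial.C (y.2 : ℂ)) =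
      ((if i ∈ s then (x - y).1 else (x - y).2 : ℝ) : ℂ) := by
    intro i
    split_ifs <;> simp
  simp only [this]
  rw [← Complex.ofReal_prod, Complex.real_smul, Complex.real_smul]
  push_cast
  ring

/-- Integral form of the remainder along the segment from `y` to `x`, with the kernel `(1 - t) ^ n /
n!` bounded by `1`. Keeping an integral, not a supremum, lets the final estimate depend on the
`L₂`-norm of the derivative alone. -/
theorem enorm_sub_taylorPoly_le {U : Set (ℝ × ℝ)} (hU : IsOpen U) {H : ℝ × ℝ → ℂ} {n : ℕ}
    (hH : ContDiffOn ℝ (n + 1 : ℕ) H U) {y x : ℝ × ℝ} (hseg : ∀ t ∈ Icc (0 : ℝ) 1,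
      y + t • (x - y) ∈ U) :
    ‖H x - MvPolynomial.eval ![(x.1 : ℂ), (x.2 : ℂ)] (taylorPoly H n y)‖ₑ ≤
      ∫⁻ t in Ioc (0 : ℝ) 1, ‖iteratedFDeriv ℝ (n + 1) H (y + t • (x - y))‖ₑ *
        ‖x - y‖ₑ ^ (n + 1) := by
  set v := x - y with hv
  set g : ℝ → ℂ := fun t => H (y + t • v) with hg
  have hI : uIcc (0 : ℝ) 1 = Icc 0 1 := uIcc_of_le zero_le_one
  have hgc : ∀ t ∈ Icc (0 : ℝ) 1, ContDiffAt ℝ (n + 1 : ℕ) g t := by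
    intro t ht
    have h2 : ContDiff ℝ (n + 1 : ℕ) (fun t : ℝ => y + t • v) := by fun_prop
    exact (hH.contDiffAt (hU.mem_nhds (hseg t ht))).comp t h2.contDiffAt
  have hder : ∀ m ≤ n + 1, ∀ t ∈ Icc (0 : ℝ) 1, iteratedDerivWithin m g (Icc 0 1) t =
      iteratedFDeriv ℝ m H (y + t • v) (fun _ => v) := by
    intro m hm t ht
    rw [iteratedDerivWithin_eq_iteratedDeriv (uniqueDiffOn_Icc zero_lt_one)
      ((hgc t ht).of_le (by exact_mod_cast hm)) ht]
    exact iteratedDeriv_comp_line hU hH y v hm t (hseg t ht)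
  have key := taylor_integral_remainder (f := g) (x₀ := 0) (x := 1) (n := n)
    (fun t ht => (hgc t (hI ▸ ht)).contDiffWithinAt)
  have h1 : taylorWithinEval g n (uIcc 0 1) 0 1 =
      MvPolynomial.eval ![(x.1 : ℂ), (x.2 : ℂ)] (taylorPoly H n y) := by
    rw [taylor_within_apply, eval_taylorPoly]
    refine Finset.sum_congr rfl fun m hm => ?_
    rw [hI, hder m (by simp at hm; omega) 0 (by simp)]
    simp [hv]
  have h2 : g 1 = H x := by simp [hg, hv]
  rw [h1, h2, intervalIntegral.integral_of_le zero_le_one] at key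
  rw [key]
  refine (enorm_integral_le_lintegral_enorm _).trans (setLIntegral_mono' measurableSet_Ioc ?_)
  intro t ht
  rw [hI, hder _ le_rfl t ⟨ht.1.le, ht.2⟩, enorm_smul]
  have h3 : ‖(1 - t) ^ n / (n.factorial : ℝ)‖ₑ ≤ 1 := by
    rw [← ofReal_norm, ← ENNReal.ofReal_one]
    refine ENNReal.ofReal_le_ofReal ?_
    rw [norm_div, norm_pow, Real.norm_of_nonneg (by linarith [ht.2] : 0 ≤ 1 - t)]
    rw [div_le_one (by simp [Nat.factorial_pos])]
    refine (pow_le_one₀ (by linarith [ht.2]) (by linarith [ht.1])).trans ?_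
    simp only [RCLike.norm_natCast]
    exact_mod_cast Nat.factorial_pos n
  have h4 : ‖iteratedFDeriv ℝ (n + 1) H (y + t • v) (fun _ => v)‖ₑ ≤
      ‖iteratedFDeriv ℝ (n + 1) H (y + t • v)‖ₑ * ‖v‖ₑ ^ (n + 1) := by
    have := (iteratedFDeriv ℝ (n + 1) H (y + t • v)).le_opNorm (fun _ => v)
    rw [Finset.prod_const, Finset.card_univ, Fintype.card_fin] at this
    rw [← ofReal_norm, ← ofReal_norm, ← ofReal_norm, ← ENNReal.ofReal_pow (norm_nonneg _),
      ← ENNReal.ofReal_mul (norm_nonneg _)]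
    exact ENNReal.ofReal_le_ofReal this
  calc _ ≤ 1 * _ := mul_le_mul' h3 h4
    _ = _ := one_mul _

/-- The point `y + t (x - y)` is a dilation of `x` by `t` and of `y` by `1 - t`. One of the two
factors is at least `1 / 2`; substituting in that variable costs at most `4`, and integrating the
other gives the volume of `Q`. -/
theorem lintegral_lintegral_segment_le {Q : Set (ℝ × ℝ)}
    {g : ℝ × ℝ → ℝ≥0∞} (hg : Measurable g) :
    ∫⁻ y in Q, ∫⁻ x in Q, ∫⁻ t in Ioc (0 : ℝ) 1, g (y + t • (x - y)) ≤
      4 * volume Q * ∫⁻ x, g x := by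
  have hmeas : Measurable fun z : (ℝ × ℝ) × (ℝ × ℝ) × ℝ => g (z.1 + z.2.2 • (z.2.1 - z.1)) :=
    hg.comp (by fun_prop)
  have h1 : ∫⁻ y in Q, ∫⁻ x in Q, ∫⁻ t in Ioc (0 : ℝ) 1, g (y + t • (x - y)) =
      ∫⁻ t in Ioc (0 : ℝ) 1, ∫⁻ y in Q, ∫⁻ x in Q, g (y + t • (x - y)) := by
    have : ∀ y, ∫⁻ x in Q, ∫⁻ t in Ioc (0 : ℝ) 1, g (y + t • (x - y)) =
        ∫⁻ t in Ioc (0 : ℝ) 1, ∫⁻ x in Q, g (y + t • (x - y)) := by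
      intro y
      exact lintegral_lintegral_swap (by
        exact (hmeas.comp (f := fun p : (ℝ × ℝ) × ℝ => (y, p)) (by fun_prop)).aemeasurable)
    simp only [this]
    refine lintegral_lintegral_swap ?_
    refine Measurable.aemeasurable ?_
    refine Measurable.lintegral_prod_right (f := fun (p : (ℝ × ℝ) × ℝ) x =>
      g (p.1 + p.2 • (x - p.1))) ?_
    exact hg.comp (by fun_prop)
  rw [h1]
  have h2 : ∀ t ∈ Ioc (0 : ℝ) 1, ∫⁻ y in Q, ∫⁻ x in Q, g (y + t • (x - y)) ≤
      4 * volume Q * ∫⁻ x, g x := by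
    intro t ht
    have hc : ∀ s : ℝ, 1 / 2 ≤ s → ∀ c : ℝ → ℝ × ℝ → ℝ × ℝ,
        ∫⁻ y in Q, ∫⁻ x in Q, g (c s y + s • x) ≤ 4 * volume Q * ∫⁻ x, g x := by
      intro s hs c
      calc _ ≤ ∫⁻ y in Q, 4 * ∫⁻ x, g x :=
            lintegral_mono fun y => (setLIntegral_le_lintegral _ _).trans
              (lintegral_comp_add_smul hg _ hs)
        _ = _ := by rw [setLIntegral_const]; ring
    rcases le_total (1 / 2) t with h | h
    · convert hc t h (fun s y => y - s • y) using 6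
      rw [smul_sub]; abel
    · rw [lintegral_lintegral_swap]
      · convert hc (1 - t) (by linarith) (fun s y => (1 - s) • y) using 6
        module
      · exact (hg.comp (by fun_prop : Measurable fun p : (ℝ × ℝ) × (ℝ × ℝ) =>
          p.1 + t • (p.2 - p.1))).aemeasurable
  refine (setLIntegral_mono' measurableSet_Ioc h2).trans ?_
  rw [setLIntegral_const]; simp

/-- A Bramble–Hilbert estimate. A Taylor polynomial with arbitrary centre is not controlled by the
`L₂`-norm of the derivatives, but on average over the centre it is, so a good centre exists. Balls
of `ℝ × ℝ` are squares, of side `2 h`. -/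
theorem exists_polynomial_lintegral_le {U : Set (ℝ × ℝ)} (hU : IsOpen U) {H : ℝ × ℝ → ℂ} {k : ℕ}
    (hk : 1 ≤ k) (hH : ContDiffOn ℝ k H U) {x₀ : ℝ × ℝ} {h : ℝ} (hh : 0 < h)
    (hQ : Metric.closedBall x₀ h ⊆ U) :
    ∃ P : MvPolynomial (Fin 2) ℂ, P.totalDegree < k ∧
      ∫⁻ x in Metric.closedBall x₀ h, ‖H x - MvPolynomial.eval ![(x.1 : ℂ), (x.2 : ℂ)] P‖ₑ ^ 2 ≤
        4 * ENNReal.ofReal (2 * h) ^ (2 * k) *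
          ∫⁻ x in Metric.closedBall x₀ h, ‖iteratedFDeriv ℝ k H x‖ₑ ^ 2 := by
  obtain ⟨n, rfl⟩ : ∃ n, k = n + 1 := ⟨k - 1, by omega⟩
  set Q := Metric.closedBall x₀ h with hQd
  have hQm : MeasurableSet Q := measurableSet_closedBall
  have hcont : ContinuousOn (fun x => ‖iteratedFDeriv ℝ (n + 1) H x‖ₑ ^ 2) Q := by
    have h1 : ContinuousOn (iteratedFDeriv ℝ (n + 1) H) Q := fun x hx =>
      ((hH.contDiffAt (hU.mem_nhds (hQ hx))).iteratedFDeriv_right (m := 0)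
        (i := n + 1) (by simp)).continuousAt.continuousWithinAt
    exact (ENNReal.continuous_pow 2).comp_continuousOn h1.enorm
  -- Extension by zero keeps the dilated integrals, which leave `Q`, bounded by the integral over
  -- `Q`.
  set g : ℝ × ℝ → ℝ≥0∞ := Q.indicator fun x => ‖iteratedFDeriv ℝ (n + 1) H x‖ₑ ^ 2 with hg
  have hgm : Measurable g := by
    classical
    have := hcont.measurable_piecewise (g := fun _ => 0) continuousOn_const hQm
    convert this using 1
    ext x; simp [hg, Set.piecewise, Set.indicator]
  have hgi : ∫⁻ x, g x = ∫⁻ x in Q, ‖iteratedFDeriv ℝ (n + 1) H x‖ₑ ^ 2 := lintegral_indicator hQm _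
  set M : ℝ × ℝ → ℝ≥0∞ := fun y => ∫⁻ x in Q, ∫⁻ t in Ioc (0 : ℝ) 1, g (y + t • (x - y)) with hM
  have hMm : Measurable M := by
    refine Measurable.lintegral_prod_right (f := fun y x =>
      ∫⁻ t in Ioc (0 : ℝ) 1, g (y + t • (x - y))) ?_
    refine Measurable.lintegral_prod_right (f := fun (p : (ℝ × ℝ) × (ℝ × ℝ)) t =>
      g (p.1 + t • (p.2 - p.1))) ?_
    exact hgm.comp (by fun_prop)
  have hQ0 : volume Q ≠ 0 := (Metric.measure_closedBall_pos volume x₀ hh).ne'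
  have hQt : volume Q ≠ ⊤ := measure_closedBall_lt_top.ne
  -- The centre: a point where the remainder integral is at most its mean over `Q`.
  obtain ⟨y, hy, hyM⟩ := exists_le_setLAverage hQ0 hQt hMm.aemeasurable
  have hMy : M y ≤ 4 * ∫⁻ x, g x := by
    refine hyM.trans ?_
    rw [setLAverage_eq]
    refine ENNReal.div_le_of_le_mul ?_
    refine (lintegral_lintegral_segment_le hgm).trans (le_of_eq (by ring))
  refine ⟨taylorPoly H n y, totalDegree_taylorPoly_lt H n y, ?_⟩
  have hpt : ∀ x ∈ Q, ‖H x - MvPolynomial.eval ![(x.1 : ℂ), (x.2 : ℂ)] (taylorPoly H n y)‖ₑ ^ 2 ≤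
      ENNReal.ofReal (2 * h) ^ (2 * (n + 1)) * ∫⁻ t in Ioc (0 : ℝ) 1, g (y + t • (x - y)) := by
    intro x hx
    have hseg : ∀ t ∈ Icc (0 : ℝ) 1, y + t • (x - y) ∈ Q := fun t ht =>
      (convex_closedBall x₀ h).add_smul_sub_mem hy hx ht
    have h1 := enorm_sub_taylorPoly_le hU hH (fun t ht => hQ (hseg t ht))
    have h2 : ‖x - y‖ₑ ≤ ENNReal.ofReal (2 * h) := by
      rw [← ofReal_norm, ← dist_eq_norm]
      refine ENNReal.ofReal_le_ofReal ?_
      have := dist_triangle_right x y x₀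
      simp only [hQd, Metric.mem_closedBall] at hx hy
      linarith
    have hcs := lintegral_mul_sq_le (μ := volume.restrict (Ioc (0 : ℝ) 1))
      (f := fun t => ‖iteratedFDeriv ℝ (n + 1) H (y + t • (x - y))‖ₑ)
      (g := fun _ => ‖x - y‖ₑ ^ (n + 1)) (by
        refine ContinuousOn.aemeasurable ?_ measurableSet_Ioc
        refine ContinuousOn.enorm ?_
        intro t ht
        have hc : Continuous fun t : ℝ => y + t • (x - y) := by fun_prop
        have := ((hH.contDiffAt (hU.mem_nhds (hQ (hseg t ⟨ht.1.le, ht.2⟩)))).iteratedFDeriv_right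
          (m := 0) (i := n + 1) (by simp)).continuousAt
        exact (this.comp_of_eq hc.continuousAt rfl).continuousWithinAt) aemeasurable_const
    calc _ ≤ _ := pow_le_pow_left' h1 2
      _ ≤ _ := hcs
      _ ≤ _ := by
        rw [mul_comm]
        refine mul_le_mul' ?_ ?_
        · rw [setLIntegral_const, Real.volume_Ioc, sub_zero, ENNReal.ofReal_one, mul_one, ← pow_mul,
            mul_comm (n + 1) 2]
          gcongr
        · refine setLIntegral_mono' measurableSet_Ioc fun t ht => ?_
          simp only [hg]
          rw [Set.indicator_of_mem (hseg t ⟨ht.1.le, ht.2⟩)]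
  calc _ ≤ ∫⁻ x in Q, ENNReal.ofReal (2 * h) ^ (2 * (n + 1)) *
        ∫⁻ t in Ioc (0 : ℝ) 1, g (y + t • (x - y)) := setLIntegral_mono' hQm hpt
    _ = ENNReal.ofReal (2 * h) ^ (2 * (n + 1)) * M y :=
      lintegral_const_mul' _ _ (by finiteness)
    _ ≤ ENNReal.ofReal (2 * h) ^ (2 * (n + 1)) * (4 * ∫⁻ x, g x) := by gcongr
    _ = _ := by rw [hgi]; ring

/-! ### Plane quadrilaterals -/

theorem cross_self (u : ℂ) : cross u u = 0 := by simp only [cross]; ring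

theorem cross_smul_right (t : ℝ) (u w : ℂ) : cross u (t • w) = t * cross u w := by
  simp only [cross, Complex.real_smul, Complex.re_ofReal_mul, Complex.im_ofReal_mul]; ring

theorem cross_add (u w z : ℂ) : cross u (w + z) = cross u w + cross u z := by
  simp only [cross, Complex.add_re, Complex.add_im]; ring

theorem continuous_cross (u : ℂ) : Continuous (cross u) := by unfold cross; fun_prop

theorem cross_eq_im (u w : ℂ) : cross u w = (starRingEnd ℂ u * w).im := by
  simp only [cross, Complex.mul_im, Complex.conj_re, Complex.conj_im]; ring

theorem abs_cross_le (u w : ℂ) : |cross u w| ≤ ‖u‖ * ‖w‖ := by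
  rw [cross_eq_im]
  refine (Complex.abs_im_le_norm _).trans ?_
  simp

/-- The three cross products add up to `D`; divided by `D` they are the barycentric coordinates of
`z`. -/
theorem convexHull_triangle {a b c : ℂ} (hD : 0 < cross (b - a) (c - a)) :
    convexHull ℝ {a, b, c} = {z | 0 ≤ cross (b - a) (z - a) ∧ 0 ≤ cross (c - b) (z - b) ∧
      0 ≤ cross (a - c) (z - c)} := by
  apply Subset.antisymm
  · refine convexHull_min ?_ ?_
    · rintro z (rfl | rfl | rfl) <;>
      · refine ⟨?_, ?_, ?_⟩ <;>
        · simp only [cross, Complex.sub_re, Complex.sub_im] at hD ⊢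
          nlinarith
    · intro x hx y hy s t hs ht hst
      have key : ∀ u v : ℂ, 0 ≤ cross u (x - v) → 0 ≤ cross u (y - v) →
          0 ≤ cross u (s • x + t • y - v) := by
        intro u v h1 h2
        have : s • x + t • y - v = s • (x - v) + t • (y - v) := by
          have : v = (s + t) • v := by rw [hst, one_smul]
          conv_lhs => rw [this]
          module
        rw [this, cross_add, cross_smul_right, cross_smul_right]
        positivity
      exact ⟨key _ _ hx.1 hy.1, key _ _ hx.2.1 hy.2.1, key _ _ hx.2.2 hy.2.2⟩
  · rintro z ⟨h1, h2, h3⟩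
    set D := cross (b - a) (c - a) with hDd
    have hsum : cross (c - b) (z - b) + cross (a - c) (z - c) + cross (b - a) (z - a) = D := by
      simp only [hDd, cross, Complex.sub_re, Complex.sub_im]; ring
    have hz : z = (cross (c - b) (z - b) / D) • a + (cross (a - c) (z - c) / D) • b +
        (cross (b - a) (z - a) / D) • c := by
      have h4 : D • z = cross (c - b) (z - b) • a + cross (a - c) (z - c) • b +
          cross (b - a) (z - a) • c := by
        apply Complex.ext <;>
        · simp only [hDd, cross, Complex.sub_re, Complex.sub_im, Complex.add_re, Complex.add_im,
            Complex.real_smul, Complex.re_ofReal_mul, Complex.im_ofReal_mul]; ring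
      have h5 : z = D⁻¹ • (D • z) := by rw [smul_smul, inv_mul_cancel₀ hD.ne', one_smul]
      conv_lhs => rw [h5, h4]
      simp only [smul_add, smul_smul, div_eq_inv_mul]
    have := (convex_convexHull ℝ {a, b, c}).sum_mem (t := (Finset.univ : Finset (Fin 3)))
      (w := ![cross (c - b) (z - b) / D, cross (a - c) (z - c) / D, cross (b - a) (z - a) / D])
      (z := ![a, b, c])
      (by intro i _; fin_cases i <;> simp <;> positivity)
      (by simp [Fin.sum_univ_three]; field_simp; exact hsum)
      (by intro i _; fin_cases i <;> simp <;> exact subset_convexHull ℝ _ (by simp))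
    rw [hz]
    simpa [Fin.sum_univ_three] using this

theorem openTriangle_subset_interior {a b c : ℂ} (hD : 0 < cross (b - a) (c - a)) :
    {z | 0 < cross (b - a) (z - a) ∧ 0 < cross (c - b) (z - b) ∧
      0 < cross (a - c) (z - c)} ⊆ interior (convexHull ℝ {a, b, c}) := by
  refine interior_maximal ?_ ?_
  · rw [convexHull_triangle hD]
    exact fun z hz => ⟨hz.1.le, hz.2.1.le, hz.2.2.le⟩
  · have hc : ∀ u v : ℂ, IsOpen {z | 0 < cross u (z - v)} := fun u v =>
      isOpen_lt continuous_const ((continuous_cross u).comp (continuous_id.sub continuous_const))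
    exact (hc _ _).inter ((hc _ _).inter (hc _ _))

theorem isCompact_triangle (a b c : ℂ) : IsCompact (convexHull ℝ {a, b, c}) :=
  (Set.toFinite {a, b, c}).isCompact_convexHull ℝ

theorem frontier_triangle_subset {a b c : ℂ} (hD : 0 < cross (b - a) (c - a)) :
    frontier (convexHull ℝ {a, b, c}) ⊆ {z | cross (b - a) (z - a) = 0} ∪
      {z | cross (c - b) (z - b) = 0} ∪ {z | cross (a - c) (z - c) = 0} := by
  rintro z ⟨hz, hz'⟩
  rw [(isCompact_triangle a b c).isClosed.closure_eq, convexHull_triangle hD] at hz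
  by_contra h
  simp only [mem_union, mem_ofPred_eq, not_or] at h
  exact hz' (openTriangle_subset_interior hD
    ⟨lt_of_le_of_ne hz.1 (Ne.symm h.1.1), lt_of_le_of_ne hz.2.1 (Ne.symm h.1.2),
      lt_of_le_of_ne hz.2.2 (Ne.symm h.2)⟩)

theorem triangle_subset_closure_interior {a b c : ℂ} (hD : 0 < cross (b - a) (c - a)) :
    convexHull ℝ {a, b, c} ⊆ closure (interior (convexHull ℝ {a, b, c})) := by
  have hne : (interior (convexHull ℝ {a, b, c})).Nonempty := by
    refine ⟨(1 / 3 : ℝ) • (a + b + c), openTriangle_subset_interior hD ?_⟩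
    refine ⟨?_, ?_, ?_⟩ <;>
    · simp only [cross, Complex.sub_re, Complex.sub_im, Complex.add_re, Complex.add_im,
        Complex.real_smul, Complex.re_ofReal_mul, Complex.im_ofReal_mul] at hD ⊢
      nlinarith
  rw [(convex_convexHull ℝ _).closure_interior_eq_closure_of_nonempty_interior hne]
  exact subset_closure

/-- The vector `-(I * u)` points to the right of `u`. A small step in that direction leaves `T`,
which lies to the left of the line through `z`, and does not reach `T'`, from which `z` is strictly
separated. -/
theorem notMem_interior_union {T T' : Set ℂ} {u p w v z : ℂ} (hu : u ≠ 0)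
    (hT : ∀ y ∈ T, 0 ≤ cross u (y - p)) (hT' : ∀ y ∈ T', 0 ≤ cross w (y - v))
    (hz : cross u (z - p) = 0) (hz' : cross w (z - v) < 0) : z ∉ interior (T ∪ T') := by
  intro hi
  have hc : Continuous fun t : ℝ => z + t • (-(Complex.I * u)) := by fun_prop
  have h1 : ∀ᶠ t : ℝ in nhdsWithin 0 (Ioi 0), z + t • (-(Complex.I * u)) ∈ interior (T ∪ T') := by
    refine (hc.tendsto' 0 z (by simp)).mono_left nhdsWithin_le_nhds |>.eventually
      (isOpen_interior.mem_nhds hi)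
  have h2 : ∀ᶠ t : ℝ in nhdsWithin 0 (Ioi 0), cross w (z + t • (-(Complex.I * u)) - v) < 0 := by
    have hc2 : Continuous fun t : ℝ => cross w (z + t • (-(Complex.I * u)) - v) :=
      (continuous_cross w).comp (hc.sub continuous_const)
    refine ((hc2.tendsto 0).mono_left nhdsWithin_le_nhds).eventually (gt_mem_nhds ?_)
    simpa using hz'
  obtain ⟨t, ⟨h3, h4⟩, h5⟩ := ((h1.and h2).and self_mem_nhdsWithin).exists
  rcases interior_subset h3 with h | h
  · have h6 := hT _ h
    rw [show z + t • (-(Complex.I * u)) - p = (z - p) + t • (-(Complex.I * u)) by ring, cross_add,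
      cross_smul_right, hz] at h6
    have h7 : cross u (-(Complex.I * u)) = -(u.re ^ 2 + u.im ^ 2) := by
      simp [cross]; ring
    have h8 : 0 < u.re ^ 2 + u.im ^ 2 := by
      have := Complex.normSq_pos.2 hu
      rw [Complex.normSq_apply] at this
      nlinarith
    rw [h7] at h6
    have h5' : 0 < t := h5
    nlinarith
  · exact absurd (hT' _ h) (not_le.2 h4)

theorem isOpen_quad (q : Fin 4 → ℂ) : IsOpen (quad q) := isOpen_interior

theorem isBounded_quad (q : Fin 4 → ℂ) : Bornology.IsBounded (quad q) :=
  (((isCompact_triangle _ _ _).union (isCompact_triangle _ _ _)).isBounded).subset interior_subset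

theorem cross_rotate (a b c : ℂ) : cross (b - a) (c - a) = cross (c - b) (a - b) := by
  simp only [cross, Complex.sub_re, Complex.sub_im]; ring

theorem triangle_subset_closure_quad {q : Fin 4 → ℂ} (h₁ : 0 < cross (q 1 - q 0) (q 2 - q 0)) :
    convexHull ℝ {q 0, q 1, q 2} ⊆ closure (quad q) :=
  (triangle_subset_closure_interior h₁).trans
    (closure_mono (interior_mono subset_union_left))

/-- The two edges of a counterclockwise triangle other than `[a, c]` avoid the interior of its union
with a set beyond the line through `a` and `c`. -/
theorem edges_notMem_interior {a b c : ℂ} {T' : Set ℂ} (hD : 0 < cross (b - a) (c - a))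
    (hT' : ∀ y ∈ T', 0 ≤ cross (c - a) (y - a)) :
    ∀ z ∈ segment ℝ a b ∪ segment ℝ b c, z ∉ interior (convexHull ℝ {a, b, c} ∪ T') := by
  have hab : b - a ≠ 0 := by intro h; simp [h, cross] at hD
  have hbc : c - b ≠ 0 := by
    intro h; rw [cross_rotate, h] at hD; simp [cross] at hD
  have hT := (convexHull_triangle hD).subset
  have hD' : cross (c - a) (b - a) = - cross (b - a) (c - a) := by simp only [cross]; ring
  have e1 : ∀ t : ℝ, 0 < t → a + t • (b - a) ∉ interior (convexHull ℝ {a, b, c} ∪ T') := by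
    intro t ht
    refine notMem_interior_union hab (fun y hy => (hT hy).1) hT' ?_ ?_
    · rw [add_sub_cancel_left, cross_smul_right, cross_self, mul_zero]
    · rw [add_sub_cancel_left, cross_smul_right, hD']
      nlinarith
  have e2 : ∀ t : ℝ, t < 1 → b + t • (c - b) ∉ interior (convexHull ℝ {a, b, c} ∪ T') := by
    intro t ht
    refine notMem_interior_union hbc (fun y hy => (hT hy).2.1) hT' ?_ ?_
    · rw [add_sub_cancel_left, cross_smul_right, cross_self, mul_zero]
    · have : b + t • (c - b) - a = (1 - t) • (b - a) + t • (c - a) := by module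
      rw [this, cross_add, cross_smul_right, cross_smul_right, cross_self, hD']
      nlinarith
  -- The corners `a` and `c` lie on the separating line itself, where the strict argument fails;
  -- they are reached as limits, the complement of the interior being closed.
  have lim : ∀ (f : ℝ → ℂ), Continuous f → ∀ (t₀ : ℝ) (s : Set ℝ), t₀ ∈ closure s →
      (∀ t ∈ s, f t ∉ interior (convexHull ℝ {a, b, c} ∪ T')) →
      f t₀ ∉ interior (convexHull ℝ {a, b, c} ∪ T') := by
    intro f hf t₀ s hs h
    exact (isOpen_interior.isClosed_compl.preimage hf).closure_subset_iff.2 h hs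
  rintro z (hz | hz)
  · rw [segment_eq_image'] at hz
    obtain ⟨t, ht, rfl⟩ := hz
    refine lim (fun t => a + t • (b - a)) (by fun_prop) t (Ioi 0) ?_ (fun t ht => e1 t ht)
    rw [closure_Ioi]; exact ht.1
  · rw [segment_eq_image'] at hz
    obtain ⟨t, ht, rfl⟩ := hz
    refine lim (fun t => b + t • (c - b)) (by fun_prop) t (Iio 1) ?_ (fun t ht => e2 t ht)
    rw [closure_Iio]; exact ht.2

/-- Relabelling by two exchanges the two triangles, so statements about the first two edges transfer
to the other two. -/
theorem quad_shift (q : Fin 4 → ℂ) : quad (fun v => q (v + 2)) = quad q := by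
  have e1 : ({q 2, q 3, q 0} : Set ℂ) = {q 0, q 2, q 3} := by grind
  have e2 : ({q 2, q 0, q 1} : Set ℂ) = {q 0, q 1, q 2} := by grind
  have : quad (fun v => q (v + 2)) =
      interior (convexHull ℝ {q 2, q 3, q 0} ∪ convexHull ℝ {q 2, q 0, q 1}) := rfl
  rw [this, e1, e2, union_comm]; rfl

theorem edge_zero_one_subset_frontier {q : Fin 4 → ℂ} (h₁ : 0 < cross (q 1 - q 0) (q 2 - q 0))
    (h₂ : 0 < cross (q 2 - q 0) (q 3 - q 0)) :
    segment ℝ (q 0) (q 1) ∪ segment ℝ (q 1) (q 2) ⊆ frontier (quad q) := by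
  intro z hz
  rw [(isOpen_quad q).frontier_eq]
  refine ⟨triangle_subset_closure_quad h₁ ?_, ?_⟩
  · rcases hz with hz | hz
    · exact (convex_convexHull ℝ _).segment_subset (subset_convexHull ℝ _ (by simp))
        (subset_convexHull ℝ _ (by simp)) hz
    · exact (convex_convexHull ℝ _).segment_subset (subset_convexHull ℝ _ (by simp))
        (subset_convexHull ℝ _ (by simp)) hz
  · refine edges_notMem_interior h₁ (fun y hy => ?_) z hz
    exact ((convexHull_triangle h₂).subset hy).1

theorem edge_subset_frontier {q : Fin 4 → ℂ} (h₁ : 0 < cross (q 1 - q 0) (q 2 - q 0))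
    (h₂ : 0 < cross (q 2 - q 0) (q 3 - q 0)) (v : Fin 4) :
    segment ℝ (q v) (q (v + 1)) ⊆ frontier (quad q) := by
  have h := edge_zero_one_subset_frontier h₁ h₂
  have h' := edge_zero_one_subset_frontier (q := fun v => q (v + 2))
    (by simpa [cross_rotate (q 0) (q 2) (q 3)] using h₂)
    (by simpa [← cross_rotate (q 0) (q 1) (q 2), cross_rotate (q 2) (q 0) (q 1)] using h₁)
  rw [quad_shift] at h'
  fin_cases v
  · exact subset_union_left.trans h
  · exact subset_union_right.trans h
  · exact subset_union_left.trans h'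
  · exact subset_union_right.trans h'

theorem corner_mem_frontier {q : Fin 4 → ℂ} (h₁ : 0 < cross (q 1 - q 0) (q 2 - q 0))
    (h₂ : 0 < cross (q 2 - q 0) (q 3 - q 0)) (v : Fin 4) : q v ∈ frontier (quad q) :=
  edge_subset_frontier h₁ h₂ v (left_mem_segment ℝ _ _)

/-- A corner in the wrong place would make one of the two triangles degenerate or wrongly oriented.
This serves to show that a vertex on the common edge of two patches is a corner of both. -/
theorem eq_of_corner_mem_edge {q : Fin 4 → ℂ} (h₁ : 0 < cross (q 1 - q 0) (q 2 - q 0))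
    (h₂ : 0 < cross (q 2 - q 0) (q 3 - q 0)) {u v : Fin 4}
    (h : q u ∈ segment ℝ (q v) (q (v + 1))) : u = v ∨ u = v + 1 := by
  have key : ∀ {q : Fin 4 → ℂ}, 0 < cross (q 1 - q 0) (q 2 - q 0) →
      0 < cross (q 2 - q 0) (q 3 - q 0) → q 2 ∉ segment ℝ (q 0) (q 1) ∧
      q 3 ∉ segment ℝ (q 0) (q 1) ∧ q 0 ∉ segment ℝ (q 1) (q 2) ∧ q 3 ∉ segment ℝ (q 1) (q 2) := by
    intro q h₁ h₂
    have hD' : cross (q 2 - q 0) (q 1 - q 0) = - cross (q 1 - q 0) (q 2 - q 0) := by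
      simp only [cross]; ring
    simp only [segment_eq_image']
    refine ⟨?_, ?_, ?_, ?_⟩ <;> rintro ⟨t, ht, h⟩ <;> simp only at h
    · rw [← h, add_sub_cancel_left, cross_smul_right, cross_self] at h₁
      simp at h₁
    · rw [← h, add_sub_cancel_left, cross_smul_right, hD'] at h₂
      nlinarith [ht.1]
    · have : cross (q 1 - q 0) (q 2 - q 0) = 0 := by
        rw [← h]
        rw [show q 1 - (q 1 + t • (q 2 - q 1)) = (-t) • (q 2 - q 1) by module,
          show q 2 - (q 1 + t • (q 2 - q 1)) = (1 - t) • (q 2 - q 1) by module, cross_smul_right]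
        simp only [cross, Complex.real_smul, Complex.re_ofReal_mul, Complex.im_ofReal_mul]; ring
      linarith
    · rw [← h, show q 1 + t • (q 2 - q 1) - q 0 = (1 - t) • (q 1 - q 0) + t • (q 2 - q 0) by module,
        cross_add, cross_smul_right, cross_smul_right, cross_self, hD'] at h₂
      nlinarith [ht.2]
  have k1 := key h₁ h₂
  have k2 := key (q := fun v => q (v + 2))
    (by simpa [cross_rotate (q 0) (q 2) (q 3)] using h₂)
    (by simpa [← cross_rotate (q 0) (q 1) (q 2), cross_rotate (q 2) (q 0) (q 1)] using h₁)
  simp only [Fin.isValue, zero_add] at k2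
  have e : (1 : Fin 4) + 2 = 3 ∧ (2 : Fin 4) + 2 = 0 ∧ (3 : Fin 4) + 2 = 1 := by decide
  rw [e.1, e.2.1, e.2.2] at k2
  obtain ⟨a1, a2, a3, a4⟩ := k1
  obtain ⟨b1, b2, b3, b4⟩ := k2
  fin_cases u <;> fin_cases v <;> first | (left; rfl) | (right; rfl) | exact absurd h ‹_›

/-- Only an upper bound for the rim is required, so the lines of all triangle sides are listed, the
diagonal included: the distance to the rim is bounded below by the distance to one of finitely many
lines. -/
theorem frontier_quad_subset {q : Fin 4 → ℂ} (h₁ : 0 < cross (q 1 - q 0) (q 2 - q 0))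
    (h₂ : 0 < cross (q 2 - q 0) (q 3 - q 0)) :
    ∃ A : Finset (ℂ × ℂ), (∀ l ∈ A, l.2 ≠ 0) ∧
      ∀ z ∈ frontier (quad q), ∃ l ∈ A, cross l.2 (z - l.1) = 0 := by
  have ne : ∀ {a b c : ℂ}, 0 < cross (b - a) (c - a) → b - a ≠ 0 := by
    intro a b c h h'; simp [h', cross] at h
  refine ⟨{(q 0, q 1 - q 0), (q 1, q 2 - q 1), (q 2, q 0 - q 2), (q 0, q 2 - q 0),
    (q 2, q 3 - q 2), (q 3, q 0 - q 3)}, ?_, ?_⟩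
  · have n1 := ne h₁
    have n2 : q 2 - q 1 ≠ 0 := by
      have h := h₁
      rw [cross_rotate] at h; exact ne h
    have n3 : q 0 - q 2 ≠ 0 := by
      rw [← neg_sub, neg_ne_zero]; exact ne h₂
    have n4 := ne h₂
    have n5 : q 3 - q 2 ≠ 0 := by
      have h := h₂
      rw [cross_rotate] at h; exact ne h
    have n6 : q 0 - q 3 ≠ 0 := by
      have h := h₂
      rw [cross_rotate, cross_rotate] at h; exact ne h
    intro l hl
    simp only [Finset.mem_insert, Finset.mem_singleton] at hl
    rcases hl with rfl | rfl | rfl | rfl | rfl | rfl <;> assumption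
  · intro z hz
    have hz' := frontier_union_subset _ _ (frontier_interior_subset hz)
    simp only [Finset.mem_insert, Finset.mem_singleton, exists_eq_or_imp, exists_eq_left]
    rcases hz' with h | h
    · rcases frontier_triangle_subset h₁ h.1 with (h | h) | h
      · exact .inl h
      · exact .inr (.inl h)
      · exact .inr (.inr (.inl h))
    · rcases frontier_triangle_subset h₂ h.2 with (h | h) | h
      · exact .inr (.inr (.inr (.inl h)))
      · exact .inr (.inr (.inr (.inr (.inl h))))
      · exact .inr (.inr (.inr (.inr (.inr h))))

/-- An endpoint of a segment is an extreme point: `a` is a convex combination of `c` and `d`, which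
are themselves `a` plus nonnegative multiples of `b - a`, so one of them is `a`. -/
theorem left_eq_of_segment_eq {E : Type*} [AddCommGroup E] [Module ℝ E] {a b c d : E}
    (h : segment ℝ a b = segment ℝ c d) : a = c ∨ a = d := by
  have h1 : a ∈ segment ℝ c d := h ▸ left_mem_segment ℝ a b
  have h2 : c ∈ segment ℝ a b := h ▸ left_mem_segment ℝ c d
  have h3 : d ∈ segment ℝ a b := h ▸ right_mem_segment ℝ c d
  simp only [segment_eq_image'] at h1 h2 h3
  obtain ⟨t, ht, h1⟩ := h1
  obtain ⟨r, hr, h2⟩ := h2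
  obtain ⟨s, hs, h3⟩ := h3
  simp only at h1 h2 h3
  have h4 : ((1 - t) * r + t * s) • (b - a) = 0 := by
    have : (a + r • (b - a)) + t • ((a + s • (b - a)) - (a + r • (b - a))) = a := by
      rw [h2, h3, h1]
    calc _ = ((a + r • (b - a)) + t • ((a + s • (b - a)) - (a + r • (b - a)))) - a := by module
      _ = 0 := by rw [this, sub_self]
  rcases smul_eq_zero.1 h4 with h5 | h5
  · have e1 : (1 - t) * r = 0 := by nlinarith [mul_nonneg (sub_nonneg.2 ht.2) hr.1, mul_nonneg ht.1 hs.1]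
    have e2 : t * s = 0 := by linarith
    rcases mul_eq_zero.1 e1 with e | e
    · have : t = 1 := by linarith
      rw [this, one_mul] at e2
      right; rw [← h3, e2]; simp
    · left; rw [← h2, e]; simp
  · left; rw [← h2, h5]; simp

/-! ### Integrals of negative powers of the distance to the boundary of a quadrilateral -/

/-- Scaling by `h` reduces to `h = 1`, where `e > 1` gives integrability at infinity. -/
theorem exists_lintegral_max_rpow_le {e : ℝ} (he : 1 < e) : ∃ C : ℝ≥0, ∀ h : ℝ, 0 < h →
    ∫⁻ y : ℝ, ENNReal.ofReal (max |y| h ^ (-e)) ≤ C * ENNReal.ofReal (h ^ (1 - e)) := by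
  have hint : Integrable (fun y : ℝ => max |y| 1 ^ (-e)) := by
    have h1 : Integrable (fun y : ℝ => 2 ^ e * (1 + ‖y‖) ^ (-e)) :=
      (integrable_one_add_norm (by simpa using he)).const_mul _
    refine h1.mono' (by
      refine (Measurable.pow_const ?_ _).aestronglyMeasurable
      fun_prop) (Filter.Eventually.of_forall fun y => ?_)
    have h2 : 0 < max |y| 1 := by positivity
    rw [Real.norm_of_nonneg (by positivity), Real.norm_eq_abs]
    have h3 : (1 + |y|) / 2 ≤ max |y| 1 := by
      have := le_max_left |y| 1
      have := le_max_right |y| 1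
      linarith
    calc max |y| 1 ^ (-e) ≤ ((1 + |y|) / 2) ^ (-e) :=
          Real.rpow_le_rpow_of_nonpos (by positivity) h3 (by linarith)
      _ = _ := by
        rw [Real.div_rpow (by positivity) (by norm_num), Real.rpow_neg (by norm_num : (0 : ℝ) ≤ 2),
          div_inv_eq_mul, mul_comm]
  have hfin : ∫⁻ y : ℝ, ENNReal.ofReal (max |y| 1 ^ (-e)) < ⊤ := hint.lintegral_lt_top
  refine ⟨(∫⁻ y : ℝ, ENNReal.ofReal (max |y| 1 ^ (-e))).toNNReal, fun h hh => ?_⟩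
  rw [ENNReal.coe_toNNReal hfin.ne]
  have h1 : ∫⁻ y : ℝ, ENNReal.ofReal (max |y| 1 ^ (-e)) =
      ∫⁻ y : ℝ, ENNReal.ofReal (max |y| 1 ^ (-e)) := rfl
  have h2 : ∫⁻ y : ℝ, ENNReal.ofReal (max |h * (h⁻¹ • y)| h ^ (-e)) =
      ENNReal.ofReal |((h⁻¹) ^ 1)⁻¹| * ∫⁻ y, ENNReal.ofReal (max |h * y| h ^ (-e)) := by
    have : ∫⁻ y : ℝ, ENNReal.ofReal (max |h * (h⁻¹ • y)| h ^ (-e)) =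
        ∫⁻ y, ENNReal.ofReal (max |h * y| h ^ (-e)) ∂(Measure.map (fun x : ℝ => h⁻¹ • x) volume) := by
      rw [lintegral_map (f := fun y : ℝ => ENNReal.ofReal (max |h * y| h ^ (-e))) ?_ (by fun_prop)]
      exact ENNReal.measurable_ofReal.comp (Measurable.pow_const (by fun_prop) _)
    rw [this, Measure.map_addHaar_smul _ (by positivity), lintegral_smul_measure]
    simp
  have h3 : ∀ y : ℝ, h * (h⁻¹ • y) = y := fun y => by
    rw [smul_eq_mul, ← mul_assoc, mul_inv_cancel₀ hh.ne', one_mul]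
  simp only [h3] at h2
  rw [h2]
  have h4 : ∀ y : ℝ, ENNReal.ofReal (max |h * y| h ^ (-e)) =
      ENNReal.ofReal (h ^ (-e)) * ENNReal.ofReal (max |y| 1 ^ (-e)) := by
    intro y
    rw [← ENNReal.ofReal_mul (by positivity), ← Real.mul_rpow hh.le (by positivity),
      mul_max_of_nonneg _ _ hh.le, abs_mul, abs_of_pos hh, mul_one]
  simp only [h4]
  rw [lintegral_const_mul' _ _ ENNReal.ofReal_ne_top, ← mul_assoc, mul_comm]
  gcongr
  rw [← ENNReal.ofReal_mul (abs_nonneg _)]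
  refine ENNReal.ofReal_le_ofReal (le_of_eq ?_)
  rw [pow_one, inv_inv, abs_of_pos hh, sub_eq_add_neg, Real.rpow_add hh, Real.rpow_one]

/-- A rigid motion turns the line into the real axis and the distance to it into `|im|`. The
integral then factors: the real part ranges over an interval of length `2 R`, the imaginary part
gives the one-dimensional integral. -/
theorem exists_lintegral_line_le {e : ℝ} (he : 1 < e) (a u : ℂ) (hu : u ≠ 0) {B : Set ℂ}
    (hB : Bornology.IsBounded B) : ∃ C : ℝ≥0, ∀ h : ℝ, 0 < h →
    ∫⁻ z in B, ENNReal.ofReal (max (|cross u (z - a)| / ‖u‖) h ^ (-e)) ≤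
      C * ENNReal.ofReal (h ^ (1 - e)) := by
  obtain ⟨C, hC⟩ := exists_lintegral_max_rpow_le he
  obtain ⟨R, hR⟩ := hB.subset_closedBall a
  set ϑ : Circle := ⟨starRingEnd ℂ u / (‖u‖ : ℂ), by simp [Submonoid.unitSphere, hu]⟩ with hϑ
  set L : ℂ ≃ₗᵢ[ℝ] ℂ := rotation ϑ with hL
  have hLval : ∀ w, |(L w).im| = |cross u w| / ‖u‖ := by
    intro w
    have : L w = (starRingEnd ℂ u * w) / (‖u‖ : ℂ) := by
      rw [div_mul_eq_mul_div₀ _ _ _ |>.symm]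
      rfl
    rw [this, Complex.div_ofReal_im, abs_div, abs_norm, cross_eq_im]
  refine ⟨2 * ‖R‖₊ * C, fun h hh => ?_⟩
  set G : ℂ → ℝ≥0∞ := fun w => (Metric.closedBall (0 : ℂ) R).indicator
    (fun w => ENNReal.ofReal (max |w.im| h ^ (-e))) w with hG
  have hGm : Measurable fun w : ℂ => ENNReal.ofReal (max |w.im| h ^ (-e)) :=
    ENNReal.measurable_ofReal.comp (Measurable.pow_const
      ((Complex.measurable_im.abs).max measurable_const) _)
  have h1 : ∫⁻ z in B, ENNReal.ofReal (max (|cross u (z - a)| / ‖u‖) h ^ (-e)) ≤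
      ∫⁻ z, G (L (z - a)) := by
    calc _ ≤ ∫⁻ z in Metric.closedBall a R,
          ENNReal.ofReal (max (|cross u (z - a)| / ‖u‖) h ^ (-e)) := lintegral_mono_set hR
      _ = ∫⁻ z, (Metric.closedBall a R).indicator
          (fun z => ENNReal.ofReal (max (|cross u (z - a)| / ‖u‖) h ^ (-e))) z :=
        (lintegral_indicator measurableSet_closedBall _).symm
      _ ≤ _ := by
        refine lintegral_mono fun z => ?_
        by_cases hz : z ∈ Metric.closedBall a R
        · have hz' : L (z - a) ∈ Metric.closedBall (0 : ℂ) R := by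
            rw [mem_closedBall_zero_iff, L.norm_map, ← dist_eq_norm]; exact hz
          simp only [hG]
          rw [Set.indicator_of_mem hz, Set.indicator_of_mem hz', hLval]
        · rw [Set.indicator_of_notMem hz]; exact zero_le
  refine h1.trans ?_
  rw [lintegral_sub_right_eq_self (fun z => G (L z)) a,
    L.measurePreserving.lintegral_comp (hGm.indicator measurableSet_closedBall)]
  have h2 : ∫⁻ w, G w ≤ ∫⁻ p : ℝ × ℝ, (Icc (-R) R).indicator (fun _ => (1 : ℝ≥0∞)) p.1 *
      ENNReal.ofReal (max |p.2| h ^ (-e)) := by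
    rw [← (Complex.volume_preserving_equiv_real_prod.symm).lintegral_comp_emb
      Complex.measurableEquivRealProd.symm.measurableEmbedding]
    refine lintegral_mono fun p => ?_
    simp only [hG]
    by_cases hp : Complex.measurableEquivRealProd.symm p ∈ Metric.closedBall (0 : ℂ) R
    · rw [Set.indicator_of_mem hp]
      have h3 : p.1 ∈ Icc (-R) R := by
        rw [mem_closedBall_zero_iff] at hp
        exact abs_le.1 ((Complex.abs_re_le_norm _).trans hp)
      rw [Set.indicator_of_mem h3, one_mul]
      rfl
    · rw [Set.indicator_of_notMem hp]; exact zero_le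
  refine h2.trans ?_
  rw [Measure.volume_eq_prod, lintegral_prod_mul (f := (Icc (-R) R).indicator fun _ => (1 : ℝ≥0∞))
      (g := fun y : ℝ => ENNReal.ofReal (max |y| h ^ (-e))) (measurable_const.indicator
    measurableSet_Icc).aemeasurable (ENNReal.measurable_ofReal.comp (Measurable.pow_const
      (measurable_id.abs.max measurable_const) _)).aemeasurable,
    lintegral_indicator measurableSet_Icc, setLIntegral_const, Real.volume_Icc, one_mul]
  push_cast
  rw [mul_assoc]
  refine mul_le_mul' ?_ (hC h hh)
  rw [show (2 : ℝ≥0∞) = ENNReal.ofReal 2 by simp, ← enorm_eq_nnnorm, ← ofReal_norm,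
    ← ENNReal.ofReal_mul (by norm_num)]
  refine ENNReal.ofReal_le_ofReal ?_
  rw [Real.norm_eq_abs]
  linarith [le_abs_self R]

/-- Distance of a point to the boundary of a quadrilateral. -/
def rimDist (q : Fin 4 → ℂ) (z : ℂ) : ℝ := Metric.infDist z (frontier (quad q))

theorem continuous_rimDist (q : Fin 4 → ℂ) : Continuous (rimDist q) :=
  Metric.continuous_infDist_pt _

theorem rimDist_nonneg (q : Fin 4 → ℂ) (z : ℂ) : 0 ≤ rimDist q z := Metric.infDist_nonneg

/-- The nearest rim point lies on one of the finitely many lines, so the integrand is at most the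
sum of the integrands for the lines. -/
theorem exists_lintegral_rimDist_le {q : Fin 4 → ℂ} (h₁ : 0 < cross (q 1 - q 0) (q 2 - q 0))
    (h₂ : 0 < cross (q 2 - q 0) (q 3 - q 0)) {e : ℝ} (he : 1 < e) : ∃ C : ℝ≥0, ∀ h : ℝ, 0 < h →
    ∫⁻ z in quad q, ENNReal.ofReal (max (rimDist q z) h ^ (-e)) ≤
      C * ENNReal.ofReal (h ^ (1 - e)) := by
  obtain ⟨A, hA, hAf⟩ := frontier_quad_subset h₁ h₂
  have hl : ∀ l : ℂ × ℂ, ∃ C : ℝ≥0, l.2 ≠ 0 → ∀ h : ℝ, 0 < h →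
      ∫⁻ z in quad q, ENNReal.ofReal (max (|cross l.2 (z - l.1)| / ‖l.2‖) h ^ (-e)) ≤
      C * ENNReal.ofReal (h ^ (1 - e)) := by
    intro l
    by_cases h0 : l.2 = 0
    · exact ⟨0, fun h => absurd h0 h⟩
    · obtain ⟨C, hC⟩ := exists_lintegral_line_le he l.1 l.2 h0 (isBounded_quad q)
      exact ⟨C, fun _ => hC⟩
  choose C hC using hl
  refine ⟨∑ l ∈ A, C l, fun h hh => ?_⟩
  have hpt : ∀ z, ENNReal.ofReal (max (rimDist q z) h ^ (-e)) ≤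
      ∑ l ∈ A, ENNReal.ofReal (max (|cross l.2 (z - l.1)| / ‖l.2‖) h ^ (-e)) := by
    intro z
    obtain ⟨y, hy, hyz⟩ := isClosed_frontier.exists_infDist_eq_dist
      (⟨_, corner_mem_frontier h₁ h₂ 0⟩ : (frontier (quad q)).Nonempty) z
    obtain ⟨l, hlA, hly⟩ := hAf y hy
    refine le_trans ?_ (Finset.single_le_sum (f := fun l : ℂ × ℂ =>
      ENNReal.ofReal (max (|cross l.2 (z - l.1)| / ‖l.2‖) h ^ (-e))) (fun _ _ => zero_le) hlA)
    refine ENNReal.ofReal_le_ofReal ?_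
    refine Real.rpow_le_rpow_of_nonpos (by positivity) ?_ (by linarith)
    refine max_le_max_right h ?_
    rw [div_le_iff₀ (norm_pos_iff.2 (hA l hlA)), rimDist, hyz, dist_eq_norm, mul_comm]
    have : cross l.2 (z - l.1) = cross l.2 (z - y) := by
      rw [show z - l.1 = (z - y) + (y - l.1) by ring, cross_add, hly, add_zero]
    rw [this]
    exact abs_cross_le _ _
  calc _ ≤ ∫⁻ z in quad q, ∑ l ∈ A, ENNReal.ofReal (max (|cross l.2 (z - l.1)| / ‖l.2‖) h ^ (-e)) :=
        lintegral_mono hpt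
    _ = ∑ l ∈ A, ∫⁻ z in quad q, ENNReal.ofReal (max (|cross l.2 (z - l.1)| / ‖l.2‖) h ^ (-e)) := by
      refine lintegral_finsetSum _ fun l _ => ?_
      refine ENNReal.measurable_ofReal.comp (Measurable.pow_const (Measurable.max ?_
        measurable_const) _)
      exact ((((continuous_cross l.2).comp (continuous_id.sub continuous_const)).abs).div_const
        _).measurable
    _ ≤ ∑ l ∈ A, C l * ENNReal.ofReal (h ^ (1 - e)) :=
      Finset.sum_le_sum fun l hlA => hC l (hA l hlA) h hh
    _ = _ := by push_cast; rw [Finset.sum_mul]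

/-! ### The patches of a polyhedral surface -/

namespace Patch

variable (F : Patch)

theorem isClosedEmbedding_chart : Topology.IsClosedEmbedding F.chart :=
  F.chart.isometry.isClosedEmbedding

theorem closure_face : closure F.face = F.chart '' closure (quad F.q) :=
  F.isClosedEmbedding_chart.closure_image_eq _

theorem isClosed_rim : IsClosed F.rim :=
  F.isClosedEmbedding_chart.isClosedMap _ isClosed_frontier

theorem rim_subset_closure : F.rim ⊆ closure F.face := by
  rw [F.closure_face]; exact image_mono frontier_subset_closure

theorem closure_face_diff_rim : closure F.face \ F.rim = F.face := by
  rw [F.closure_face, rim, ← image_sdiff F.chart.injective, closure_sdiff_frontier,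
    (isOpen_quad _).interior_eq, face]

theorem edge_subset_rim (v : Fin 4) : F.edge v ⊆ F.rim := by
  have h : F.edge v = F.chart '' segment ℝ (F.q v) (F.q (v + 1)) :=
    (image_segment ℝ F.chart.toAffineMap (F.q v) (F.q (v + 1))).symm
  rw [h]
  exact image_mono (edge_subset_frontier F.ccw_left F.ccw_right v)

theorem corner_mem_rim (v : Fin 4) : F.corner v ∈ F.rim :=
  F.edge_subset_rim v (left_mem_segment ℝ _ _)

theorem eq_of_corner_mem_edge {u v : Fin 4} (h : F.corner u ∈ F.edge v) : u = v ∨ u = v + 1 := by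
  have h' : F.edge v = F.chart '' segment ℝ (F.q v) (F.q (v + 1)) :=
    (image_segment ℝ F.chart.toAffineMap (F.q v) (F.q (v + 1))).symm
  rw [h', corner, F.chart.injective.mem_set_image] at h
  exact PolySurf.eq_of_corner_mem_edge F.ccw_left F.ccw_right h

end Patch

namespace Surface

variable (S : Surface)

theorem closure_face_subset_bdry (i : Fin S.I) : closure (S.patch i).face ⊆ S.bdry := by
  rw [bdry, S.frontier_eq]; exact subset_iUnion (fun i => closure (S.patch i).face) i

theorem face_subset_bdry (i : Fin S.I) : (S.patch i).face ⊆ S.bdry :=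
  subset_closure.trans (S.closure_face_subset_bdry i)

theorem isCompact_bdry : IsCompact S.bdry :=
  S.isCompact.of_isClosed_subset isClosed_frontier S.isCompact.isClosed.frontier_subset

theorem inter_closure_face_subset_rim {i l : Fin S.I} (h : i ≠ l) :
    closure (S.patch i).face ∩ closure (S.patch l).face ⊆ (S.patch i).rim := by
  rcases S.inter i l h with h | ⟨v, w, -, h⟩ | ⟨v, w, -, h⟩
  · rw [h]; exact empty_subset _
  · rw [h, singleton_subset_iff]; exact (S.patch i).corner_mem_rim v
  · rw [h]; exact (S.patch i).edge_subset_rim v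

theorem disjoint_face_rim (i : Fin S.I) : Disjoint (S.patch i).face (S.patch i).rim := by
  rw [← (S.patch i).closure_face_diff_rim]; exact disjoint_sdiff_left

theorem disjoint_face_closure_face {i l : Fin S.I} (h : i ≠ l) :
    Disjoint (S.patch i).face (closure (S.patch l).face) := by
  rw [disjoint_left]
  intro x hx hx'
  exact disjoint_left.1 (S.disjoint_face_rim i) hx
    (S.inter_closure_face_subset_rim h ⟨subset_closure hx, hx'⟩)

theorem isClosed_skeleton : IsClosed S.skeleton :=
  isClosed_iUnion_of_finite fun i => (S.patch i).isClosed_rim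

theorem rim_subset_skeleton (i : Fin S.I) : (S.patch i).rim ⊆ S.skeleton :=
  subset_iUnion (fun i => (S.patch i).rim) i

/-- A connected piece of the surface that avoids all patch boundaries lies in a single patch. -/
theorem exists_subset_face {K : Set E3} (hK : IsConnected K) (hKb : K ⊆ S.bdry)
    (hKs : Disjoint K S.skeleton) : ∃ i, K ⊆ (S.patch i).face := by
  obtain ⟨x, hx⟩ := hK.nonempty
  have hx' : x ∈ ⋃ i, closure (S.patch i).face := S.frontier_eq ▸ hKb hx
  obtain ⟨i, hi⟩ := mem_iUnion.1 hx'
  refine ⟨i, ?_⟩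
  set B := ⋃ l ∈ {l | l ≠ i}, closure (S.patch l).face with hB
  have hBc : IsClosed B := (Set.toFinite _).isClosed_biUnion fun _ _ => isClosed_closure
  have hcov : K ⊆ closure (S.patch i).face ∪ B := by
    intro y hy
    have hy' : y ∈ ⋃ i, closure (S.patch i).face := S.frontier_eq ▸ hKb hy
    obtain ⟨l, hl⟩ := mem_iUnion.1 hy'
    by_cases h : l = i
    · exact .inl (h ▸ hl)
    · exact .inr (mem_biUnion (show l ∈ {l | l ≠ i} from h) hl)
  have hdis : K ∩ (closure (S.patch i).face ∩ B) = ∅ := by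
    rw [← disjoint_iff_inter_eq_empty, disjoint_left]
    rintro y hy ⟨h1, h2⟩
    obtain ⟨l, hl, h3⟩ := mem_iUnion₂.1 h2
    exact disjoint_left.1 hKs hy (S.rim_subset_skeleton i
      (S.inter_closure_face_subset_rim (Ne.symm hl) ⟨h1, h3⟩))
  have hsub : K ⊆ closure (S.patch i).face := by
    rcases isPreconnected_iff_subset_of_disjoint_closed.1 hK.isPreconnected _ _ isClosed_closure hBc
      hcov hdis with h | h
    · exact h
    · exact absurd (show x ∈ K ∩ (closure (S.patch i).face ∩ B) from ⟨hx, hi, h hx⟩)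
        (by rw [hdis]; exact notMem_empty x)
  intro y hy
  rw [← (S.patch i).closure_face_diff_rim]
  exact ⟨hsub hy, fun h => disjoint_left.1 hKs hy (S.rim_subset_skeleton i h)⟩

/-- A vertex on a closed patch is a corner of that patch. -/
theorem exists_vert_eq {n : Fin S.N} {i : Fin S.I} (h : S.ν n ∈ closure (S.patch i).face) :
    ∃ v, S.vert i v = n := by
  obtain ⟨l, u, hlu⟩ := S.vert_surj n
  by_cases hil : l = i
  · subst hil; exact ⟨u, hlu⟩
  have hu : S.ν n = (S.patch l).corner u := by rw [← hlu, S.ν_vert]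
  have hmem : S.ν n ∈ closure (S.patch l).face ∩ closure (S.patch i).face :=
    ⟨by rw [hu]; exact (S.patch l).rim_subset_closure ((S.patch l).corner_mem_rim u), h⟩
  have fin : ∀ w, S.ν n = (S.patch i).corner w → ∃ v, S.vert i v = n := fun w hw =>
    ⟨w, S.ν_injective (by rw [S.ν_vert, hw])⟩
  rcases S.inter l i hil with h | ⟨v, w, hvw, h⟩ | ⟨v, w, hvw, h⟩
  · rw [h] at hmem; exact absurd hmem (notMem_empty _)
  · rw [h, mem_singleton_iff] at hmem
    exact fin w (hmem.trans hvw)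
  · rw [h, hu] at hmem
    have key : ∀ a b : E3, segment ℝ a b = (S.patch i).edge w → S.ν n = a → ∃ v, S.vert i v = n := by
      intro a b hab hna
      rcases left_eq_of_segment_eq (hab.trans rfl) with h' | h'
      · exact fin w (hna.trans h')
      · exact fin (w + 1) (hna.trans h')
    rcases (S.patch l).eq_of_corner_mem_edge hmem with h' | h'
    · exact key _ _ hvw (by rw [hu, h'])
    · exact key _ _ ((segment_symm ℝ _ _).trans hvw) (by rw [hu, h'])

variable {S}

/-- Otherwise `x` would belong both to `U₁ n` and to a patch at distance at least `C₁` from `U₁ n`.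
On a given patch only the cut-offs of its own corners contribute. -/
theorem Resolution.eq_zero_of_forall_vert_ne (R : S.Resolution) {n : Fin S.N} {i : Fin S.I}
    (h : ∀ v, S.vert i v ≠ n) {x : E3} (hx : x ∈ (S.patch i).face) : R.φ n x = 0 := by
  by_contra h0
  have hU : x ∈ R.U₁ n := by
    by_contra hU
    exact h0 (R.eq_zero n x ⟨S.face_subset_bdry i hx, hU⟩)
  have h1 : S.ν n ∉ closure (S.patch i).face := fun h' =>
    let ⟨v, hv⟩ := S.exists_vert_eq h'
    h v hv
  have := R.far_patches n i h1 x hU x hx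
  rw [dist_self] at this
  exact absurd R.C₁_pos (not_lt.2 this)

end Surface

/-! ### Square integrable functions on the surface -/

theorem eLpNorm_two_sq {X E : Type*} [MeasurableSpace X] [NormedAddCommGroup E] (f : X → E)
    (μ : Measure X) : eLpNorm f 2 μ ^ 2 = ∫⁻ x, ‖f x‖ₑ ^ 2 ∂μ := by
  have := eLpNorm_nnreal_pow_eq_lintegral (f := f) (μ := μ) (p := 2) (by norm_num)
  simpa using this

theorem restrict_square : (volume : Measure (ℝ × ℝ)).restrict square =
    volume.restrict openSquare := by
  refine Measure.restrict_congr_set ?_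
  rw [square, openSquare, Measure.volume_eq_prod]
  exact Measure.set_prod_ae_eq Ioo_ae_eq_Icc.symm Ioo_ae_eq_Icc.symm

theorem measurableSet_square : MeasurableSet square := measurableSet_Icc.prod measurableSet_Icc

theorem isOpen_openSquare : IsOpen openSquare := isOpen_Ioo.prod isOpen_Ioo

theorem openSquare_subset_square : openSquare ⊆ square :=
  prod_mono Ioo_subset_Icc_self Ioo_subset_Icc_self

theorem isCompact_square : IsCompact square := isCompact_Icc.prod isCompact_Icc

namespace Patch

variable (F : Patch)

theorem continuousOn_param : ContinuousOn F.param square := by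
  obtain ⟨L, hL, h⟩ := F.param_bilip
  have : LipschitzOnWith ⟨L, hL.le⟩ F.param square :=
    LipschitzOnWith.of_dist_le_mul fun x hx y hy => (h x hx y hy).1
  exact this.continuousOn

theorem aemeasurable_param : AEMeasurable F.param (volume.restrict square) :=
  F.continuousOn_param.aemeasurable measurableSet_square

/-- The inverse parametrization is Lipschitz, and Lipschitz maps increase the two-dimensional
Hausdorff measure at most by the square of their constant. The plane is transported to `ℝ × ℝ`,
where this measure equals Lebesgue measure. -/
theorem exists_volume_le_image :
    ∃ C : ℝ≥0, ∀ T ⊆ square, volume T ≤ C * volume (F.param '' T) := by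
  obtain ⟨L, hL, h⟩ := F.param_bilip
  set e := Complex.equivRealProdCLM with he
  set K : ℝ≥0 := L.toNNReal * ‖(e.symm : ℝ × ℝ →L[ℝ] ℂ)‖₊
  refine ⟨K ^ 2, fun T hT => ?_⟩
  set g : ℝ × ℝ → ℝ × ℝ := fun p => Function.invFunOn F.param square (e.symm p) with hg
  have hinv : ∀ x ∈ T, g (e (F.param x)) = x := fun x hx => by
    simp only [hg, e.symm_apply_apply]
    exact F.param_bij.injOn.leftInvOn_invFunOn (hT hx)
  have hlip : LipschitzOnWith K g (e '' (F.param '' T)) := by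
    refine LipschitzOnWith.of_dist_le_mul ?_
    rintro _ ⟨_, ⟨x, hx, rfl⟩, rfl⟩ _ ⟨_, ⟨y, hy, rfl⟩, rfl⟩
    rw [hinv x hx, hinv y hy]
    refine (h x (hT hx) y (hT hy)).2.trans ?_
    have h1 := e.symm.lipschitz.dist_le_mul (e (F.param x)) (e (F.param y))
    rw [e.symm_apply_apply, e.symm_apply_apply] at h1
    calc L * dist (F.param x) (F.param y) ≤ L * (_ * dist (e (F.param x)) (e (F.param y))) := by
          gcongr
      _ = _ := by simp only [K]; push_cast; rw [Real.coe_toNNReal _ hL.le, mul_assoc]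
  have h2 := hlip.hausdorffMeasure_image_le (d := 2) (by norm_num)
  have h3 : g '' (e '' (F.param '' T)) = T := by
    rw [image_image, image_image]
    exact (image_congr fun x hx => hinv x hx).trans (image_id' T)
  rw [h3, hausdorffMeasure_prod_real] at h2
  have h4 : volume (e '' (F.param '' T)) = volume (F.param '' T) := by
    have h5 : e '' (F.param '' T) = Complex.measurableEquivRealProd.symm ⁻¹' (F.param '' T) :=
      Complex.measurableEquivRealProd.image_eq_preimage_symm _
    rw [h5, Complex.volume_preserving_equiv_real_prod.symm.measure_preimage_equiv]
  rw [h4] at h2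
  convert h2 using 2
  simp

theorem exists_map_param_le : ∃ C : ℝ≥0, Measure.map F.param (volume.restrict square) ≤
    (C : ℝ≥0∞) • volume.restrict (quad F.q) := by
  obtain ⟨C, hC⟩ := F.exists_volume_le_image
  refine ⟨C, Measure.le_iff.2 fun A hA => ?_⟩
  have hm := F.aemeasurable_param
  -- The boundary of the square is a null set, and only the open square is mapped into the open
  -- quadrilateral.
  rw [restrict_square] at hm ⊢
  rw [Measure.map_apply_of_aemeasurable hm hA, Measure.smul_apply, smul_eq_mul,
    Measure.restrict_apply hA, Measure.restrict_apply' isOpen_openSquare.measurableSet]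
  refine (hC _ (inter_subset_right.trans openSquare_subset_square)).trans ?_
  gcongr
  rintro _ ⟨x, ⟨hx, hx'⟩, rfl⟩
  exact ⟨hx, F.param_interior ▸ mem_image_of_mem _ hx'⟩

theorem lintegral_comp_param_le {C : ℝ≥0} (hC : Measure.map F.param (volume.restrict square) ≤
    (C : ℝ≥0∞) • volume.restrict (quad F.q)) {f : ℂ → ℝ≥0∞}
    (hf : AEMeasurable f (volume.restrict (quad F.q))) :
    ∫⁻ x in square, f (F.param x) ≤ C * ∫⁻ z in quad F.q, f z := by
  have hf' : AEMeasurable f (Measure.map F.param (volume.restrict square)) :=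
    (hf.smul_measure (C : ℝ≥0∞)).mono_measure hC
  rw [← lintegral_map' hf' F.aemeasurable_param]
  refine (lintegral_mono' hC le_rfl).trans (le_of_eq ?_)
  rw [lintegral_smul_measure, smul_eq_mul]

theorem measurableEmbedding_chart : MeasurableEmbedding F.chart :=
  F.isClosedEmbedding_chart.measurableEmbedding

end Patch

namespace Surface

variable (S : Surface)

theorem lintegral_σ (f : E3 → ℝ≥0∞) :
    ∫⁻ x, f x ∂S.σ = ∑ i, ∫⁻ z in quad (S.patch i).q, f ((S.patch i).chart z) := by
  rw [σ, lintegral_finsetSum_measure]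
  exact Finset.sum_congr rfl fun i _ => (S.patch i).measurableEmbedding_chart.lintegral_map _

theorem map_chart_le_σ (i : Fin S.I) :
    Measure.map (S.patch i).chart (volume.restrict (quad (S.patch i).q)) ≤ S.σ := by
  refine Measure.le_iff.2 fun A _ => ?_
  rw [σ, Measure.finsetSum_apply]
  exact Finset.single_le_sum (f := fun i => Measure.map (S.patch i).chart
    (volume.restrict (quad (S.patch i).q)) A) (fun _ _ => zero_le) (Finset.mem_univ i)

instance isFiniteMeasure_σ : IsFiniteMeasure S.σ := by
  refine ⟨?_⟩
  rw [σ, Measure.finsetSum_apply]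
  refine ENNReal.sum_lt_top.2 fun i _ => ?_
  rw [Measure.map_apply (S.patch i).measurableEmbedding_chart.measurable MeasurableSet.univ]
  simpa using (isBounded_quad (S.patch i).q).measure_lt_top

theorem measurable_chart_comp_param (i : Fin S.I) :
    AEMeasurable (S.patch i).kappa (volume.restrict square) :=
  (S.patch i).measurableEmbedding_chart.measurable.comp_aemeasurable
    (S.patch i).aemeasurable_param

theorem exists_map_kappa_le : ∃ C : ℝ≥0, ∀ i,
    Measure.map (S.patch i).kappa (volume.restrict square) ≤ (C : ℝ≥0∞) • S.σ := by
  choose C hC using fun i => (S.patch i).exists_map_param_le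
  refine ⟨∑ i, C i, fun i => ?_⟩
  have h1 : Measure.map (S.patch i).kappa (volume.restrict square) =
      Measure.map (S.patch i).chart (Measure.map (S.patch i).param (volume.restrict square)) :=
    (AEMeasurable.map_map_of_aemeasurable
      (S.patch i).measurableEmbedding_chart.measurable.aemeasurable
      (S.patch i).aemeasurable_param).symm
  rw [h1]
  refine Measure.le_iff.2 fun A hA => ?_
  have hm := (S.patch i).measurableEmbedding_chart.measurable
  rw [Measure.map_apply hm hA]
  refine (Measure.le_iff'.1 (hC i) _).trans ?_
  rw [Measure.smul_apply, Measure.smul_apply, ← Measure.map_apply hm hA]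
  refine mul_le_mul' ?_ (Measure.le_iff'.1 (S.map_chart_le_σ i) A)
  exact_mod_cast Finset.single_le_sum (f := C) (fun _ _ => zero_le) (Finset.mem_univ i)

theorem memLp_comp_kappa {u : E3 → ℂ} (hu : MemLp u 2 S.σ) (i : Fin S.I) :
    MemLp (fun x => u ((S.patch i).kappa x)) 2 (volume.restrict square) := by
  obtain ⟨C, hC⟩ := S.exists_map_kappa_le
  exact (hu.of_measure_le_smul ENNReal.coe_ne_top (hC i)).comp_of_map
    (S.measurable_chart_comp_param i)

theorem exists_eLpNorm_comp_kappa_le : ∃ C : ℝ≥0, ∀ u : E3 → ℂ, MemLp u 2 S.σ → ∀ i,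
    eLpNorm (fun x => u ((S.patch i).kappa x)) 2 (volume.restrict square) ≤
      C * eLpNorm u 2 S.σ := by
  obtain ⟨C, hC⟩ := S.exists_map_kappa_le
  refine ⟨C ^ (1 / 2 : ℝ), fun u hu i => ?_⟩
  have hm := hu.1.mono_ac (Measure.absolutelyContinuous_of_le_smul (hC i))
  have h1 : eLpNorm (fun x => u ((S.patch i).kappa x)) 2 (volume.restrict square) =
      eLpNorm u 2 (Measure.map (S.patch i).kappa (volume.restrict square)) :=
    (eLpNorm_map_measure hm (S.measurable_chart_comp_param i)).symm
  rw [h1]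
  refine (eLpNorm_mono_measure u (hC i)).trans ?_
  rw [eLpNorm_smul_measure_of_ne_top (by norm_num), smul_eq_mul, ENNReal.coe_rpow_of_nonneg]
  · simp
  · norm_num

theorem integrable_mul_star {u v : E3 → ℂ} (hu : MemLp u 2 S.σ) (hv : MemLp v 2 S.σ)
    (i : Fin S.I) : Integrable (fun x => u ((S.patch i).kappa x) * star (v ((S.patch i).kappa x)))
      (volume.restrict square) :=
  (S.memLp_comp_kappa hu i).integrable_mul (S.memLp_comp_kappa hv i).star

theorem pairing_sub {u w v : E3 → ℂ} (hu : MemLp u 2 S.σ) (hw : MemLp w 2 S.σ)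
    (hv : MemLp v 2 S.σ) : S.pairing (u - w) v = S.pairing u v - S.pairing w v := by
  simp only [pairing, Pi.sub_apply, sub_mul]
  rw [← Finset.sum_sub_distrib]
  exact Finset.sum_congr rfl fun i _ =>
    integral_sub (S.integrable_mul_star hu hv i) (S.integrable_mul_star hw hv i)

/-- Continuity of the pairing in the surface `L₂`-norms. The pairing integrates over the parameter
square without a Jacobian, so Cauchy–Schwarz is combined with the comparison of the pushed-forward
measure with `S.σ`. -/
theorem exists_enorm_pairing_le : ∃ C : ℝ≥0, ∀ u v : E3 → ℂ, MemLp u 2 S.σ → MemLp v 2 S.σ →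
    ‖S.pairing u v‖ₑ ≤ C * (eLpNorm u 2 S.σ * eLpNorm v 2 S.σ) := by
  obtain ⟨C, hC⟩ := S.exists_eLpNorm_comp_kappa_le
  refine ⟨S.I * (C * C), fun u v hu hv => ?_⟩
  refine (enorm_sum_le _ _).trans ?_
  have : ∀ i ∈ (Finset.univ : Finset (Fin S.I)),
      ‖∫ x in square, u ((S.patch i).kappa x) * star (v ((S.patch i).kappa x))‖ₑ ≤
        (C * C) * (eLpNorm u 2 S.σ * eLpNorm v 2 S.σ) := by
    intro i _
    refine (enorm_integral_le_lintegral_enorm _).trans ?_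
    have h1 := (S.memLp_comp_kappa hu i).1.enorm
    have h2 := (S.memLp_comp_kappa hv i).1.enorm
    have h3 := lintegral_mul_sq_le h1 h2
    rw [← eLpNorm_two_sq (fun x => u ((S.patch i).kappa x)),
      ← eLpNorm_two_sq (fun x => v ((S.patch i).kappa x)), ← mul_pow] at h3
    have h4 := (ENNReal.pow_le_pow_left_iff two_ne_zero).1 h3
    calc _ = ∫⁻ x in square, ‖u ((S.patch i).kappa x)‖ₑ * ‖v ((S.patch i).kappa x)‖ₑ := by
          simp only [enorm_mul, enorm_eq_nnnorm (star _), nnnorm_star, ← enorm_eq_nnnorm]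
      _ ≤ _ := h4
      _ ≤ (C * eLpNorm u 2 S.σ) * (C * eLpNorm v 2 S.σ) := mul_le_mul' (hC u hu i) (hC v hv i)
      _ = _ := by ring
  refine (Finset.sum_le_sum this).trans ?_
  rw [Finset.sum_const, Finset.card_univ, Fintype.card_fin, nsmul_eq_mul]
  push_cast
  rw [mul_assoc (S.I : ℝ≥0∞)]

theorem ae_mem_bdry : ∀ᵐ x ∂S.σ, x ∈ S.bdry := by
  rw [ae_iff, σ, Measure.finsetSum_apply, Finset.sum_eq_zero_iff]
  intro i _
  rw [(S.patch i).measurableEmbedding_chart.map_apply]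
  refine measure_mono_null (t := (quad (S.patch i).q)ᶜ) (fun z hz hz' => ?_)
    (by rw [Measure.restrict_apply' (isOpen_quad _).measurableSet]; simp)
  exact hz (S.face_subset_bdry i (mem_image_of_mem _ hz'))

theorem PwSmooth.memLp {S : Surface} {w : E3 → ℂ} (hw : S.PwSmooth w) : MemLp w 2 S.σ := by
  have hσ : S.σ.restrict S.bdry = S.σ := Measure.restrict_eq_self_of_ae_mem S.ae_mem_bdry
  obtain ⟨M, hM⟩ := S.isCompact_bdry.exists_bound_of_continuousOn hw.1
  have h1 : AEStronglyMeasurable w (S.σ.restrict S.bdry) :=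
    hw.1.aestronglyMeasurable S.isCompact_bdry.measurableSet
  rw [← hσ]
  refine MemLp.of_bound h1 M ?_
  exact ae_restrict_of_forall_mem S.isCompact_bdry.measurableSet hM

end Surface

/-! ### Plane sectors -/

theorem corner_ne {q : Fin 4 → ℂ} (h₁ : 0 < cross (q 1 - q 0) (q 2 - q 0))
    (h₂ : 0 < cross (q 2 - q 0) (q 3 - q 0)) (v : Fin 4) : q (v + 1) - q v ≠ 0 := by
  have e : (3 : Fin 4) + 1 = 0 := by decide
  intro h
  fin_cases v <;> simp only [Fin.isValue, Fin.mk_one, Fin.reduceFinMk, Fin.zero_eta, zero_add,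
    Fin.reduceAdd, e] at h
  · simp [h, cross] at h₁
  · rw [sub_eq_zero.1 h, cross_self] at h₁; exact lt_irrefl _ h₁
  · rw [sub_eq_zero.1 h, cross_self] at h₂; exact lt_irrefl _ h₂
  · rw [sub_eq_zero.1 h, sub_self] at h₂; simp [cross] at h₂

/-- The unit vector along the edge from `q v` to `q (v + 1)`. -/
def edgeDir (q : Fin 4 → ℂ) (v : Fin 4) : ℂ := (q (v + 1) - q v) / (‖q (v + 1) - q v‖ : ℂ)

theorem norm_edgeDir {q : Fin 4 → ℂ} {v : Fin 4} (h : q (v + 1) - q v ≠ 0) :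
    ‖edgeDir q v‖ = 1 := by
  simp [edgeDir, h]

theorem cornerPolar_eq (q : Fin 4 → ℂ) (v : Fin 4) (x : ℝ × ℝ) : cornerPolar q v x =
    q v + edgeDir q v * ((x.1 : ℂ) * Complex.exp ((x.2 : ℂ) * Complex.I)) := rfl

theorem contDiff_cornerPolar (q : Fin 4 → ℂ) (v : Fin 4) : ContDiff ℝ ∞ (cornerPolar q v) := by
  have h1 : ContDiff ℝ ∞ fun x : ℝ × ℝ => (x.1 : ℂ) := Complex.ofRealCLM.contDiff.comp contDiff_fst
  have h2 : ContDiff ℝ ∞ fun x : ℝ × ℝ => (x.2 : ℂ) := Complex.ofRealCLM.contDiff.comp contDiff_snd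
  exact contDiff_const.add (contDiff_const.mul (h1.mul (h2.mul contDiff_const).cexp))

theorem interiorAngle_le (q : Fin 4 → ℂ) (v : Fin 4) : interiorAngle q v ≤ 2 * Real.pi := by
  have h := Complex.arg_le_pi ((q (v + 3) - q v) / (q (v + 1) - q v))
  have := Real.pi_pos
  simp only [interiorAngle]
  split_ifs with h' <;> linarith

theorem isOpen_strip (γ : ℝ) : IsOpen (strip γ) := isOpen_Ioi.prod isOpen_Ioo

section Sector

variable {q : Fin 4 → ℂ} {v : Fin 4} {γ : ℝ}

theorem cornerPolar_eq_cornerPolar (hq : q (v + 1) - q v ≠ 0) {x y : ℝ × ℝ}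
    (h : cornerPolar q v x = cornerPolar q v y) (hx : 0 < x.1) (hy : 0 < y.1)
    (hxy : |x.2 - y.2| < 2 * Real.pi) : x = y := by
  have hd : edgeDir q v ≠ 0 := by
    rw [← norm_ne_zero_iff, norm_edgeDir hq]; exact one_ne_zero
  rw [cornerPolar_eq, cornerPolar_eq] at h
  have h1 := mul_left_cancel₀ hd (add_left_cancel h)
  have h2 : x.1 = y.1 := by
    have := congrArg norm h1
    simpa [Complex.norm_exp, abs_of_pos hx, abs_of_pos hy] using this
  rw [h2] at h1
  have h3 := mul_left_cancel₀ (by exact_mod_cast hy.ne') h1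
  rw [Complex.exp_eq_exp_iff_exists_int] at h3
  obtain ⟨n, hn⟩ := h3
  have h4 : x.2 - y.2 = n * (2 * Real.pi) := by
    have := congrArg Complex.im hn
    simp at this
    linarith
  have h5 : n = 0 := by
    rw [h4, abs_mul, abs_of_pos (by positivity : 0 < 2 * Real.pi)] at hxy
    have h6 : |(n : ℝ)| < 1 := by
      by_contra h7
      have := Real.pi_pos
      nlinarith [not_lt.1 h7]
    exact Int.abs_lt_one_iff.1 (by exact_mod_cast h6)
  rw [h5] at h4
  exact Prod.ext h2 (by simp at h4; linarith)

theorem injOn_cornerPolar (hq : q (v + 1) - q v ≠ 0) :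
    InjOn (cornerPolar q v) (strip (2 * Real.pi)) := by
  rintro x ⟨hx, hx'⟩ y ⟨hy, hy'⟩ h
  refine cornerPolar_eq_cornerPolar hq h hx hy ?_
  rw [abs_lt]
  constructor <;> linarith [hx'.1, hx'.2, hy'.1, hy'.2]

theorem strip_mono {γ γ' : ℝ} (h : γ ≤ γ') : strip γ ⊆ strip γ' :=
  prod_mono subset_rfl (Ioo_subset_Ioo_right h)

/-- Polar coordinates in a plane sector. -/
theorem lintegral_cornerPolar (hq : q (v + 1) - q v ≠ 0) (hγ : γ ≤ 2 * Real.pi)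
    (f : ℂ → ℝ≥0∞) : ∫⁻ x, f (cornerPolar q v x) ∂polarMeasure γ =
      ∫⁻ z in cornerPolar q v '' strip γ, f z := by
  set D := edgeDir q v with hD
  -- `polarCoord` uses angles in `(-π, π)`, the sector uses angles in `(0, γ)`; rotating by `-D`
  -- instead of `D` shifts the angle by `π`.
  set ϑ : Circle := ⟨-D, by simp [Submonoid.unitSphere, hD, norm_edgeDir hq]⟩ with hϑ
  have hms : MeasurableSet (strip γ) := (isOpen_strip γ).measurableSet
  have hmi : MeasurableSet (cornerPolar q v '' strip γ) :=
    hms.image_of_continuousOn_injOn (contDiff_cornerPolar q v).continuous.continuousOn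
      ((injOn_cornerPolar hq).mono (strip_mono hγ))
  set F : ℂ → ℝ≥0∞ := (cornerPolar q v '' strip γ).indicator f with hF
  have h1 : ∫⁻ z in cornerPolar q v '' strip γ, f z = ∫⁻ z, F z := (lintegral_indicator hmi f).symm
  have h2 : ∫⁻ z, F z = ∫⁻ w, F (q v + (-D) * w) := by
    rw [← lintegral_add_left_eq_self F (q v)]
    exact ((rotation ϑ).measurePreserving.lintegral_comp_emb
      (rotation ϑ).toHomeomorph.measurableEmbedding (fun w => F (q v + w))).symm
  have h3 : ∀ p : ℝ × ℝ, F (q v + (-D) * Complex.polarCoord.symm p) =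
      F (cornerPolar q v (p + (0, Real.pi))) := by
    intro p
    congr 1
    rw [cornerPolar_eq, Complex.polarCoord_symm_apply, ← hD]
    simp only [Prod.fst_add, Prod.snd_add, add_zero]
    push_cast
    rw [add_mul, Complex.exp_add, Complex.exp_pi_mul_I, Complex.exp_mul_I]
    ring
  have h4 : ∫⁻ w, F (q v + (-D) * w) = ∫⁻ p in polarCoord.target,
      ENNReal.ofReal p.1 * F (cornerPolar q v (p + (0, Real.pi))) := by
    rw [← Complex.lintegral_comp_polarCoord_symm]
    refine lintegral_congr fun p => ?_
    rw [h3, smul_eq_mul]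
  have h5 : ∫⁻ p in polarCoord.target, ENNReal.ofReal p.1 * F (cornerPolar q v (p + (0, Real.pi))) =
      ∫⁻ x in strip (2 * Real.pi), ENNReal.ofReal x.1 * F (cornerPolar q v x) := by
    have hmt : MeasurableSet polarCoord.target := polarCoord.open_target.measurableSet
    rw [← lintegral_indicator hmt, ← lintegral_indicator (isOpen_strip _).measurableSet,
      ← lintegral_add_right_eq_self ((strip (2 * Real.pi)).indicator fun x =>
        ENNReal.ofReal x.1 * F (cornerPolar q v x)) ((0, Real.pi) : ℝ × ℝ)]
    refine lintegral_congr fun p => ?_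
    have hp : p ∈ polarCoord.target ↔ p + (0, Real.pi) ∈ strip (2 * Real.pi) := by
      simp only [polarCoord_target, strip, mem_prod, mem_Ioi, mem_Ioo, Prod.fst_add, Prod.snd_add,
        add_zero]
      refine and_congr_right fun _ => ⟨fun h => ⟨?_, ?_⟩, fun h => ⟨?_, ?_⟩⟩ <;> linarith [h.1, h.2]
    by_cases h : p ∈ polarCoord.target
    · rw [Set.indicator_of_mem h, Set.indicator_of_mem (hp.1 h)]
      simp
    · rw [Set.indicator_of_notMem h, Set.indicator_of_notMem (fun h' => h (hp.2 h'))]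
  have h6 : ∫⁻ x in strip (2 * Real.pi), ENNReal.ofReal x.1 * F (cornerPolar q v x) =
      ∫⁻ x in strip γ, ENNReal.ofReal x.1 * f (cornerPolar q v x) := by
    rw [← lintegral_indicator (isOpen_strip _).measurableSet, ← lintegral_indicator hms]
    refine lintegral_congr fun x => ?_
    by_cases hx : x ∈ strip γ
    · rw [Set.indicator_of_mem (strip_mono hγ hx), Set.indicator_of_mem hx, hF,
        Set.indicator_of_mem (mem_image_of_mem _ hx)]
    · rw [Set.indicator_of_notMem hx]
      by_cases hx' : x ∈ strip (2 * Real.pi)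
      · rw [Set.indicator_of_mem hx', hF, Set.indicator_of_notMem, mul_zero]
        rintro ⟨y, hy, hyx⟩
        exact hx (injOn_cornerPolar hq (strip_mono hγ hy) hx' hyx ▸ hy)
      · rw [Set.indicator_of_notMem hx']
  rw [h1, h2, h4, h5, h6, polarMeasure, lintegral_withDensity_eq_lintegral_mul_non_measurable]
  · rfl
  · exact ENNReal.measurable_ofReal.comp measurable_fst
  · exact Filter.Eventually.of_forall fun x => ENNReal.ofReal_lt_top

theorem dist_cornerPolar_le (hq : q (v + 1) - q v ≠ 0) {r : ℝ} (hr : 0 ≤ r) (s t : ℝ) :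
    dist (cornerPolar q v (r, s)) (cornerPolar q v (r, t)) ≤ r * |s - t| := by
  rw [cornerPolar_eq, cornerPolar_eq, dist_add_left, dist_eq_norm, ← mul_sub, norm_mul,
    norm_edgeDir hq, one_mul, ← mul_sub, norm_mul, Complex.norm_real, Real.norm_of_nonneg hr]
  gcongr
  have h : Complex.exp (s * Complex.I) - Complex.exp (t * Complex.I) =
      Complex.exp (t * Complex.I) * (Complex.exp (Complex.I * (s - t : ℝ)) - 1) := by
    rw [mul_sub, ← Complex.exp_add, mul_one]
    congr 2
    push_cast; ring
  rw [h, norm_mul, Complex.norm_exp_ofReal_mul_I, one_mul]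
  exact Real.norm_exp_I_mul_ofReal_sub_one_le

/-- A point of the sector that is far from the part of the quadrilateral outside of the sector: its
distance to the rim is controlled by its angular distance to the sides of the sector. -/
theorem min_rimDist_le (hq : q (v + 1) - q v ≠ 0) (hγ : γ ≤ 2 * Real.pi) {x : ℝ × ℝ}
    (hx : x ∈ strip γ) (hxq : cornerPolar q v x ∈ quad q) {C₁ : ℝ}
    (hfar : ∀ y ∈ quad q \ cornerPolar q v '' strip γ, C₁ ≤ dist (cornerPolar q v x) y) :
    min C₁ (rimDist q (cornerPolar q v x)) ≤ x.1 * min x.2 (γ - x.2) := by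
  have hr : 0 < x.1 := hx.1
  -- Travel from `x` along the arc of constant radius to the side `ϑ` of the sector. Either the arc
  -- meets the rim, or it stays in the quadrilateral and ends at a point outside the open sector,
  -- which is at distance at least `C₁`. In both cases the distance is bounded by the arc length.
  have key : ∀ ϑ : ℝ, (x.1, ϑ) ∉ strip γ →
      (∀ y ∈ strip γ, |ϑ - y.2| < 2 * Real.pi) →
      min C₁ (rimDist q (cornerPolar q v x)) ≤ x.1 * |x.2 - ϑ| := by
    intro ϑ hϑ hϑ'
    set c : ℝ → ℂ := fun t => cornerPolar q v (x.1, t) with hc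
    have hcc : Continuous c := (contDiff_cornerPolar q v).continuous.comp (by fun_prop)
    have hdist : ∀ t ∈ uIcc x.2 ϑ, dist (cornerPolar q v x) (c t) ≤ x.1 * |x.2 - ϑ| := by
      intro t ht
      refine (dist_cornerPolar_le hq hr.le x.2 t).trans ?_
      refine mul_le_mul_of_nonneg_left ?_ hr.le
      rw [abs_sub_comm, abs_sub_comm x.2]
      exact abs_sub_left_of_mem_uIcc ht
    by_cases hf : ∃ t ∈ uIcc x.2 ϑ, c t ∈ frontier (quad q)
    · obtain ⟨t, ht, htf⟩ := hf
      exact (min_le_right _ _).trans ((Metric.infDist_le_dist_of_mem htf).trans (hdist t ht))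
    · push Not at hf
      have hsub : c '' uIcc x.2 ϑ ⊆ quad q := by
        have hpre : IsPreconnected (c '' uIcc x.2 ϑ) :=
          isPreconnected_uIcc.image c hcc.continuousOn
        by_contra hns
        obtain ⟨y, hy, hyq⟩ := not_subset.1 hns
        have := isPreconnected_iff_subset_of_disjoint.1 hpre (quad q) (closure (quad q))ᶜ
          (isOpen_quad q) isClosed_closure.isOpen_compl (by
            rintro _ ⟨t, ht, rfl⟩
            by_cases h : c t ∈ quad q
            · exact .inl h
            · refine .inr fun h' => hf t ht ?_
              rw [(isOpen_quad q).frontier_eq]; exact ⟨h', h⟩) (by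
            rw [show quad q ∩ (closure (quad q))ᶜ = ∅ from
              disjoint_iff_inter_eq_empty.1 (disjoint_compl_right_iff_subset.2 subset_closure),
              inter_empty])
        rcases this with h | h
        · exact hyq (h hy)
        · exact h (mem_image_of_mem c left_mem_uIcc) (subset_closure hxq)
      have h1 : c ϑ ∈ quad q := hsub (mem_image_of_mem c right_mem_uIcc)
      have h2 : c ϑ ∉ cornerPolar q v '' strip γ := by
        rintro ⟨y, hy, hyx⟩
        have := cornerPolar_eq_cornerPolar hq hyx.symm hr hy.1 (hϑ' y hy)
        exact hϑ (this ▸ hy)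
      exact (min_le_left _ _).trans ((hfar _ ⟨h1, h2⟩).trans (hdist ϑ right_mem_uIcc))
  have hx2 := hx.2
  rw [mul_min_of_nonneg _ _ hr.le]
  refine le_min ?_ ?_
  · have := key 0 (fun h => lt_irrefl _ h.2.1)
      (fun y hy => by rw [zero_sub, abs_neg, abs_of_pos hy.2.1]; linarith [hy.2.2])
    rwa [sub_zero, abs_of_pos hx2.1] at this
  · have := key γ (fun h => lt_irrefl _ h.2.2)
      (fun y hy => by rw [abs_of_pos (by linarith [hy.2.2])]; linarith [hy.2.1])
    rwa [abs_sub_comm, abs_of_pos (by linarith [hx2.2])] at this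

end Sector

/-! ### The part of a patch on which a vertex cut-off lives -/

namespace Surface

variable {S : Surface}

theorem coneFace_eq (i : Fin S.I) (v : Fin 4) : S.coneFace i v =
    (S.patch i).chart '' (cornerPolar (S.patch i).q v '' strip (S.angle i v)) := by
  rw [image_image]; rfl

/-- The part of the patch `i` where the cut-off function of the corner `v` lives. -/
def Resolution.active (R : S.Resolution) (i : Fin S.I) (v : Fin 4) : Set ℂ :=
  quad (S.patch i).q ∩ closure {z ∈ quad (S.patch i).q | (S.patch i).chart z ∈ R.U₁ (S.vert i v)}

variable (R : S.Resolution)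

/-- The cone condition places the point only in the closed sector. If it were outside the open
sector, nearby points of the sector would still lie in the relatively open set `U₁`, at a distance
less than `C₁` from `z`, against the separation condition. -/
theorem Resolution.mem_sector_of_mem_U₁ {i : Fin S.I} {v : Fin 4} {z : ℂ}
    (hz : z ∈ quad (S.patch i).q) (hU : (S.patch i).chart z ∈ R.U₁ (S.vert i v)) :
    z ∈ cornerPolar (S.patch i).q v '' strip (S.angle i v) := by
  set F := S.patch i
  set n := S.vert i v
  have hc : (i, v) ∈ S.corners n := by simp [corners, n]
  by_contra hns
  have h1 := R.in_cone n (i, v) hc ⟨hU, subset_closure (mem_image_of_mem _ hz)⟩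
  rw [coneFace_eq, F.isClosedEmbedding_chart.closure_image_eq,
    F.chart.injective.mem_set_image] at h1
  obtain ⟨O, hO, hOU⟩ := R.isOpen_U₁ n
  have hN : quad F.q ∩ F.chart ⁻¹' O ∩ Metric.ball z R.C₁ ∈ nhds z := by
    refine Filter.inter_mem (Filter.inter_mem ((isOpen_quad _).mem_nhds hz)
      ((hO.preimage F.chart.continuous).mem_nhds ?_)) (Metric.ball_mem_nhds z R.C₁_pos)
    rw [hOU] at hU; exact hU.1
  obtain ⟨y, ⟨⟨hy1, hy2⟩, hy3⟩, hy4⟩ := mem_closure_iff_nhds.1 h1 _ hN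
  have hyU : F.chart y ∈ R.U₁ n := by
    rw [hOU]; exact ⟨hy2, S.face_subset_bdry i (mem_image_of_mem _ hy1)⟩
  have := R.far_outside n (i, v) hc (F.chart y) ⟨hyU, by
      rw [coneFace_eq]; exact mem_image_of_mem _ hy4⟩ (F.chart z)
    ⟨mem_image_of_mem _ hz, by rw [coneFace_eq, F.chart.injective.mem_set_image]; exact hns⟩
  rw [F.chart.dist_map] at this
  exact absurd hy3 (not_lt.2 this)

/-- The separation inequality is not strict and so survives the closure in `active`. That closure is
taken so that the cut-off vanishes in a neighbourhood of every other point of the patch, and with it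
all derivatives. -/
theorem Resolution.le_dist_of_mem_active {i : Fin S.I} {v : Fin 4} {z : ℂ}
    (hz : z ∈ R.active i v) {y : ℂ}
    (hy : y ∈ quad (S.patch i).q \ cornerPolar (S.patch i).q v '' strip (S.angle i v)) :
    R.C₁ ≤ dist z y := by
  have hc : (i, v) ∈ S.corners (S.vert i v) := by simp [corners]
  have hcl : IsClosed {z : ℂ | R.C₁ ≤ dist z y} :=
    isClosed_le continuous_const (continuous_id.dist continuous_const)
  refine hcl.closure_subset_iff.2 ?_ hz.2
  rintro w ⟨hw, hwU⟩
  have := R.far_outside _ (i, v) hc ((S.patch i).chart w) ⟨hwU, by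
      rw [coneFace_eq]; exact mem_image_of_mem _ (R.mem_sector_of_mem_U₁ hw hwU)⟩
    ((S.patch i).chart y) ⟨mem_image_of_mem _ hy.1, by
      rw [coneFace_eq, (S.patch i).chart.injective.mem_set_image]; exact hy.2⟩
  rwa [(S.patch i).chart.dist_map] at this

theorem Resolution.active_subset_sector (i : Fin S.I) (v : Fin 4) :
    R.active i v ⊆ cornerPolar (S.patch i).q v '' strip (S.angle i v) := by
  intro z hz
  by_contra hns
  have := R.le_dist_of_mem_active hz ⟨hz.1, hns⟩
  rw [dist_self] at this
  exact absurd R.C₁_pos (not_lt.2 this)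

theorem Resolution.eventually_eq_zero {i : Fin S.I} {v : Fin 4} {z : ℂ}
    (hz : z ∈ quad (S.patch i).q) (hz' : z ∉ R.active i v) :
    ∀ᶠ y in nhds z, R.φ (S.vert i v) ((S.patch i).chart y) = 0 := by
  have h1 : z ∉ closure {z ∈ quad (S.patch i).q | (S.patch i).chart z ∈ R.U₁ (S.vert i v)} :=
    fun h => hz' ⟨hz, h⟩
  filter_upwards [isClosed_closure.isOpen_compl.mem_nhds h1, (isOpen_quad _).mem_nhds hz]
    with y hy hyq
  refine R.eq_zero _ _ ⟨S.face_subset_bdry i (mem_image_of_mem _ hyq), fun hU => ?_⟩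
  exact hy (subset_closure ⟨hyq, hU⟩)

theorem Resolution.min_rimDist_le_of_mem_active {i : Fin S.I} {v : Fin 4} {x : ℝ × ℝ}
    (hx : x ∈ strip (S.angle i v)) (hxa : cornerPolar (S.patch i).q v x ∈ R.active i v) :
    min R.C₁ (rimDist (S.patch i).q (cornerPolar (S.patch i).q v x)) ≤
      x.1 * min x.2 (S.angle i v - x.2) :=
  min_rimDist_le (corner_ne (S.patch i).ccw_left (S.patch i).ccw_right v) (interiorAngle_le _ _) hx
    hxa.1 fun _ hy => R.le_dist_of_mem_active hxa hy

end Surface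

/-! ### Cartesian derivatives in terms of polar derivatives -/

theorem pd_sub_const {V : Type*} [NormedAddCommGroup V] [NormedSpace ℝ V] (v : ℝ × ℝ)
    (F : ℝ × ℝ → V) (c : V) : pd v (fun x => F x - c) = pd v F := by
  ext x; simp only [pd, fderiv_sub_const]

theorem mixedPd_sub_const {V : Type*} [NormedAddCommGroup V] [NormedSpace ℝ V] {a b : ℕ}
    (hab : 1 ≤ a + b) (F : ℝ × ℝ → V) (c : V) : mixedPd a b (fun x => F x - c) = mixedPd a b F := by
  unfold mixedPd
  rcases b with _ | b
  · obtain ⟨a, rfl⟩ : ∃ a', a = a' + 1 := ⟨a - 1, by omega⟩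
    simp only [Function.iterate_zero, id, Function.iterate_succ_apply, pd_sub_const]
  · simp only [Function.iterate_succ_apply, pd_sub_const]

/-- Rescaling the radius and shifting the angle moves the base point to `(1, 0)`; each radial
derivative gains a factor `r`, which produces the scale-invariant quantities `r ^ a ∂_r^a ∂_φ^b`. -/
theorem mixedPd_comp_scale {F : ℝ × ℝ → ℂ} {U : Set (ℝ × ℝ)} (hU : IsOpen U)
    (hF : ContDiffOn ℝ ∞ F U) (r φ : ℝ) (a b : ℕ) {y : ℝ × ℝ} (hy : (r * y.1, φ + y.2) ∈ U) :
    mixedPd a b (fun y : ℝ × ℝ => F (r * y.1, φ + y.2)) y =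
      r ^ a • mixedPd a b F (r * y.1, φ + y.2) := by
  set A : ℝ × ℝ → ℝ × ℝ := fun y => (r * y.1, φ + y.2) with hA
  have hAc : Continuous A := by fun_prop
  have hUo : IsOpen (A ⁻¹' U) := hU.preimage hAc
  have hAd : ∀ y, HasFDerivAt A ((r • ContinuousLinearMap.fst ℝ ℝ ℝ).prod
      (ContinuousLinearMap.snd ℝ ℝ ℝ)) y := fun y =>
    (hasFDerivAt_fst.const_mul r).prodMk (hasFDerivAt_snd.const_add φ)
  have step : ∀ {H : ℝ × ℝ → ℂ} (v : ℝ × ℝ), ContDiffOn ℝ ∞ H U → ∀ y ∈ A ⁻¹' U,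
      pd v (H ∘ A) y = pd (r * v.1, v.2) H (A y) := by
    intro H v hH y hy
    have := ((hH.contDiffAt (hU.mem_nhds hy)).differentiableAt (by simp)).hasFDerivAt.comp y (hAd y)
    simp only [pd]
    rw [this.fderiv]
    simp
  have hb : ∀ b : ℕ, EqOn ((pd (0, 1))^[b] (F ∘ A)) ((pd (0, 1))^[b] F ∘ A) (A ⁻¹' U) := by
    intro b
    induction b with
    | zero => exact fun _ _ => rfl
    | succ b ih =>
      simp only [Function.iterate_succ_apply']
      intro y hy
      rw [pd_congr hUo ih _ hy, step _ (contDiffOn_pd_iterate hU hF _ b) y hy]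
      simp
  have ha : ∀ a : ℕ, EqOn (mixedPd a b (F ∘ A)) (fun y => r ^ a • mixedPd a b F (A y)) (A ⁻¹' U) := by
    intro a
    induction a with
    | zero => intro y hy; simpa [mixedPd] using hb b hy
    | succ a ih =>
      have e : ∀ H : ℝ × ℝ → ℂ, mixedPd (a + 1) b H = pd (1, 0) (mixedPd a b H) := fun H => by
        simp only [mixedPd, Function.iterate_succ_apply']
      intro y hy
      have hs := contDiffOn_mixedPd hU hF a b
      have hd : DifferentiableAt ℝ (mixedPd a b F ∘ A) y :=
        ((hs.contDiffAt (hU.mem_nhds hy)).differentiableAt (by simp)).comp y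
          (hAd y).differentiableAt
      rw [e, e, pd_congr hUo ih _ hy]
      have h1 : pd (1, 0) (fun y => r ^ a • mixedPd a b F (A y)) y =
          r ^ a • pd (1, 0) (mixedPd a b F ∘ A) y := by
        simp only [pd]
        have := (hd.hasFDerivAt.const_smul (r ^ a)).fderiv
        exact (congrArg (fun L : ℝ × ℝ →L[ℝ] ℂ => L (1, 0)) this)
      rw [h1, step _ hs y hy]
      have h2 : pd (r * (1, 0).1, (1, 0).2) (mixedPd a b F) (A y) =
          r • pd (1, 0) (mixedPd a b F) (A y) := by
        simp only [pd]
        rw [← map_smul]; simp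
      rw [h2, smul_smul, ← pow_succ]
  exact ha a hy

/-- The principal polar coordinates of a complex number. -/
def polarPair (w : ℂ) : ℝ × ℝ := (‖w‖, w.arg)

theorem contDiffOn_polarPair : ContDiffOn ℝ ∞ polarPair Complex.slitPlane := by
  intro w hw
  have h1 : ContDiffAt ℝ ∞ (fun w : ℂ => ‖w‖) w := contDiffAt_norm ℝ (Complex.slitPlane_ne_zero hw)
  have h2 : ContDiffAt ℝ ∞ (fun w : ℂ => (Complex.log w).im) w :=
    Complex.imCLM.contDiff.contDiffAt.comp w ((Complex.contDiffAt_log hw).restrict_scalars ℝ)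
  have h3 : polarPair = fun w : ℂ => (‖w‖, (Complex.log w).im) := by
    ext w <;> simp [polarPair, Complex.log_im]
  rw [h3]
  exact (h1.prodMk h2).contDiffWithinAt

theorem norm_iteratedFDeriv_sub_mul_le (p c z : ℂ) {i : ℕ} (hi : 1 ≤ i) :
    ‖iteratedFDeriv ℝ i (fun z => c * (z - p)) z‖ ≤ ‖c‖ ^ i := by
  obtain ⟨i, rfl⟩ : ∃ i', i = i' + 1 := ⟨i - 1, by omega⟩
  have h1 : fderiv ℝ (fun z : ℂ => c * (z - p)) = fun _ => ContinuousLinearMap.mul ℝ ℂ c := by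
    ext1 z
    exact ((ContinuousLinearMap.mul ℝ ℂ c).hasFDerivAt.comp z
      ((hasFDerivAt_id z).sub_const p)).fderiv.trans (by ext; simp)
  rw [← norm_iteratedFDeriv_fderiv, h1]
  rcases i with _ | i
  · rw [norm_iteratedFDeriv_zero]
    simp
  · rw [iteratedFDeriv_const_of_ne (by omega)]
    simp

/-- By homogeneity only the derivatives of `polarPair` at the point `1` enter; the linear map `z ↦
u⁻¹ (z - p)` contributes a factor `‖u‖⁻¹` per order. -/
theorem exists_norm_iteratedFDeriv_polarPair_le (m : ℕ) : ∃ K : ℝ, 1 ≤ K ∧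
    ∀ (p u : ℂ), u ≠ 0 → ∀ i, 1 ≤ i → i ≤ m →
      ‖iteratedFDeriv ℝ i (fun z => polarPair (u⁻¹ * (z - p))) (p + u)‖ ≤ (K * ‖u‖⁻¹) ^ i := by
  set K₀ : ℝ := 1 + ∑ i ∈ Finset.range (m + 1),
    ‖iteratedFDerivWithin ℝ i polarPair Complex.slitPlane 1‖ with hK₀
  have hK₀1 : 1 ≤ K₀ := by
    rw [hK₀]; linarith [Finset.sum_nonneg fun i (_ : i ∈ Finset.range (m + 1)) =>
      norm_nonneg (iteratedFDerivWithin ℝ i polarPair Complex.slitPlane 1)]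
  have hf1 : (1 : ℝ) ≤ m.factorial := by exact_mod_cast Nat.factorial_pos m
  refine ⟨m.factorial * K₀, one_le_mul_of_one_le_of_one_le hf1 hK₀1, fun p u hu i hi him => ?_⟩
  set ℓ : ℂ → ℂ := fun z => u⁻¹ * (z - p) with hℓ
  have hℓc : ContDiff ℝ ∞ ℓ := contDiff_const.mul (contDiff_id.sub contDiff_const)
  set s := ℓ ⁻¹' Complex.slitPlane with hs
  have hso : IsOpen s := Complex.isOpen_slitPlane.preimage hℓc.continuous
  have hℓ1 : ℓ (p + u) = 1 := by simp [hℓ, hu]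
  have hmem : p + u ∈ s := by
    rw [hs, mem_preimage, hℓ1]; exact Complex.one_mem_slitPlane
  have := norm_iteratedFDerivWithin_comp_le (n := i) (N := ∞) contDiffOn_polarPair hℓc.contDiffOn
    (by exact_mod_cast le_top)
    Complex.isOpen_slitPlane.uniqueDiffOn hso.uniqueDiffOn (mapsTo_preimage _ _) hmem
    (C := K₀) (D := ‖u‖⁻¹) (fun j hj => by
      rw [hℓ1]
      refine (Finset.single_le_sum (f := fun i =>
        ‖iteratedFDerivWithin ℝ i polarPair Complex.slitPlane 1‖) (fun _ _ => norm_nonneg _)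
        (Finset.mem_range.2 (by omega : j < m + 1))).trans ?_
      rw [hK₀]; linarith) (fun j hj _ => by
      rw [iteratedFDerivWithin_of_isOpen j hso hmem]
      refine (norm_iteratedFDeriv_sub_mul_le p u⁻¹ _ hj).trans ?_
      rw [norm_inv])
  rw [iteratedFDerivWithin_of_isOpen i hso hmem] at this
  refine this.trans ?_
  rw [mul_pow]
  gcongr
  calc (i.factorial : ℝ) * K₀ ≤ m.factorial * K₀ := by
        gcongr
    _ ≤ _ := le_self_pow₀ (one_le_mul_of_one_le_of_one_le hf1 hK₀1) (by omega)

/-- Multiplication of complex numbers multiplies radii and adds angles. Polar coordinates relative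
to the base point avoid the branch cut: there the relative quotient is `1`, wherever the base point
lies. -/
theorem cornerPolar_polarPair (q : Fin 4 → ℂ) (v : Fin 4) (x : ℝ × ℝ)
    (hx : cornerPolar q v x - q v ≠ 0) (z : ℂ) :
    cornerPolar q v
      (x.1 * (polarPair ((cornerPolar q v x - q v)⁻¹ * (z - q v))).1,
        x.2 + (polarPair ((cornerPolar q v x - q v)⁻¹ * (z - q v))).2) = z := by
  set w := (cornerPolar q v x - q v)⁻¹ * (z - q v) with hw
  have h1 : (cornerPolar q v x - q v) * w = z - q v := by rw [hw, mul_inv_cancel_left₀ hx]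
  have h2 : cornerPolar q v x - q v =
      edgeDir q v * ((x.1 : ℂ) * Complex.exp ((x.2 : ℂ) * Complex.I)) := by
    rw [cornerPolar_eq, add_sub_cancel_left]
  rw [cornerPolar_eq]
  simp only [polarPair]
  push_cast
  rw [add_mul, Complex.exp_add]
  have h3 := Complex.norm_mul_exp_arg_mul_I w
  calc _ = q v + (edgeDir q v * ((x.1 : ℂ) * Complex.exp ((x.2 : ℂ) * Complex.I))) *
        ((‖w‖ : ℂ) * Complex.exp (w.arg * Complex.I)) := by ring
    _ = _ := by rw [← h2, h3, h1]; ring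

/-- Near `z₀` the function `G` factors through relative polar coordinates. The outer map has
derivatives `r ^ a ∂_r^a ∂_φ^b` at `(1, 0)`, the inner map has derivatives of size `r ^ (-i)`, and
the composition estimate multiplies the two. -/
theorem exists_norm_iteratedFDeriv_le_polar_aux (m : ℕ) : ∃ C : ℝ, 0 ≤ C ∧
    ∀ (q : Fin 4 → ℂ) (v : Fin 4), q (v + 1) - q v ≠ 0 → ∀ (G : ℂ → ℂ) (W : Set ℂ), IsOpen W →
      ContDiffOn ℝ ∞ G W → ∀ x : ℝ × ℝ, 0 < x.1 → cornerPolar q v x ∈ W → ∀ M : ℝ,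
      (∀ a b, a + b ≤ m → x.1 ^ a * ‖mixedPd a b (fun y => G (cornerPolar q v y)) x‖ ≤ M) →
      ‖iteratedFDeriv ℝ m G (cornerPolar q v x)‖ ≤ C * M * (x.1 ^ m)⁻¹ := by
  obtain ⟨K, hK1, hK⟩ := exists_norm_iteratedFDeriv_polarPair_le m
  refine ⟨m.factorial * 2 ^ m * K ^ m, by positivity, ?_⟩
  intro q v hq G W hW hG x hx hxW M hM
  set z₀ := cornerPolar q v x with hz₀
  set u := z₀ - q v with hu
  have hun : ‖u‖ = x.1 := by
    rw [hu, hz₀, cornerPolar_eq, add_sub_cancel_left, norm_mul, norm_edgeDir hq, norm_mul,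
      Complex.norm_exp_ofReal_mul_I, Complex.norm_real, Real.norm_of_nonneg hx.le]; ring
  have hu0 : u ≠ 0 := by rw [← norm_ne_zero_iff, hun]; exact hx.ne'
  have hzu : q v + u = z₀ := by rw [hu]; ring
  set f₁ : ℂ → ℝ × ℝ := fun z => polarPair (u⁻¹ * (z - q v)) with hf₁
  have hℓc : Continuous fun z : ℂ => u⁻¹ * (z - q v) := by fun_prop
  set s := (fun z => u⁻¹ * (z - q v)) ⁻¹' Complex.slitPlane ∩ W with hs
  have hso : IsOpen s := (Complex.isOpen_slitPlane.preimage hℓc).inter hW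
  have h1 : u⁻¹ * (z₀ - q v) = 1 := by rw [← hu]; exact inv_mul_cancel₀ hu0
  have hzs : z₀ ∈ s := ⟨by rw [mem_preimage, h1]; exact Complex.one_mem_slitPlane, hxW⟩
  have hf₁z : f₁ z₀ = (1, 0) := by
    change polarPair (u⁻¹ * (z₀ - q v)) = _
    rw [h1]; simp [polarPair]
  have hf₁c : ContDiffOn ℝ ∞ f₁ s :=
    contDiffOn_polarPair.comp (contDiff_const.mul (contDiff_id.sub contDiff_const)).contDiffOn
      (fun z hz => hz.1)
  set f : ℝ × ℝ → ℂ := fun y => G (cornerPolar q v y) with hf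
  set U := cornerPolar q v ⁻¹' W with hU
  have hUo : IsOpen U := hW.preimage (contDiff_cornerPolar q v).continuous
  have hfc : ContDiffOn ℝ ∞ f U :=
    hG.comp (contDiff_cornerPolar q v).contDiffOn (mapsTo_preimage _ _)
  set F : ℝ × ℝ → ℂ := fun y => f (x.1 * y.1, x.2 + y.2) with hF
  have hAs : ContDiff ℝ ∞ fun y : ℝ × ℝ => (x.1 * y.1, x.2 + y.2) :=
    (contDiff_const.mul contDiff_fst).prodMk (contDiff_const.add contDiff_snd)
  set t := (fun y : ℝ × ℝ => (x.1 * y.1, x.2 + y.2)) ⁻¹' U with ht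
  have hto : IsOpen t := hUo.preimage hAs.continuous
  have hFc : ContDiffOn ℝ ∞ F t := hfc.comp hAs.contDiffOn (mapsTo_preimage _ _)
  have hst : MapsTo f₁ s t := by
    intro z hz
    change cornerPolar q v _ ∈ W
    rw [cornerPolar_polarPair q v x hu0 z]
    exact hz.2
  have hGF : EqOn G (F ∘ f₁) s := by
    intro z _
    change G z = G (cornerPolar q v _)
    rw [cornerPolar_polarPair q v x hu0 z]
  have h10 : ((1 : ℝ), (0 : ℝ)) ∈ t := hf₁z ▸ hst hzs
  have hM0 : 0 ≤ M := (by positivity : (0 : ℝ) ≤ _).trans (hM 0 0 (by omega))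
  have key := norm_iteratedFDerivWithin_comp_le (n := m) (N := ∞) hFc hf₁c
    (by exact_mod_cast le_top) hto.uniqueDiffOn hso.uniqueDiffOn hst hzs
    (C := 2 ^ m * M) (D := K * ‖u‖⁻¹) (fun i hi => by
      rw [hf₁z, iteratedFDerivWithin_of_isOpen i hto h10]
      refine (norm_iteratedFDeriv_le_of_mixedPd hto hFc i h10 (M := M) fun a b hab => ?_).trans ?_
      · rw [mixedPd_comp_scale hUo hfc x.1 x.2 a b h10, norm_smul, norm_pow,
          Real.norm_of_nonneg hx.le]
        simpa using hM a b (by omega)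
      · gcongr
        norm_num) (fun i hi him => by
      rw [iteratedFDerivWithin_of_isOpen i hso hzs, ← hzu]
      exact hK _ _ hu0 i hi him)
  rw [iteratedFDerivWithin_congr hGF.symm hzs, iteratedFDerivWithin_of_isOpen m hso hzs] at key
  refine key.trans (le_of_eq ?_)
  rw [mul_pow, hun, inv_pow]
  ring

/-- Subtracting the value at the base point removes the term of order zero and, as `m ≥ 1`, changes
no derivative. This matters because the weighted norm carries no angular weight on the function
itself. -/
theorem exists_norm_iteratedFDeriv_le_polar {m : ℕ} (hm : 1 ≤ m) : ∃ C : ℝ, 0 ≤ C ∧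
    ∀ (q : Fin 4 → ℂ) (v : Fin 4), q (v + 1) - q v ≠ 0 → ∀ (G : ℂ → ℂ) (W : Set ℂ), IsOpen W →
      ContDiffOn ℝ ∞ G W → ∀ x : ℝ × ℝ, 0 < x.1 → cornerPolar q v x ∈ W → ∀ M : ℝ,
      (∀ a b, 1 ≤ a + b → a + b ≤ m →
        x.1 ^ a * ‖mixedPd a b (fun y => G (cornerPolar q v y)) x‖ ≤ M) →
      ‖iteratedFDeriv ℝ m G (cornerPolar q v x)‖ ≤ C * M * (x.1 ^ m)⁻¹ := by
  obtain ⟨C, hC0, hC⟩ := exists_norm_iteratedFDeriv_le_polar_aux m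
  refine ⟨C, hC0, ?_⟩
  intro q v hq G W hW hG x hx hxW M hM
  have hM0 : 0 ≤ M := (by positivity : (0 : ℝ) ≤ _).trans (hM 0 1 (by omega) (by omega))
  have key := hC q v hq (fun z => G z - G (cornerPolar q v x)) W hW (hG.sub contDiffOn_const) x hx
    hxW M (fun a b hab => by
      rcases Nat.eq_zero_or_pos (a + b) with h | h
      · obtain ⟨rfl, rfl⟩ : a = 0 ∧ b = 0 := by omega
        simpa [mixedPd] using hM0
      · rw [mixedPd_sub_const (a := a) (b := b) h (fun y => G (cornerPolar q v y))]
        exact hM a b h hab)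
  obtain ⟨n, rfl⟩ : ∃ n, m = n + 1 := ⟨m - 1, by omega⟩
  rw [← norm_iteratedFDeriv_fderiv] at key ⊢
  have h : fderiv ℝ (fun z => G z - G (cornerPolar q v x)) = fderiv ℝ G := by
    ext1 z; exact fderiv_sub_const _
  rwa [h] at key

/-! ### The weighted Sobolev norm controls weighted Cartesian derivatives -/

/-- With `θ` the angular distance to the sides, `r ^ a` is at most the weight times `r ^ ρ θ ^ (ρ -
k) (2π) ^ k`, since `1 + r ≥ 1` and `θ ≤ 2π`. Multiplied by `δ ^ (k - ρ) ≤ (C₂ r θ) ^ (k - ρ)` and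
by `r ^ (-m)`, the powers of `θ` cancel and `r ^ (k - m)` remains, which is bounded for `m ≤ k`. -/
theorem exists_norm_iteratedFDeriv_le_weight {k m : ℕ} (hm : 1 ≤ m) (hmk : m ≤ k) {ρ : ℝ}
    (hρ : 0 ≤ ρ) (hρk : ρ ≤ k) (R C₂ : ℝ) (hR : 1 ≤ R) (hC₂ : 0 ≤ C₂) : ∃ C : ℝ, 0 ≤ C ∧
    ∀ (q : Fin 4 → ℂ) (v : Fin 4), q (v + 1) - q v ≠ 0 → ∀ (G : ℂ → ℂ) (W : Set ℂ), IsOpen W →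
      ContDiffOn ℝ ∞ G W → ∀ γ ≤ 2 * Real.pi, ∀ x ∈ strip γ, cornerPolar q v x ∈ W → x.1 ≤ R →
      ∀ δ : ℝ, 0 ≤ δ → δ ≤ C₂ * (x.1 * min x.2 (γ - x.2)) → ∀ N : ℝ,
      (∀ a b, 1 ≤ a + b → a + b ≤ k →
        ‖polarWeight γ ρ ρ a b x‖ * ‖mixedPd a b (fun y => G (cornerPolar q v y)) x‖ ≤ N) →
      δ ^ ((k : ℝ) - ρ) * ‖iteratedFDeriv ℝ m G (cornerPolar q v x)‖ ≤ C * N := by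
  obtain ⟨C, hC0, hC⟩ := exists_norm_iteratedFDeriv_le_polar hm
  refine ⟨C₂ ^ ((k : ℝ) - ρ) * C * (2 * Real.pi) ^ k * R ^ (k - m), by positivity, ?_⟩
  intro q v hq G W hW hG γ hγ x hx hxW hxR δ hδ0 hδ N hN
  have hr : 0 < x.1 := hx.1
  have hx2 := hx.2
  set θ := min x.2 (γ - x.2) with hθ
  have hθ0 : 0 < θ := lt_min hx2.1 (by linarith [hx2.2])
  have hθπ : θ ≤ 2 * Real.pi := (min_le_left _ _).trans (hx2.2.le.trans hγ)
  have hπ : 1 ≤ 2 * Real.pi := by linarith [Real.pi_gt_three]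
  have hN0 : 0 ≤ N := (by positivity : (0 : ℝ) ≤ _).trans (hN 0 1 (by omega) (by omega))
  set M := N * (x.1 ^ ρ * θ ^ (ρ - k) * (2 * Real.pi) ^ k) with hM
  have key := hC q v hq G W hW hG x hr hxW M (fun a b h1 h2 => by
    have h3 := hN a b h1 (h2.trans hmk)
    have hw : polarWeight γ ρ ρ a b x =
        x.1 ^ (-ρ) * (1 + x.1) ^ ρ * (θ * x.1) ^ a * θ ^ ((b : ℝ) - ρ) := rfl
    have hwpos : 0 < polarWeight γ ρ ρ a b x := by rw [hw]; positivity
    rw [Real.norm_of_nonneg hwpos.le] at h3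
    have h4 : x.1 ^ a ≤ polarWeight γ ρ ρ a b x * (x.1 ^ ρ * θ ^ (ρ - k) * (2 * Real.pi) ^ k) := by
      have e1 : x.1 ^ (-ρ) * x.1 ^ ρ = 1 := by
        rw [← Real.rpow_add hr, neg_add_cancel, Real.rpow_zero]
      have e2 : θ ^ a * θ ^ ((b : ℝ) - ρ) * θ ^ (ρ - k) * (2 * Real.pi) ^ k =
          (2 * Real.pi / θ) ^ (k - (a + b)) * (2 * Real.pi) ^ (a + b) := by
        rw [← Real.rpow_natCast θ a, ← Real.rpow_add hθ0, ← Real.rpow_add hθ0, div_pow,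
          ← Real.rpow_natCast θ (k - (a + b)), Nat.cast_sub (h2.trans hmk), div_mul_eq_mul_div,
          ← pow_add, Nat.sub_add_cancel (h2.trans hmk), div_eq_mul_inv, ← Real.rpow_neg hθ0.le,
          mul_comm]
        congr 2
        push_cast; ring
      have e3 : 1 ≤ (2 * Real.pi / θ) ^ (k - (a + b)) * (2 * Real.pi) ^ (a + b) :=
        one_le_mul_of_one_le_of_one_le (one_le_pow₀ ((one_le_div hθ0).2 hθπ)) (one_le_pow₀ hπ)
      have e4 : 1 ≤ (1 + x.1) ^ ρ := Real.one_le_rpow (by linarith) hρ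
      calc x.1 ^ a ≤ x.1 ^ a * ((1 + x.1) ^ ρ *
            ((2 * Real.pi / θ) ^ (k - (a + b)) * (2 * Real.pi) ^ (a + b))) :=
            le_mul_of_one_le_right (by positivity) (one_le_mul_of_one_le_of_one_le e4 e3)
        _ = (x.1 ^ (-ρ) * x.1 ^ ρ) * (x.1 ^ a * ((1 + x.1) ^ ρ *
            ((2 * Real.pi / θ) ^ (k - (a + b)) * (2 * Real.pi) ^ (a + b)))) := by
            rw [e1, one_mul]
        _ = _ := by rw [← e2, hw, mul_pow]; ring
    calc x.1 ^ a * ‖mixedPd a b (fun y => G (cornerPolar q v y)) x‖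
        ≤ (polarWeight γ ρ ρ a b x * (x.1 ^ ρ * θ ^ (ρ - k) * (2 * Real.pi) ^ k)) *
          ‖mixedPd a b (fun y => G (cornerPolar q v y)) x‖ := by gcongr
      _ = (polarWeight γ ρ ρ a b x * ‖mixedPd a b (fun y => G (cornerPolar q v y)) x‖) *
          (x.1 ^ ρ * θ ^ (ρ - k) * (2 * Real.pi) ^ k) := by ring
      _ ≤ M := by rw [hM]; gcongr)
  have hkρ : 0 ≤ (k : ℝ) - ρ := by linarith
  have h5 : δ ^ ((k : ℝ) - ρ) ≤ C₂ ^ ((k : ℝ) - ρ) * (x.1 ^ ((k : ℝ) - ρ) * θ ^ ((k : ℝ) - ρ)) := by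
    rw [← Real.mul_rpow hr.le hθ0.le, ← Real.mul_rpow hC₂ (by positivity)]
    exact Real.rpow_le_rpow hδ0 hδ hkρ
  calc _ ≤ (C₂ ^ ((k : ℝ) - ρ) * (x.1 ^ ((k : ℝ) - ρ) * θ ^ ((k : ℝ) - ρ))) *
        (C * M * (x.1 ^ m)⁻¹) := by gcongr
    _ = C₂ ^ ((k : ℝ) - ρ) * C * (2 * Real.pi) ^ k * (x.1 ^ ((k : ℝ) - ρ) * x.1 ^ ρ * (x.1 ^ m)⁻¹) *
        (θ ^ ((k : ℝ) - ρ) * θ ^ (ρ - k)) * N := by rw [hM]; ring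
    _ = C₂ ^ ((k : ℝ) - ρ) * C * (2 * Real.pi) ^ k * x.1 ^ (k - m) * N := by
      rw [← Real.rpow_add hr, ← Real.rpow_add hθ0, sub_add_cancel, Real.rpow_natCast,
        show (k : ℝ) - ρ + (ρ - k) = 0 by ring, Real.rpow_zero, mul_one, pow_sub₀ _ hr.ne' hmk]
    _ ≤ _ := by gcongr

/-! ### Weighted bounds for derivatives of patchwise smooth functions on a patch -/

namespace Surface

variable {S : Surface}

theorem PwSmooth.contDiffOn_quad {w : E3 → ℂ} (hw : S.PwSmooth w) (i : Fin S.I) :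
    ContDiffOn ℝ ∞ (fun z => w ((S.patch i).chart z)) (quad (S.patch i).q) :=
  (hw.2 i).mono subset_closure

variable (R : S.Resolution)

theorem Resolution.contDiffOn_mul {w : E3 → ℂ} (hw : S.PwSmooth w) (n : Fin S.N) (i : Fin S.I) :
    ContDiffOn ℝ ∞ (fun z => (R.φ n ((S.patch i).chart z) : ℂ) * w ((S.patch i).chart z))
      (quad (S.patch i).q) :=
  ((R.smooth n).contDiffOn_quad i).mul (hw.contDiffOn_quad i)

theorem coneNorm_le_xNorm (k : ℕ) (ρ : ℝ) (u : E3 → ℂ) (n : Fin S.N) :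
    S.coneNorm n k ρ ρ (S.facewise fun x => (R.φ n x : ℂ) * u x) ≤ R.xNorm k ρ u :=
  Finset.single_le_sum (f := fun n => S.coneNorm n k ρ ρ (S.facewise fun x => (R.φ n x : ℂ) * u x))
    (fun _ _ => zero_le) (Finset.mem_univ n)

theorem eLpNorm_facewise_le_xNorm (k : ℕ) (ρ : ℝ) (u : E3 → ℂ) (i : Fin S.I) (v : Fin 4) :
    eLpNorm (S.facewise (fun x => (R.φ (S.vert i v) x : ℂ) * u x) i v) 2
      (polarMeasure (S.angle i v)) ≤ R.xNorm k ρ u := by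
  refine le_trans ?_ (coneNorm_le_xNorm R k ρ u (S.vert i v))
  refine le_trans ?_ le_self_add
  have hc : (i, v) ∈ S.corners (S.vert i v) := by simp [corners]
  refine le_trans ?_ (ENNReal.rpow_le_rpow (Finset.single_le_sum
    (f := fun c : Fin S.I × Fin 4 => eLpNorm (S.facewise (fun x => (R.φ (S.vert i v) x : ℂ) * u x)
      c.1 c.2) 2 (polarMeasure (S.angle c.1 c.2)) ^ (2 : ℝ)) (fun _ _ => zero_le) hc)
    (by norm_num : (0 : ℝ) ≤ 1 / 2))
  rw [← ENNReal.rpow_mul]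
  norm_num

theorem weightedDerivNorm_le_coneNorm {n : Fin S.N} {k : ℕ} (ρ μ : ℝ)
    (f : Fin S.I → Fin 4 → ℝ × ℝ → ℂ) {c : Fin S.I × Fin 4} (hc : c ∈ S.corners n) {β : ℕ × ℕ}
    (h1 : 1 ≤ β.1 + β.2) (h2 : β.1 + β.2 ≤ k) :
    weightedDerivNorm (S.angle c.1 c.2) ρ μ β.1 β.2 (f c.1 c.2) ≤ S.coneNorm n k ρ μ f := by
  have hβ : β ∈ (Finset.range (k + 1) ×ˢ Finset.range (k + 1)).filter
      (fun β => 1 ≤ β.1 + β.2 ∧ β.1 + β.2 ≤ k) := by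
    simp only [Finset.mem_filter, Finset.mem_product, Finset.mem_range]
    omega
  unfold coneNorm
  generalize (Finset.range (k + 1) ×ˢ Finset.range (k + 1)).filter
      (fun β => 1 ≤ β.1 + β.2 ∧ β.1 + β.2 ≤ k) = A at hβ
  calc _ ≤ ∑ β ∈ A, weightedDerivNorm (S.angle c.1 c.2) ρ μ β.1 β.2 (f c.1 c.2) :=
        Finset.single_le_sum (f := fun β : ℕ × ℕ => weightedDerivNorm (S.angle c.1 c.2) ρ μ β.1 β.2
          (f c.1 c.2)) (fun _ _ => zero_le) hβ
    _ ≤ ∑ c ∈ S.corners n, ∑ β ∈ A, weightedDerivNorm (S.angle c.1 c.2) ρ μ β.1 β.2 (f c.1 c.2) :=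
        Finset.single_le_sum (f := fun c : Fin S.I × Fin 4 => ∑ β ∈ A,
          weightedDerivNorm (S.angle c.1 c.2) ρ μ β.1 β.2 (f c.1 c.2)) (fun _ _ => zero_le) hc
    _ ≤ _ := le_add_self

theorem weightedDerivNorm_le_xNorm {k : ℕ} (ρ : ℝ) (u : E3 → ℂ) (i : Fin S.I) (v : Fin 4)
    {a b : ℕ} (h1 : 1 ≤ a + b) (h2 : a + b ≤ k) :
    weightedDerivNorm (S.angle i v) ρ ρ a b
      (S.facewise (fun x => (R.φ (S.vert i v) x : ℂ) * u x) i v) ≤ R.xNorm k ρ u :=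
  (weightedDerivNorm_le_coneNorm (S := S) (n := S.vert i v) ρ ρ _ (c := (i, v)) (β := (a, b))
    (by simp [corners]) h1 h2).trans (coneNorm_le_xNorm R k ρ u (S.vert i v))

theorem facewise_eq (g : E3 → ℂ) {i : Fin S.I} {v : Fin 4} {x : ℝ × ℝ}
    (hx : cornerPolar (S.patch i).q v x ∈ quad (S.patch i).q) :
    S.facewise g i v x = g ((S.patch i).chart (cornerPolar (S.patch i).q v x)) :=
  Set.indicator_of_mem (subset_closure (mem_image_of_mem _ hx)) g

/-- The polar coordinates that belong to points of the patch `i`. -/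
def polarPatch (S : Surface) (i : Fin S.I) (v : Fin 4) : Set (ℝ × ℝ) :=
  strip (S.angle i v) ∩ cornerPolar (S.patch i).q v ⁻¹' quad (S.patch i).q

theorem isOpen_polarPatch (i : Fin S.I) (v : Fin 4) : IsOpen (S.polarPatch i v) :=
  (isOpen_strip _).inter ((isOpen_quad _).preimage (contDiff_cornerPolar _ _).continuous)

theorem polarMeasure_absolutelyContinuous (γ : ℝ) : polarMeasure γ ≪ volume :=
  (withDensity_absolutelyContinuous _ _).trans Measure.restrict_le_self.absolutelyContinuous

/-- The infimum defining the norm ranges over weak derivatives of the extension by zero. On the open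
set of polar coordinates of patch points each of them agrees almost everywhere with the classical
derivative, so the bound holds for every competitor; if there is none, the right side is infinite.
-/
theorem lintegral_weight_mixedPd_le (ρ : ℝ) {w : E3 → ℂ} (hw : S.PwSmooth w) (i : Fin S.I)
    (v : Fin 4) (a b : ℕ) :
    ∫⁻ x in S.polarPatch i v, (‖polarWeight (S.angle i v) ρ ρ a b x‖ₑ * ‖mixedPd a b (fun y =>
      (R.φ (S.vert i v) ((S.patch i).chart (cornerPolar (S.patch i).q v y)) : ℂ) *
        w ((S.patch i).chart (cornerPolar (S.patch i).q v y))) x‖ₑ) ^ 2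
      ∂polarMeasure (S.angle i v) ≤ weightedDerivNorm (S.angle i v) ρ ρ a b
        (S.facewise (fun x => (R.φ (S.vert i v) x : ℂ) * w x) i v) ^ 2 := by
  set γ := S.angle i v
  set n := S.vert i v
  set f := S.facewise (fun x => (R.φ n x : ℂ) * w x) i v with hf
  set f' : ℝ × ℝ → ℂ := fun y => (R.φ n ((S.patch i).chart (cornerPolar (S.patch i).q v y)) : ℂ) *
        w ((S.patch i).chart (cornerPolar (S.patch i).q v y)) with hf'
  have hPo := S.isOpen_polarPatch i v
  have hff : EqOn f' f (S.polarPatch i v) := fun x hx =>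
    (facewise_eq (fun x => (R.φ n x : ℂ) * w x) hx.2).symm
  have hf'c : ContDiffOn ℝ ∞ f' (S.polarPatch i v) :=
    (R.contDiffOn_mul hw n i).comp (contDiff_cornerPolar _ _).contDiffOn (fun x hx => hx.2)
  have hfc : ContDiffOn ℝ ∞ f (S.polarPatch i v) := hf'c.congr hff.symm
  have hmix : EqOn (mixedPd a b f') (mixedPd a b f) (S.polarPatch i v) :=
    pd_iterate_congr hPo (pd_iterate_congr hPo hff _ b) _ a
  rw [weightedDerivNorm]
  set T := ∫⁻ x in S.polarPatch i v, (‖polarWeight γ ρ ρ a b x‖ₑ * ‖mixedPd a b f' x‖ₑ) ^ 2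
    ∂polarMeasure γ with hT
  suffices h : T ^ (1 / 2 : ℝ) ≤ ⨅ (g : ℝ × ℝ → ℂ) (_ : IsWeakPolarDeriv γ a b f g),
      eLpNorm (fun x => (polarWeight γ ρ ρ a b x : ℂ) * g x) 2 (polarMeasure γ) by
    calc T = (T ^ (1 / 2 : ℝ)) ^ 2 := by
          rw [← ENNReal.rpow_natCast, ← ENNReal.rpow_mul]; norm_num
      _ ≤ _ := pow_le_pow_left' h 2
  refine le_iInf₂ fun g hg => ?_
  have hae := hg.ae_eq_mixedPd hPo inter_subset_left hfc
  have h3 : T ≤ eLpNorm (fun x => (polarWeight γ ρ ρ a b x : ℂ) * g x) 2 (polarMeasure γ) ^ 2 := by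
    rw [eLpNorm_two_sq]
    refine le_trans (le_of_eq ?_) (setLIntegral_le_lintegral (S.polarPatch i v) _)
    refine setLIntegral_congr_fun_ae hPo.measurableSet ?_
    filter_upwards [(polarMeasure_absolutelyContinuous γ).ae_le hae] with x hx hxP
    have e : ‖((polarWeight γ ρ ρ a b x : ℝ) : ℂ)‖ₑ = ‖polarWeight γ ρ ρ a b x‖ₑ := by
      rw [← ofReal_norm, ← ofReal_norm, Complex.norm_real]
    rw [enorm_mul, hx hxP, ← hmix hxP, e]
  calc T ^ (1 / 2 : ℝ) ≤ (_ ^ 2) ^ (1 / 2 : ℝ) := ENNReal.rpow_le_rpow h3 (by norm_num)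
    _ = _ := by rw [← ENNReal.rpow_natCast, ← ENNReal.rpow_mul]; norm_num

theorem measurableSet_active (i : Fin S.I) (v : Fin 4) : MeasurableSet (R.active i v) :=
  (isOpen_quad _).measurableSet.inter isClosed_closure.measurableSet

/-- Integrals over the active part of a patch in polar coordinates. -/
theorem lintegral_active_le (i : Fin S.I) (v : Fin 4) (f : ℂ → ℝ≥0∞) :
    ∫⁻ z in R.active i v, f z ≤ ∫⁻ x in S.polarPatch i v ∩ cornerPolar (S.patch i).q v ⁻¹'
      R.active i v, f (cornerPolar (S.patch i).q v x) ∂polarMeasure (S.angle i v) := by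
  have hq := corner_ne (S.patch i).ccw_left (S.patch i).ccw_right v
  have hm := measurableSet_active R i v
  have hm' : MeasurableSet (cornerPolar (S.patch i).q v ⁻¹' R.active i v) :=
    hm.preimage (contDiff_cornerPolar _ _).continuous.measurable
  have hms := (S.isOpen_polarPatch i v).measurableSet.inter hm'
  rw [← lintegral_indicator hm, ← lintegral_indicator hms]
  calc ∫⁻ z, (R.active i v).indicator f z
      = ∫⁻ z in cornerPolar (S.patch i).q v '' strip (S.angle i v), (R.active i v).indicator f z := by
        refine (setLIntegral_eq_of_support_subset ?_).symm
        intro z hz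
        exact R.active_subset_sector i v (Set.indicator_apply_ne_zero.1 hz).1
    _ = ∫⁻ x, (R.active i v).indicator f (cornerPolar (S.patch i).q v x)
          ∂polarMeasure (S.angle i v) := (lintegral_cornerPolar hq (interiorAngle_le _ _) _).symm
    _ ≤ _ := by
      have hst : ∀ᵐ x ∂polarMeasure (S.angle i v), x ∈ strip (S.angle i v) :=
        (withDensity_absolutelyContinuous _ _).ae_le
          (ae_restrict_mem (isOpen_strip _).measurableSet)
      refine lintegral_mono_ae ?_
      filter_upwards [hst] with x hx
      by_cases h : cornerPolar (S.patch i).q v x ∈ R.active i v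
      · rw [Set.indicator_of_mem h, Set.indicator_of_mem (show x ∈ S.polarPatch i v ∩
          cornerPolar (S.patch i).q v ⁻¹' R.active i v from ⟨⟨hx, h.1⟩, h⟩)]
      · rw [Set.indicator_of_notMem h]; exact zero_le

end Surface

theorem measurable_polarWeight (γ ρ μ : ℝ) (a b : ℕ) : Measurable (polarWeight γ ρ μ a b) := by
  unfold polarWeight
  fun_prop

theorem sq_sum_le {ι : Type*} (s : Finset ι) (f : ι → ℝ≥0∞) :
    (∑ i ∈ s, f i) ^ 2 ≤ s.card * ∑ i ∈ s, f i ^ 2 := by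
  have h := ENNReal.rpow_sum_le_const_mul_sum_rpow s f (p := 2) (by norm_num)
  norm_num at h
  exact h

theorem norm_cornerPolar_sub {q : Fin 4 → ℂ} {v : Fin 4} (hq : q (v + 1) - q v ≠ 0) {x : ℝ × ℝ}
    (hx : 0 ≤ x.1) : ‖cornerPolar q v x - q v‖ = x.1 := by
  have h : ‖q (v + 1) - q v‖ ≠ 0 := norm_ne_zero_iff.2 hq
  simp [cornerPolar, Complex.norm_exp_ofReal_mul_I, h, abs_of_nonneg hx]

theorem exists_rimDist_le (q : Fin 4 → ℂ) (v : Fin 4) :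
    ∃ D : ℝ, 1 ≤ D ∧ ∀ z ∈ quad q, rimDist q z ≤ D ∧ ‖z - q v‖ ≤ D := by
  obtain ⟨D, hD⟩ := (isBounded_quad q).isCompact_closure.exists_bound_of_continuousOn
    (f := fun z => (rimDist q z, z - q v))
    ((continuous_rimDist q).prodMk (by fun_prop)).continuousOn
  refine ⟨max D 1, le_max_right _ _, fun z hz => ?_⟩
  have h := hD z (subset_closure hz)
  rw [Prod.norm_def] at h
  exact ⟨(le_abs_self _).trans ((le_max_left _ _).trans (h.trans (le_max_left _ _))),
    (le_max_right _ _).trans (h.trans (le_max_left _ _))⟩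

namespace Surface

variable {S : Surface} (R : S.Resolution)

/-- Where the minimum with `C₁` is attained by `C₁`, boundedness of the patch replaces it: the rim
distance is at most `D = (D / C₁) C₁`. -/
theorem Resolution.rimDist_le_of_mem_active {i : Fin S.I} {v : Fin 4} {D : ℝ}
    (hD : ∀ z ∈ quad (S.patch i).q, rimDist (S.patch i).q z ≤ D) {x : ℝ × ℝ}
    (hx : x ∈ strip (S.angle i v)) (hxa : cornerPolar (S.patch i).q v x ∈ R.active i v) :
    rimDist (S.patch i).q (cornerPolar (S.patch i).q v x) ≤
      (1 + D / R.C₁) * (x.1 * min x.2 (S.angle i v - x.2)) := by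
  have h := R.min_rimDist_le_of_mem_active hx hxa
  have hC := R.C₁_pos
  have hd := hD _ hxa.1
  have h0 := rimDist_nonneg (S.patch i).q (cornerPolar (S.patch i).q v x)
  have hD0 : 0 ≤ D / R.C₁ := div_nonneg (h0.trans hd) hC.le
  rcases min_le_iff.1 h with h1 | h1
  · calc _ ≤ D / R.C₁ * R.C₁ := by rwa [div_mul_cancel₀ _ hC.ne']
      _ ≤ D / R.C₁ * (x.1 * min x.2 (S.angle i v - x.2)) := by gcongr
      _ ≤ _ := mul_le_mul_of_nonneg_right (by linarith) (hC.le.trans h1)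
  · exact h1.trans (le_mul_of_one_le_left (h0.trans h1) (by linarith))

theorem Resolution.iteratedFDeriv_eq_zero (w : E3 → ℂ) {i : Fin S.I} {v : Fin 4} {z : ℂ}
    (hz : z ∈ quad (S.patch i).q) (hz' : z ∉ R.active i v) (m : ℕ) :
    iteratedFDeriv ℝ m (fun z => (R.φ (S.vert i v) ((S.patch i).chart z) : ℂ) *
      w ((S.patch i).chart z)) z = 0 := by
  have h : (fun z => (R.φ (S.vert i v) ((S.patch i).chart z) : ℂ) *
      w ((S.patch i).chart z)) =ᶠ[nhds z] fun _ => 0 := by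
    filter_upwards [R.eventually_eq_zero hz hz'] with y hy
    simp [hy]
  rw [(h.iteratedFDeriv ℝ m).eq_of_nhds]
  simp

/-- The contribution of a vertex of the patch to a weighted norm of the derivatives. -/
theorem Resolution.exists_lintegral_vertex_le {k m : ℕ} (hm : 1 ≤ m) (hmk : m ≤ k) {ρ : ℝ}
    (hρ : 0 ≤ ρ) (hρk : ρ ≤ k) (i : Fin S.I) (v : Fin 4) : ∃ C : ℝ≥0, ∀ w, S.PwSmooth w →
      ∀ B : ℝ≥0∞, (∀ v a b, 1 ≤ a + b → a + b ≤ k → weightedDerivNorm (S.angle i v) ρ ρ a b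
        (S.facewise (fun x => (R.φ (S.vert i v) x : ℂ) * w x) i v) ≤ B) →
      ∫⁻ z in quad (S.patch i).q, (ENNReal.ofReal (rimDist (S.patch i).q z ^ ((k : ℝ) - ρ)) *
        ‖iteratedFDeriv ℝ m (fun z => (R.φ (S.vert i v) ((S.patch i).chart z) : ℂ) *
          w ((S.patch i).chart z)) z‖ₑ) ^ 2 ≤ C * B ^ 2 := by
  obtain ⟨D, hD1, hD⟩ := exists_rimDist_le (S.patch i).q v
  have hq := corner_ne (S.patch i).ccw_left (S.patch i).ccw_right v
  obtain ⟨C, hC0, hC⟩ := exists_norm_iteratedFDeriv_le_weight hm hmk hρ hρk D (1 + D / R.C₁) hD1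
    (by have := R.C₁_pos; positivity)
  set A := (Finset.range (k + 1) ×ˢ Finset.range (k + 1)).filter
    (fun β => 1 ≤ β.1 + β.2 ∧ β.1 + β.2 ≤ k) with hA
  have hmemA : ∀ β : ℕ × ℕ, β ∈ A ↔ 1 ≤ β.1 + β.2 ∧ β.1 + β.2 ≤ k := fun β => by
    simp only [hA, Finset.mem_filter, Finset.mem_product, Finset.mem_range]
    omega
  refine ⟨C.toNNReal ^ 2 * A.card * A.card, fun w hw B hB => ?_⟩
  set G : ℂ → ℂ := fun z => (R.φ (S.vert i v) ((S.patch i).chart z) : ℂ) *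
          w ((S.patch i).chart z) with hG
  have hGc : ContDiffOn ℝ ∞ G (quad (S.patch i).q) := R.contDiffOn_mul hw _ i
  set F : ℂ → ℝ≥0∞ := fun z => (ENNReal.ofReal (rimDist (S.patch i).q z ^ ((k : ℝ) - ρ)) *
        ‖iteratedFDeriv ℝ m G z‖ₑ) ^ 2 with hF
  set t : ℕ × ℕ → ℝ × ℝ → ℝ≥0∞ := fun β x => ‖polarWeight (S.angle i v) ρ ρ β.1 β.2 x‖ₑ *
    ‖mixedPd β.1 β.2 (fun y => G (cornerPolar (S.patch i).q v y)) x‖ₑ with ht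
  have hpo := S.isOpen_polarPatch i v
  have hac : R.active i v ⊆ quad (S.patch i).q := inter_subset_left
  have htm : ∀ β ∈ A, AEMeasurable (fun x => t β x ^ 2)
      ((polarMeasure (S.angle i v)).restrict (S.polarPatch i v)) := by
    intro β _
    have h1 : ContDiffOn ℝ ∞ (mixedPd β.1 β.2 (fun y => G (cornerPolar (S.patch i).q v y)))
        (S.polarPatch i v) := contDiffOn_mixedPd hpo
        (hGc.comp (contDiff_cornerPolar _ _).contDiffOn (fun x hx => hx.2)) _ _
    have h2 := h1.continuousOn.aemeasurable (μ := polarMeasure (S.angle i v)) hpo.measurableSet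
    exact (((measurable_polarWeight _ _ _ _ _).enorm.aemeasurable).mul h2.enorm).pow_const 2
  have hpt : ∀ x ∈ S.polarPatch i v ∩ cornerPolar (S.patch i).q v ⁻¹' R.active i v,
      F (cornerPolar (S.patch i).q v x) ≤
        ENNReal.ofReal C ^ 2 * (A.card * ∑ β ∈ A, t β x ^ 2) := by
    intro x hx
    have hxs := hx.1.1
    have hxq := hx.1.2
    set N := ∑ β ∈ A, ‖polarWeight (S.angle i v) ρ ρ β.1 β.2 x‖ *
      ‖mixedPd β.1 β.2 (fun y => G (cornerPolar (S.patch i).q v y)) x‖ with hN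
    have h0 := rimDist_nonneg (S.patch i).q (cornerPolar (S.patch i).q v x)
    have key := hC (S.patch i).q v hq G _ (isOpen_quad _) hGc _ (interiorAngle_le _ _) x hxs hxq
      (by rw [← norm_cornerPolar_sub hq hxs.1.le]; exact (hD _ hxq).2) _ h0
      (R.rimDist_le_of_mem_active (fun z hz => (hD z hz).1) hxs hx.2) N (fun a b h1 h2 =>
        Finset.single_le_sum (f := fun β : ℕ × ℕ => ‖polarWeight (S.angle i v) ρ ρ β.1 β.2 x‖ *
          ‖mixedPd β.1 β.2 (fun y => G (cornerPolar (S.patch i).q v y)) x‖)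
          (fun _ _ => by positivity) ((hmemA (a, b)).2 ⟨h1, h2⟩))
    have hNt : ENNReal.ofReal N = ∑ β ∈ A, t β x := by
      rw [hN, ENNReal.ofReal_sum_of_nonneg (fun _ _ => by positivity)]
      refine Finset.sum_congr rfl fun β _ => ?_
      rw [ENNReal.ofReal_mul (norm_nonneg _), ofReal_norm, ofReal_norm]
    calc F (cornerPolar (S.patch i).q v x) ≤ (ENNReal.ofReal C * ∑ β ∈ A, t β x) ^ 2 := by
          simp only [hF]
          rw [← hNt, ← ENNReal.ofReal_mul hC0, ← ofReal_norm,
            ← ENNReal.ofReal_mul (Real.rpow_nonneg h0 _)]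
          exact pow_le_pow_left' (ENNReal.ofReal_le_ofReal key) 2
      _ ≤ _ := by
          rw [mul_pow]
          gcongr
          exact sq_sum_le A _
  calc ∫⁻ z in quad (S.patch i).q, F z = ∫⁻ z in R.active i v, F z := by
        rw [← lintegral_indicator (isOpen_quad _).measurableSet,
          ← lintegral_indicator (measurableSet_active R i v)]
        congr 1
        ext z
        by_cases hz : z ∈ R.active i v
        · rw [indicator_of_mem hz, indicator_of_mem (hac hz)]
        · rw [indicator_of_notMem hz, Set.indicator_apply_eq_zero]
          intro hzq
          simp only [hF, hG]
          rw [R.iteratedFDeriv_eq_zero w hzq hz m, ← ofReal_norm, norm_zero, ENNReal.ofReal_zero, mul_zero, zero_pow two_ne_zero]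
    _ ≤ ∫⁻ x in S.polarPatch i v ∩ cornerPolar (S.patch i).q v ⁻¹' R.active i v,
          F (cornerPolar (S.patch i).q v x) ∂polarMeasure (S.angle i v) :=
        lintegral_active_le R i v F
    _ ≤ ∫⁻ x in S.polarPatch i v ∩ cornerPolar (S.patch i).q v ⁻¹' R.active i v,
          ENNReal.ofReal C ^ 2 * (A.card * ∑ β ∈ A, t β x ^ 2) ∂polarMeasure (S.angle i v) :=
        setLIntegral_mono' (hpo.measurableSet.inter ((measurableSet_active R i v).preimage
          (contDiff_cornerPolar _ _).continuous.measurable)) hpt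
    _ ≤ ∫⁻ x in S.polarPatch i v, ENNReal.ofReal C ^ 2 * (A.card * ∑ β ∈ A, t β x ^ 2)
          ∂polarMeasure (S.angle i v) := lintegral_mono_set inter_subset_left
    _ = ENNReal.ofReal C ^ 2 * (A.card * ∑ β ∈ A, ∫⁻ x in S.polarPatch i v, t β x ^ 2
          ∂polarMeasure (S.angle i v)) := by
        rw [lintegral_const_mul' _ _ (by finiteness), lintegral_const_mul' _ _ (by finiteness),
          lintegral_finsetSum' _ htm]
    _ ≤ ENNReal.ofReal C ^ 2 * (A.card * ∑ β ∈ A, B ^ 2) := by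
        gcongr with β hβ
        exact (lintegral_weight_mixedPd_le R ρ hw i v β.1 β.2).trans (pow_le_pow_left'
          (hB v β.1 β.2 ((hmemA β).1 hβ).1 ((hmemA β).1 hβ).2) 2)
    _ = _ := by
        rw [Finset.sum_const, nsmul_eq_mul, ENNReal.ofReal]
        push_cast
        ring

/-- On every patch, the derivatives of a patchwise smooth function, weighted with a power of the
distance to the boundary of the patch, are controlled by the weighted Sobolev norm. -/
theorem Resolution.exists_lintegral_rimDist_le {k m : ℕ} (hm : 1 ≤ m) (hmk : m ≤ k) {ρ : ℝ}
    (hρ : 0 ≤ ρ) (hρk : ρ ≤ k) (i : Fin S.I) : ∃ C : ℝ≥0, ∀ w, S.PwSmooth w →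
      ∀ B : ℝ≥0∞, (∀ v a b, 1 ≤ a + b → a + b ≤ k → weightedDerivNorm (S.angle i v) ρ ρ a b
        (S.facewise (fun x => (R.φ (S.vert i v) x : ℂ) * w x) i v) ≤ B) →
      ∫⁻ z in quad (S.patch i).q, (ENNReal.ofReal (rimDist (S.patch i).q z ^ ((k : ℝ) - ρ)) *
        ‖iteratedFDeriv ℝ m (fun z => w ((S.patch i).chart z)) z‖ₑ) ^ 2 ≤ C * B ^ 2 := by
  choose C hC using fun v => R.exists_lintegral_vertex_le hm hmk hρ hρk i v
  refine ⟨S.N * (S.N * ∑ v, C v), fun w hw B hB => ?_⟩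
  set G : Fin S.N → ℂ → ℂ := fun n z => (R.φ n ((S.patch i).chart z) : ℂ) *
          w ((S.patch i).chart z) with hG
  have hqo := isOpen_quad (S.patch i).q
  have hGc : ∀ n, ContDiffOn ℝ ∞ (G n) (quad (S.patch i).q) := fun n => R.contDiffOn_mul hw n i
  set T : Fin S.N → ℂ → ℝ≥0∞ := fun n z =>
    ENNReal.ofReal (rimDist (S.patch i).q z ^ ((k : ℝ) - ρ)) * ‖iteratedFDeriv ℝ m (G n) z‖ₑ with hT
  have hTm : ∀ n ∈ Finset.univ, AEMeasurable (fun z => T n z ^ 2)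
      (volume.restrict (quad (S.patch i).q)) := by
    intro n _
    have h1 : ContinuousOn (iteratedFDeriv ℝ m (G n)) (quad (S.patch i).q) :=
      ((hGc n).continuousOn_iteratedFDerivWithin (m := m) (mod_cast le_top)
        hqo.uniqueDiffOn).congr (fun z hz => (iteratedFDerivWithin_of_isOpen m hqo hz).symm)
    have h2 : ContinuousOn (fun z => ‖iteratedFDeriv ℝ m (G n) z‖ₑ) (quad (S.patch i).q) :=
      continuous_enorm.comp_continuousOn h1
    have h3 := h2.aemeasurable (μ := volume) hqo.measurableSet
    have h4 : Measurable fun z => ENNReal.ofReal (rimDist (S.patch i).q z ^ ((k : ℝ) - ρ)) :=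
      ((continuous_rimDist _).measurable.pow_const _).ennreal_ofReal
    exact (h4.aemeasurable.mul h3).pow_const 2
  -- The vertices that are corners of the patch are covered by the vertex estimate; all other
  -- cut-offs vanish identically on the patch.
  have hTB : ∀ n, ∫⁻ z in quad (S.patch i).q, T n z ^ 2 ≤ (∑ v, C v : ℝ≥0) * B ^ 2 := by
    intro n
    by_cases h : ∃ v, S.vert i v = n
    · obtain ⟨v, rfl⟩ := h
      refine (hC v w hw B hB).trans ?_
      gcongr
      exact Finset.single_le_sum (f := C) (fun _ _ => zero_le) (Finset.mem_univ v)
    · push Not at h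
      refine (le_of_eq ?_).trans zero_le
      refine (setLIntegral_congr_fun hqo.measurableSet (g := fun _ => 0) fun z hz => ?_).trans
        lintegral_zero
      have h0 : G n =ᶠ[nhds z] fun _ => 0 := by
        filter_upwards [hqo.mem_nhds hz] with y hy
        simp [hG, R.eq_zero_of_forall_vert_ne h (mem_image_of_mem _ hy)]
      have h1 : iteratedFDeriv ℝ m (G n) z = 0 := by
        rw [(h0.iteratedFDeriv ℝ m).eq_of_nhds]
        simp
      simp only [hT]
      rw [h1, ← ofReal_norm, norm_zero, ENNReal.ofReal_zero, mul_zero, zero_pow two_ne_zero]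
  have hpt : ∀ z ∈ quad (S.patch i).q, (ENNReal.ofReal (rimDist (S.patch i).q z ^ ((k : ℝ) - ρ)) *
        ‖iteratedFDeriv ℝ m (fun z => w ((S.patch i).chart z)) z‖ₑ) ^ 2 ≤
        S.N * ∑ n, T n z ^ 2 := by
    intro z hz
    have h1 : (fun z => w ((S.patch i).chart z)) =ᶠ[nhds z] fun z => ∑ n, G n z := by
      filter_upwards [hqo.mem_nhds hz] with y hy
      simp only [hG]
      rw [← Finset.sum_mul, ← Complex.ofReal_sum, R.sum_eq_one _
        (S.face_subset_bdry i (mem_image_of_mem _ hy)), Complex.ofReal_one, one_mul]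
    have h2 : iteratedFDeriv ℝ m (fun z => w ((S.patch i).chart z)) z =
        ∑ n, iteratedFDeriv ℝ m (G n) z := by
      rw [(h1.iteratedFDeriv ℝ m).eq_of_nhds]
      exact iteratedFDeriv_fun_sum_apply fun n _ =>
        (((hGc n).contDiffAt (hqo.mem_nhds hz)).of_le (mod_cast le_top))
    calc _ ≤ (∑ n, T n z) ^ 2 := by
          rw [h2]
          simp only [hT]
          rw [← Finset.mul_sum]
          gcongr
          simp only [enorm_eq_nnnorm]
          exact_mod_cast nnnorm_sum_le _ _
      _ ≤ _ := by simpa using sq_sum_le Finset.univ (fun n => T n z)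
  calc _ ≤ ∫⁻ z in quad (S.patch i).q, S.N * ∑ n, T n z ^ 2 :=
        setLIntegral_mono' hqo.measurableSet hpt
    _ = S.N * ∑ n, ∫⁻ z in quad (S.patch i).q, T n z ^ 2 := by
        rw [lintegral_const_mul' _ _ (by finiteness), lintegral_finsetSum' _ hTm]
    _ ≤ S.N * ∑ n : Fin S.N, (∑ v, C v : ℝ≥0) * B ^ 2 := by
        gcongr with n
        exact hTB n
    _ = _ := by
        rw [Finset.sum_const, nsmul_eq_mul, Finset.card_univ, Fintype.card_fin]
        push_cast
        ring

end Surface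

/-! ### Subadditivity of the weighted norms -/

theorem integrableOn_mul_of_tsupport {V : Set (ℝ × ℝ)} {f : ℝ × ℝ → ℂ}
    (hf : LocallyIntegrableOn f V) {η : ℝ × ℝ → ℝ} (hη : Continuous η) (hc : HasCompactSupport η)
    (hs : tsupport η ⊆ V) : IntegrableOn (fun x => (η x : ℂ) * f x) V := by
  have h : IntegrableOn (fun x => (η x : ℂ) * f x) (tsupport η) :=
    (hf.integrableOn_compact_subset hs hc).continuousOn_mul
      (Complex.continuous_ofReal.comp hη).continuousOn hc
  refine ((integrableOn_iff_integrable_of_support_subset fun x hx => ?_).1 h).integrableOn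
  by_contra h4
  simp [image_eq_zero_of_notMem_tsupport h4] at hx

theorem tsupport_pd_iterate_subset (v : ℝ × ℝ) (ζ : ℝ × ℝ → ℝ) (n : ℕ) :
    tsupport ((pd v)^[n] ζ) ⊆ tsupport ζ := by
  induction n with
  | zero => exact subset_rfl
  | succ n ih => rw [Function.iterate_succ_apply']; exact (tsupport_pd_subset _ _).trans ih

theorem IsWeakPolarDeriv.sub {γ : ℝ} {a b : ℕ} {f g f' g' : ℝ × ℝ → ℂ}
    (h : IsWeakPolarDeriv γ a b f g) (h' : IsWeakPolarDeriv γ a b f' g') :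
    IsWeakPolarDeriv γ a b (f - f') (g - g') := by
  refine ⟨h.1.sub h'.1, h.2.1.sub h'.2.1, fun η hη hc hs => ?_⟩
  have hsub : tsupport (mixedPd a b η) ⊆ tsupport η :=
    (tsupport_pd_iterate_subset _ _ a).trans (tsupport_pd_iterate_subset _ _ b)
  have hcont : Continuous (polarPartial a b η) := by
    rw [polarPartial_eq_mixedPd a b hη]
    exact continuousOn_univ.1 (contDiffOn_mixedPd isOpen_univ hη.contDiffOn a b).continuousOn
  have hc' : HasCompactSupport (polarPartial a b η) := by
    rw [polarPartial_eq_mixedPd a b hη]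
    exact hc.of_isClosed_subset (isClosed_tsupport _) hsub
  have hs' : tsupport (polarPartial a b η) ⊆ strip γ := by
    rw [polarPartial_eq_mixedPd a b hη]
    exact hsub.trans hs
  simp only [Pi.sub_apply, mul_sub]
  rw [integral_sub (integrableOn_mul_of_tsupport h.1 hcont hc' hs')
      (integrableOn_mul_of_tsupport h'.1 hcont hc' hs'),
    integral_sub (integrableOn_mul_of_tsupport h.2.1 hη.continuous hc hs)
      (integrableOn_mul_of_tsupport h'.2.1 hη.continuous hc hs),
    h.2.2 η hη hc hs, h'.2.2 η hη hc hs, mul_sub]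

theorem aestronglyMeasurable_polarMeasure {γ : ℝ} {g : ℝ × ℝ → ℂ}
    (hg : LocallyIntegrableOn g (strip γ)) : AEStronglyMeasurable g (polarMeasure γ) :=
  hg.aestronglyMeasurable.mono_ac (withDensity_absolutelyContinuous _ _)

/-- Weak derivatives subtract, so every pair of competitors on the right gives one on the left.
Their local integrability supplies the measurability that Minkowski's inequality needs. -/
theorem weightedDerivNorm_sub_le (γ ρ μ : ℝ) (a b : ℕ) (f f' : ℝ × ℝ → ℂ) :
    weightedDerivNorm γ ρ μ a b (f - f') ≤
      weightedDerivNorm γ ρ μ a b f + weightedDerivNorm γ ρ μ a b f' := by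
  conv_rhs => rw [weightedDerivNorm, weightedDerivNorm]
  simp only [ENNReal.iInf_add, ENNReal.add_iInf, le_iInf_iff]
  intro g' hg' g hg
  have h : weightedDerivNorm γ ρ μ a b (f - f') ≤ eLpNorm (fun x =>
      (polarWeight γ ρ μ a b x : ℂ) * (g - g') x) 2 (polarMeasure γ) :=
    iInf₂_le (g - g') (hg.sub hg')
  refine h.trans ?_
  have hw : AEStronglyMeasurable (fun x => (polarWeight γ ρ μ a b x : ℂ)) (polarMeasure γ) :=
    (Complex.measurable_ofReal.comp (measurable_polarWeight γ ρ μ a b)).aestronglyMeasurable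
  have e : (fun x => (polarWeight γ ρ μ a b x : ℂ) * (g - g') x) =
      (fun x => (polarWeight γ ρ μ a b x : ℂ) * g x) -
        fun x => (polarWeight γ ρ μ a b x : ℂ) * g' x := by
    ext x
    simp [mul_sub]
  rw [e]
  exact eLpNorm_sub_le (hw.mul (aestronglyMeasurable_polarMeasure hg.2.1))
    (hw.mul (aestronglyMeasurable_polarMeasure hg'.2.1)) (by norm_num)

/-! ### The norm in `L₂` -/

namespace Surface

variable {S : Surface} (R : S.Resolution)

/-- An approximant is written as `w = u - (u - w)`. Its derivative norms are thereby bounded through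
the norms of `u` and of the error, which are the only quantities known in the density argument. -/
theorem weightedDerivNorm_facewise_le {k : ℕ} (ρ : ℝ) (u w : E3 → ℂ) (i : Fin S.I) (v : Fin 4)
    {a b : ℕ} (h1 : 1 ≤ a + b) (h2 : a + b ≤ k) :
    weightedDerivNorm (S.angle i v) ρ ρ a b
      (S.facewise (fun x => (R.φ (S.vert i v) x : ℂ) * w x) i v) ≤
        R.xNorm k ρ u + R.xNorm k ρ (u - w) := by
  have e : S.facewise (fun x => (R.φ (S.vert i v) x : ℂ) * w x) i v =
      S.facewise (fun x => (R.φ (S.vert i v) x : ℂ) * u x) i v -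
        S.facewise (fun x => (R.φ (S.vert i v) x : ℂ) * (u - w) x) i v := by
    ext x
    simp only [facewise, Pi.sub_apply]
    by_cases h : S.facePoint i v x ∈ closure (S.patch i).face
    · simp only [Set.indicator_of_mem h]
      ring
    · simp only [Set.indicator_of_notMem h, sub_zero]
  rw [e]
  exact (weightedDerivNorm_sub_le _ _ _ _ _ _ _).trans (add_le_add
    (weightedDerivNorm_le_xNorm R ρ u i v h1 h2)
    (weightedDerivNorm_le_xNorm R ρ (u - w) i v h1 h2))

theorem Resolution.lintegral_vertex_le_xNorm (k : ℕ) (ρ : ℝ) (u : E3 → ℂ) (i : Fin S.I)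
    (v : Fin 4) : ∫⁻ z in quad (S.patch i).q, ‖(R.φ (S.vert i v) ((S.patch i).chart z) : ℂ) *
      u ((S.patch i).chart z)‖ₑ ^ 2 ≤ R.xNorm k ρ u ^ 2 := by
  set g : ℂ → ℝ≥0∞ := fun z => ‖(R.φ (S.vert i v) ((S.patch i).chart z) : ℂ) *
      u ((S.patch i).chart z)‖ₑ ^ 2 with hg
  have hac : R.active i v ⊆ quad (S.patch i).q := inter_subset_left
  have hpm := (S.isOpen_polarPatch i v).measurableSet.inter ((measurableSet_active R i v).preimage
          (contDiff_cornerPolar (S.patch i).q v).continuous.measurable)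
  calc ∫⁻ z in quad (S.patch i).q, g z = ∫⁻ z in R.active i v, g z := by
        rw [← lintegral_indicator (isOpen_quad _).measurableSet,
          ← lintegral_indicator (measurableSet_active R i v)]
        congr 1
        ext z
        by_cases hz : z ∈ R.active i v
        · rw [indicator_of_mem hz, indicator_of_mem (hac hz)]
        · rw [indicator_of_notMem hz, Set.indicator_apply_eq_zero]
          intro hzq
          simp [hg, (R.eventually_eq_zero hzq hz).self_of_nhds]
    _ ≤ _ := lintegral_active_le R i v g
    _ = ∫⁻ x in S.polarPatch i v ∩ cornerPolar (S.patch i).q v ⁻¹' R.active i v,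
          ‖S.facewise (fun x => (R.φ (S.vert i v) x : ℂ) * u x) i v x‖ₑ ^ 2
            ∂polarMeasure (S.angle i v) :=
        setLIntegral_congr_fun hpm fun x hx => by
          simp only [hg]
          rw [facewise_eq _ hx.1.2]
    _ ≤ _ := setLIntegral_le_lintegral _ _
    _ ≤ _ := by
        rw [← eLpNorm_two_sq]
        exact pow_le_pow_left' (eLpNorm_facewise_le_xNorm R k ρ u i v) 2

/-- The cut-offs sum to one, and the `L₂`-part of each cone norm becomes a surface integral in polar
coordinates. The bound makes approximation in the weighted norm an approximation in `L₂`, and it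
controls the coarse projection. -/
theorem Resolution.exists_eLpNorm_le_xNorm : ∃ C : ℝ≥0, ∀ u, MemLp u 2 S.σ → ∀ k ρ,
    eLpNorm u 2 S.σ ≤ C * R.xNorm k ρ u := by
  refine ⟨NNReal.sqrt (S.I * (S.N * S.N)), fun u hu k ρ => ?_⟩
  have hpatch : ∀ i, ∫⁻ z in quad (S.patch i).q, ‖u ((S.patch i).chart z)‖ₑ ^ 2 ≤
      S.N * (S.N * R.xNorm k ρ u ^ 2) := by
    intro i
    have hqm := (isOpen_quad (S.patch i).q).measurableSet
    set T : Fin S.N → ℂ → ℝ≥0∞ := fun n z => ‖(R.φ n ((S.patch i).chart z) : ℂ) *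
      u ((S.patch i).chart z)‖ₑ with hT
    have hum : AEMeasurable (fun z => u ((S.patch i).chart z))
        (volume.restrict (quad (S.patch i).q)) :=
      ((hu.1.mono_measure (S.map_chart_le_σ i)).comp_aemeasurable
        (S.patch i).measurableEmbedding_chart.measurable.aemeasurable).aemeasurable
    have hTm : ∀ n ∈ Finset.univ, AEMeasurable (fun z => T n z ^ 2)
        (volume.restrict (quad (S.patch i).q)) := by
      intro n _
      have h1 : AEMeasurable (fun z => (R.φ n ((S.patch i).chart z) : ℂ))
          (volume.restrict (quad (S.patch i).q)) :=
        ((R.smooth n).contDiffOn_quad i).continuousOn.aemeasurable hqm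
      exact (h1.mul hum).enorm.pow_const 2
    have hTB : ∀ n, ∫⁻ z in quad (S.patch i).q, T n z ^ 2 ≤ R.xNorm k ρ u ^ 2 := by
      intro n
      by_cases h : ∃ v, S.vert i v = n
      · obtain ⟨v, rfl⟩ := h
        exact R.lintegral_vertex_le_xNorm k ρ u i v
      · push Not at h
        refine (le_of_eq ?_).trans zero_le
        refine (setLIntegral_congr_fun hqm (g := fun _ => 0) fun z hz => ?_).trans lintegral_zero
        simp [hT, R.eq_zero_of_forall_vert_ne h (mem_image_of_mem _ hz)]
    have hpt : ∀ z ∈ quad (S.patch i).q, ‖u ((S.patch i).chart z)‖ₑ ^ 2 ≤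
        S.N * ∑ n, T n z ^ 2 := by
      intro z hz
      have h1 : u ((S.patch i).chart z) =
          ∑ n, (R.φ n ((S.patch i).chart z) : ℂ) * u ((S.patch i).chart z) := by
        rw [← Finset.sum_mul, ← Complex.ofReal_sum, R.sum_eq_one _
          (S.face_subset_bdry i (mem_image_of_mem _ hz)), Complex.ofReal_one, one_mul]
      calc _ ≤ (∑ n, T n z) ^ 2 := by
            conv_lhs => rw [h1]
            gcongr
            exact enorm_sum_le _ _
        _ ≤ _ := by simpa using sq_sum_le Finset.univ (fun n => T n z)
    calc _ ≤ ∫⁻ z in quad (S.patch i).q, S.N * ∑ n, T n z ^ 2 := setLIntegral_mono' hqm hpt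
      _ = S.N * ∑ n, ∫⁻ z in quad (S.patch i).q, T n z ^ 2 := by
          rw [lintegral_const_mul' _ _ (by finiteness), lintegral_finsetSum' _ hTm]
      _ ≤ S.N * ∑ n : Fin S.N, R.xNorm k ρ u ^ 2 := by
          gcongr with n
          exact hTB n
      _ = _ := by
          rw [Finset.sum_const, nsmul_eq_mul, Finset.card_univ, Fintype.card_fin]
  have h2 : eLpNorm u 2 S.σ ^ 2 ≤ (NNReal.sqrt (S.I * (S.N * S.N)) * R.xNorm k ρ u) ^ 2 := by
    rw [eLpNorm_two_sq, S.lintegral_σ, mul_pow]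
    refine (Finset.sum_le_sum fun i _ => hpatch i).trans (le_of_eq ?_)
    rw [Finset.sum_const, nsmul_eq_mul, Finset.card_univ, Fintype.card_fin, ← ENNReal.coe_pow,
      NNReal.sq_sqrt]
    push_cast
    ring
  exact (ENNReal.pow_le_pow_left_iff two_ne_zero).1 h2

end Surface

/-! ### Derivatives in the parameter square -/

theorem norm_iteratedFDeriv_sub_const {E : Type*} [NormedAddCommGroup E] [NormedSpace ℝ E] {m : ℕ}
    (hm : 1 ≤ m) (g : E → ℂ) (c : ℂ) (x : E) :
    ‖iteratedFDeriv ℝ m (fun y => g y - c) x‖ = ‖iteratedFDeriv ℝ m g x‖ := by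
  obtain ⟨n, rfl⟩ : ∃ n, m = n + 1 := ⟨m - 1, by omega⟩
  rw [← norm_iteratedFDeriv_fderiv, ← norm_iteratedFDeriv_fderiv]
  have h : fderiv ℝ (fun y => g y - c) = fderiv ℝ g := funext fun y => fderiv_sub_const c
  rw [h]

/-- Composition estimate applied to `g - g (f x)`, so that the term of order zero drops out. Lower
orders `1 ≤ m < k` cannot be avoided, as the parametrization is not affine. -/
theorem norm_iteratedFDeriv_comp_le_sum {k : ℕ} (hk : 1 ≤ k) {g : ℂ → ℂ} {t : Set ℂ}
    (ht : IsOpen t) (hg : ContDiffOn ℝ k g t) {f : ℝ × ℝ → ℂ} {s : Set (ℝ × ℝ)} (hs : IsOpen s)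
    (hf : ContDiffOn ℝ k f s) (hst : MapsTo f s t) {D : ℝ} (hD1 : 1 ≤ D)
    (hD : ∀ m ≤ k, ∀ x ∈ s, ‖iteratedFDeriv ℝ m f x‖ ≤ D) {x : ℝ × ℝ} (hx : x ∈ s) :
    ‖iteratedFDeriv ℝ k (fun y => g (f y)) x‖ ≤
      k.factorial * D ^ k * ∑ m ∈ Finset.Icc 1 k, ‖iteratedFDeriv ℝ m g (f x)‖ := by
  have h := norm_iteratedFDerivWithin_comp_le (g := fun z => g z - g (f x)) (f := f) (n := k)
    (N := k) (x := x) (hg.sub contDiffOn_const) hf le_rfl ht.uniqueDiffOn hs.uniqueDiffOn hst hx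
    (C := ∑ m ∈ Finset.Icc 1 k, ‖iteratedFDeriv ℝ m g (f x)‖) (D := D) (fun i hi => by
      rw [iteratedFDerivWithin_of_isOpen i ht (hst hx)]
      rcases Nat.eq_zero_or_pos i with rfl | h
      · simp only [norm_iteratedFDeriv_zero, sub_self, norm_zero]
        positivity
      · rw [norm_iteratedFDeriv_sub_const h]
        exact Finset.single_le_sum (f := fun m => ‖iteratedFDeriv ℝ m g (f x)‖)
          (fun _ _ => norm_nonneg _) (Finset.mem_Icc.2 ⟨h, hi⟩)) (fun i h1 hi => by
      rw [iteratedFDerivWithin_of_isOpen i hs hx]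
      exact (hD i hi x hx).trans (le_self_pow₀ hD1 (by omega)))
  rw [iteratedFDerivWithin_of_isOpen k hs hx] at h
  have e := norm_iteratedFDeriv_sub_const hk (fun y => g (f y)) (g (f x)) x
  rw [← e]
  refine h.trans (le_of_eq ?_)
  ring

namespace Surface

variable {S : Surface} (R : S.Resolution)

theorem PwSmooth.contDiffOn_kappa {w : E3 → ℂ} (hw : S.PwSmooth w) {k : ℕ} (hκ : S.ParamSmooth k)
    (i : Fin S.I) : ContDiffOn ℝ k (fun x => w ((S.patch i).kappa x)) openSquare :=
  ContDiffOn.comp (g := fun z => w ((S.patch i).chart z))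
    ((hw.contDiffOn_quad i).of_le (mod_cast le_top)) (hκ i).1
    fun _ hx => (S.patch i).param_interior ▸ mem_image_of_mem _ hx

/-- The weight `dist ^ (k - ρ)` is the same for all orders `1 ≤ m ≤ k` on the patch, so the chain
rule costs only a constant; the integral is carried to the square by the comparison of measures.
Stating it with a bound `B` on derivative norms requires subadditivity only for those norms. -/
theorem Resolution.exists_lintegral_kappa_le {k : ℕ} (hk : 1 ≤ k) (hκ : S.ParamSmooth k) {ρ : ℝ}
    (hρ : 0 ≤ ρ) (hρk : ρ ≤ k) (i : Fin S.I) : ∃ C : ℝ≥0, ∀ w, S.PwSmooth w →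
      ∀ B : ℝ≥0∞, (∀ v a b, 1 ≤ a + b → a + b ≤ k → weightedDerivNorm (S.angle i v) ρ ρ a b
        (S.facewise (fun x => (R.φ (S.vert i v) x : ℂ) * w x) i v) ≤ B) →
      ∫⁻ x in openSquare, (ENNReal.ofReal
        (rimDist (S.patch i).q ((S.patch i).param x) ^ ((k : ℝ) - ρ)) *
          ‖iteratedFDeriv ℝ k (fun x => w ((S.patch i).kappa x)) x‖ₑ) ^ 2 ≤ C * B ^ 2 := by
  have h1 : ∀ m : ℕ, ∃ C : ℝ≥0, m ∈ Finset.Icc 1 k → ∀ w, S.PwSmooth w →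
      ∀ B : ℝ≥0∞, (∀ v a b, 1 ≤ a + b → a + b ≤ k → weightedDerivNorm (S.angle i v) ρ ρ a b
        (S.facewise (fun x => (R.φ (S.vert i v) x : ℂ) * w x) i v) ≤ B) →
      ∫⁻ z in quad (S.patch i).q, (ENNReal.ofReal (rimDist (S.patch i).q z ^ ((k : ℝ) - ρ)) *
        ‖iteratedFDeriv ℝ m (fun z => w ((S.patch i).chart z)) z‖ₑ) ^ 2 ≤ C * B ^ 2 := by
    intro m
    by_cases hm : m ∈ Finset.Icc 1 k
    · obtain ⟨C, hC⟩ := R.exists_lintegral_rimDist_le (Finset.mem_Icc.1 hm).1 (Finset.mem_Icc.1 hm).2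
        hρ hρk i
      exact ⟨C, fun _ => hC⟩
    · exact ⟨0, fun h => absurd h hm⟩
  choose C₀ hC₀ using h1
  obtain ⟨C₁, hC₁⟩ := (S.patch i).exists_map_param_le
  obtain ⟨hpc, hpb⟩ := hκ i
  choose! D hD using hpb
  set D' : ℝ := 1 + ∑ m ∈ Finset.range (k + 1), |D m| with hD'
  have hD1 : 1 ≤ D' := le_add_of_nonneg_right (Finset.sum_nonneg fun _ _ => abs_nonneg _)
  have hDD : ∀ m ≤ k, ∀ x ∈ openSquare, ‖iteratedFDeriv ℝ m (S.patch i).param x‖ ≤ D' := by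
    intro m hm x hx
    have h2 := Finset.single_le_sum (f := fun m => |D m|) (fun _ _ => abs_nonneg _)
      (Finset.mem_range.2 (Nat.lt_succ_of_le hm))
    linarith [hD m hm x hx, le_abs_self (D m)]
  set K : ℝ := k.factorial * D' ^ k with hK
  have hK0 : 0 ≤ K := by positivity
  refine ⟨K.toNNReal ^ 2 * (C₁ * (k * ∑ m ∈ Finset.Icc 1 k, C₀ m)), fun w hw B hB => ?_⟩
  set q := (S.patch i).q with hq
  have hqo := isOpen_quad q
  set g : ℂ → ℂ := fun z => w ((S.patch i).chart z) with hg
  have hgc : ContDiffOn ℝ ∞ g (quad q) := hw.contDiffOn_quad i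
  set T : ℕ → ℂ → ℝ≥0∞ := fun m z =>
    ENNReal.ofReal (rimDist q z ^ ((k : ℝ) - ρ)) * ‖iteratedFDeriv ℝ m g z‖ₑ with hT
  have hTm : ∀ m, AEMeasurable (T m) (volume.restrict (quad q)) := by
    intro m
    have h1 : ContinuousOn (iteratedFDeriv ℝ m g) (quad q) :=
      (hgc.continuousOn_iteratedFDerivWithin (m := m) (mod_cast le_top)
        hqo.uniqueDiffOn).congr (fun z hz => (iteratedFDerivWithin_of_isOpen m hqo hz).symm)
    have h2 : ContinuousOn (fun z => ‖iteratedFDeriv ℝ m g z‖ₑ) (quad q) :=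
      continuous_enorm.comp_continuousOn h1
    have h3 := h2.aemeasurable (μ := volume) hqo.measurableSet
    have h4 : Measurable fun z => ENNReal.ofReal (rimDist q z ^ ((k : ℝ) - ρ)) :=
      ((continuous_rimDist _).measurable.pow_const _).ennreal_ofReal
    exact h4.aemeasurable.mul h3
  have hpt : ∀ x ∈ openSquare, (ENNReal.ofReal (rimDist q ((S.patch i).param x) ^ ((k : ℝ) - ρ)) *
      ‖iteratedFDeriv ℝ k (fun x => w ((S.patch i).kappa x)) x‖ₑ) ^ 2 ≤
      ENNReal.ofReal K ^ 2 * (k * ∑ m ∈ Finset.Icc 1 k, T m ((S.patch i).param x) ^ 2) := by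
    intro x hx
    have h2 := norm_iteratedFDeriv_comp_le_sum hk hqo (hgc.of_le (mod_cast le_top))
      isOpen_openSquare hpc (fun _ hx => (S.patch i).param_interior ▸ mem_image_of_mem _ hx)
      hD1 hDD hx
    have h3 : ‖iteratedFDeriv ℝ k (fun x => w ((S.patch i).kappa x)) x‖ₑ ≤
        ENNReal.ofReal K * ∑ m ∈ Finset.Icc 1 k, ‖iteratedFDeriv ℝ m g ((S.patch i).param x)‖ₑ := by
      rw [← ofReal_norm]
      refine (ENNReal.ofReal_le_ofReal h2).trans (le_of_eq ?_)
      rw [ENNReal.ofReal_mul hK0, ENNReal.ofReal_sum_of_nonneg (fun _ _ => norm_nonneg _)]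
      simp only [ofReal_norm]
    calc _ ≤ (ENNReal.ofReal K * ∑ m ∈ Finset.Icc 1 k, T m ((S.patch i).param x)) ^ 2 := by
          refine pow_le_pow_left' ?_ 2
          simp only [hT]
          rw [← Finset.mul_sum, mul_left_comm]
          gcongr
      _ ≤ _ := by
          rw [mul_pow]
          gcongr
          simpa using sq_sum_le (Finset.Icc 1 k) (fun m => T m ((S.patch i).param x))
  calc _ ≤ ∫⁻ x in openSquare, ENNReal.ofReal K ^ 2 *
          (k * ∑ m ∈ Finset.Icc 1 k, T m ((S.patch i).param x) ^ 2) :=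
        setLIntegral_mono' isOpen_openSquare.measurableSet hpt
    _ ≤ ∫⁻ x in square, ENNReal.ofReal K ^ 2 *
          (k * ∑ m ∈ Finset.Icc 1 k, T m ((S.patch i).param x) ^ 2) :=
        lintegral_mono_set openSquare_subset_square
    _ = ENNReal.ofReal K ^ 2 * ∫⁻ x in square,
          (k * ∑ m ∈ Finset.Icc 1 k, T m ((S.patch i).param x) ^ 2) :=
        lintegral_const_mul' _ _ (by finiteness)
    _ ≤ ENNReal.ofReal K ^ 2 * (C₁ * ∫⁻ z in quad q, (k * ∑ m ∈ Finset.Icc 1 k, T m z ^ 2)) := by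
        gcongr
        exact (S.patch i).lintegral_comp_param_le hC₁ (f := fun z =>
          (k : ℝ≥0∞) * ∑ m ∈ Finset.Icc 1 k, T m z ^ 2)
          ((Finset.aemeasurable_fun_sum _ fun m _ => (hTm m).pow_const 2).const_mul _)
    _ = ENNReal.ofReal K ^ 2 * (C₁ * (k * ∑ m ∈ Finset.Icc 1 k, ∫⁻ z in quad q, T m z ^ 2)) := by
        rw [lintegral_const_mul' _ _ (by finiteness),
          lintegral_finsetSum' _ fun m _ => (hTm m).pow_const 2]
    _ ≤ ENNReal.ofReal K ^ 2 * (C₁ * (k * ∑ m ∈ Finset.Icc 1 k, C₀ m * B ^ 2)) := by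
        gcongr with m hm
        exact hC₀ m hm w hw B hB
    _ = _ := by
        rw [← Finset.sum_mul, ENNReal.ofReal]
        push_cast
        ring

end Surface

/-! ### Finite overlap -/

/-- The overlap count is used as an inequality between measures, so `f` may be an arbitrary
function. -/
theorem sum_setLIntegral_le {X ι : Type*} [MeasurableSpace X] {μ : Measure X} {s : Finset ι}
    {A : ι → Set X} {U : Set X} (hA : ∀ a ∈ s, MeasurableSet (A a)) (hAU : ∀ a ∈ s, A a ⊆ U)
    {N : ℕ} (hN : ∀ x, {a | a ∈ s ∧ x ∈ A a}.ncard ≤ N) (f : X → ℝ≥0∞) :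
    ∑ a ∈ s, ∫⁻ x in A a, f x ∂μ ≤ N * ∫⁻ x in U, f x ∂μ := by
  classical
  have h : ∑ a ∈ s, μ.restrict (A a) ≤ (N : ℝ≥0∞) • μ.restrict U := by
    refine Measure.le_iff.2 fun T hT => ?_
    rw [Measure.finsetSum_apply, Measure.smul_apply, smul_eq_mul]
    have h1 : ∀ a ∈ s, μ.restrict (A a) T = ∫⁻ x in T, (A a).indicator 1 x ∂μ.restrict U := by
      intro a ha
      rw [lintegral_indicator_one (hA a ha), Measure.restrict_apply (hA a ha),
        Measure.restrict_apply ((hA a ha).inter hT), Measure.restrict_apply hT]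
      congr 1
      ext x
      exact ⟨fun h => ⟨⟨h.2, h.1⟩, hAU a ha h.2⟩, fun h => ⟨h.1.2, h.1.1⟩⟩
    rw [Finset.sum_congr rfl h1, ← lintegral_finsetSum' _ fun a ha =>
      (measurable_one.indicator (hA a ha)).aemeasurable]
    calc _ ≤ ∫⁻ x in T, (N : ℝ≥0∞) ∂μ.restrict U := by
          refine lintegral_mono fun x => ?_
          simp only [Set.indicator_apply, Pi.one_apply]
          rw [Finset.sum_boole]
          have h2 := hN x
          rw [show {a | a ∈ s ∧ x ∈ A a} = ↑(s.filter fun a => x ∈ A a) by ext a; simp,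
            Set.ncard_coe_finset] at h2
          exact_mod_cast h2
      _ = _ := by simp
  calc _ = ∫⁻ x, f x ∂∑ a ∈ s, μ.restrict (A a) := (lintegral_finsetSum_measure _ _ _).symm
    _ ≤ ∫⁻ x, f x ∂((N : ℝ≥0∞) • μ.restrict U) := lintegral_mono' h le_rfl
    _ = _ := by rw [lintegral_smul_measure, smul_eq_mul]

/-! ### Dual wavelets supported well inside a patch -/

namespace Surface

variable {S : Surface}

theorem exists_bilip (S : Surface) : ∃ L : ℝ, 1 ≤ L ∧ ∀ i, ∀ x ∈ square, ∀ y ∈ square,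
    dist ((S.patch i).param x) ((S.patch i).param y) ≤ L * dist x y ∧
      dist x y ≤ L * dist ((S.patch i).param x) ((S.patch i).param y) := by
  choose L hL hLb using fun i => (S.patch i).param_bilip
  refine ⟨1 + ∑ i, L i, le_add_of_nonneg_right (Finset.sum_nonneg fun i _ => (hL i).le),
    fun i x hx y hy => ?_⟩
  have h : L i ≤ 1 + ∑ i, L i := by
    have := Finset.single_le_sum (f := L) (fun i _ => (hL i).le) (Finset.mem_univ i)
    linarith
  exact ⟨(hLb i x hx y hy).1.trans (by gcongr), (hLb i x hx y hy).2.trans (by gcongr)⟩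

theorem lt_dist_of_lt_setDist {A B : Set E3} {t : ℝ} (h : ENNReal.ofReal t < setDist A B)
    {x y : E3} (hx : x ∈ A) (hy : y ∈ B) : t < dist x y := by
  have h1 : setDist A B ≤ edist x y := (iInf₂_le x hx).trans (Metric.infEDist_le_edist_of_mem hy)
  rw [edist_dist] at h1
  exact (ENNReal.ofReal_lt_ofReal_iff').1 (h.trans_le h1) |>.1

/-- The geometry of the dual wavelets that are not too close to the skeleton, at mesh size `h`:
the support lies in the patch `i`, the grid point has the parameter `x₀`. -/
structure IsInterior (S : Surface) (r ρ₀ h : ℝ) (K : Set E3) (i : Fin S.I) (x₀ : ℝ × ℝ) :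
    Prop where
  subset_face : K ⊆ (S.patch i).face
  closedBall_subset : Metric.closedBall x₀ (r * h) ⊆ openSquare
  mem_closedBall : ∀ x ∈ square, (S.patch i).kappa x ∈ K → x ∈ Metric.closedBall x₀ (r * h)
  le_rimDist : h ≤ rimDist (S.patch i).q ((S.patch i).param x₀)
  rimDist_param : ∀ x ∈ Metric.closedBall x₀ (r * h),
    rimDist (S.patch i).q ((S.patch i).param x₀) ≤
      2 * rimDist (S.patch i).q ((S.patch i).param x) ∧
    dist ((S.patch i).param x) ((S.patch i).param x₀) ≤ ρ₀ * h
  rimDist_le : ∀ z, (S.patch i).chart z ∈ K →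
    rimDist (S.patch i).q z ≤ 2 * rimDist (S.patch i).q ((S.patch i).param x₀) ∧
    dist z ((S.patch i).param x₀) ≤ ρ₀ * h

/-- A connected set of diameter at most `D h` around the support misses the skeleton and hence lies
in one face. The constant `A = 2 L² D` is twice the displacement `L² D h` of the parametrization
over a square of radius `L D h`, so throughout that square the rim distance stays at least half of
its value `δ` at the grid point. -/
theorem WaveletBasis.exists_isInterior {d : ℕ} (Ψ : S.WaveletBasis d) :
    ∃ A r ρ₀ : ℝ, 0 < A ∧ 0 < r ∧ 0 < ρ₀ ∧ ∀ j ≥ Ψ.j₀, ∀ ξ,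
      ENNReal.ofReal (A * (1 / 2) ^ j) < setDist (S.supp (Ψ.ψd j ξ)) S.skeleton →
        ∃ i x₀, S.IsInterior r ρ₀ ((1 / 2) ^ j) (S.supp (Ψ.ψd j ξ)) i x₀ := by
  obtain ⟨L, hL1, hL⟩ := S.exists_bilip
  obtain ⟨D₀, hD₀⟩ := Ψ.supp_diam
  set D := max D₀ 1 with hD
  have hD1 : 1 ≤ D := le_max_right _ _
  have hL0 : 0 < L := by linarith
  have hLL : 1 ≤ L * L := by nlinarith
  have hLLD : D ≤ L * L * D := by nlinarith
  have hLD : 1 ≤ L * L * D := by nlinarith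
  refine ⟨2 * (L * L * D), L * D, L * L * D, by positivity, by positivity, by positivity, ?_⟩
  intro j hj ξ hξ
  set h : ℝ := (1 / 2) ^ j with hh
  have hh0 : 0 < h := by positivity
  obtain ⟨K, hKc, hKb, hKs, hKd⟩ := hD₀ j hj ξ
  have hKd' : ∀ x ∈ K, ∀ y ∈ K, dist x y ≤ D * h := fun x hx y hy =>
    (Metric.dist_le_diam_of_mem (S.isCompact_bdry.isBounded.subset hKb) hx hy).trans
      (hKd.trans (by gcongr; exact le_max_left _ _))
  have hg := Ψ.grid_mem_supp j hj ξ
  have hfar : ∀ y ∈ S.skeleton, 2 * (L * L * D) * h < dist (Ψ.grid j ξ) y := fun y hy =>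
    lt_dist_of_lt_setDist hξ hg hy
  have hdisj : Disjoint K S.skeleton := by
    rw [Set.disjoint_left]
    intro y hy hys
    have h1 := hfar y hys
    have h2 := hKd' _ (hKs hg) y hy
    nlinarith
  obtain ⟨i, hi⟩ := S.exists_subset_face hKc hKb hdisj
  set F := S.patch i with hF
  obtain ⟨z₀, hz₀, hz₀g⟩ := hi (hKs hg)
  obtain ⟨x₀, hx₀, rfl⟩ : z₀ ∈ F.param '' openSquare := by rw [F.param_interior]; exact hz₀
  have hx₀s := openSquare_subset_square hx₀
  set δ := rimDist F.q (F.param x₀) with hδ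
  have hδA : 2 * (L * L * D) * h ≤ δ := by
    refine (Metric.le_infDist ⟨_, corner_mem_frontier F.ccw_left F.ccw_right 0⟩).2 fun y hy => ?_
    have h1 := hfar _ (S.rim_subset_skeleton i (mem_image_of_mem _ hy))
    rw [← hz₀g, F.chart.dist_map] at h1
    exact h1.le
  have hparam : ∀ x ∈ square, dist x x₀ ≤ L * D * h → dist (F.param x) (F.param x₀) ≤
      L * L * D * h := fun x hx hxd => ((hL i x hx x₀ hx₀s).1).trans (by
    calc L * dist x x₀ ≤ L * (L * D * h) := by gcongr
      _ = _ := by ring)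
  -- Outside the square nothing is known about `param`, so connectedness is used: leaving the open
  -- square means meeting its boundary, which is mapped to the rim and hence too far away.
  have hball : Metric.closedBall x₀ (L * D * h) ⊆ openSquare := by
    have hpos : 0 < L * D * h := by positivity
    refine (convex_closedBall x₀ (L * D * h)).isPreconnected.subset_left_of_subset_union
      isOpen_openSquare isCompact_square.isClosed.isOpen_compl ?_ ?_
      ⟨x₀, Metric.mem_closedBall_self hpos.le, hx₀⟩
    · exact Set.disjoint_left.2 fun x hx hx' => hx' (openSquare_subset_square hx)
    · intro x hx
      by_contra hxn
      have hxs : x ∈ square := by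
        by_contra h'
        exact hxn (Or.inr h')
      have hxo : x ∉ openSquare := fun h' => hxn (Or.inl h')
      have h1 := hparam x hxs hx
      have h2 : F.param x ∈ frontier (quad F.q) := by
        rw [(isOpen_quad _).frontier_eq]
        refine ⟨F.param_bij.mapsTo hxs, fun h' => hxo ?_⟩
        rw [← F.param_interior] at h'
        obtain ⟨y, hy, hyx⟩ := h'
        exact F.param_bij.injOn (openSquare_subset_square hy) hxs hyx ▸ hy
      have h3 : δ ≤ dist (F.param x₀) (F.param x) := Metric.infDist_le_dist_of_mem h2
      rw [dist_comm] at h3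
      nlinarith
  have hsupp : ∀ z, F.chart z ∈ S.supp (Ψ.ψd j ξ) → dist z (F.param x₀) ≤ D * h := by
    intro z hz
    rw [← F.chart.dist_map, hz₀g]
    exact hKd' _ (hKs hz) _ (hKs hg)
  refine ⟨i, x₀, hKs.trans hi, hball, ?_, ?_, ?_, ?_⟩
  · intro x hx hxK
    have h1 := hsupp _ hxK
    calc dist x x₀ ≤ L * dist (F.param x) (F.param x₀) := (hL i x hx x₀ hx₀s).2
      _ ≤ L * (D * h) := by gcongr
      _ = _ := by ring
  · nlinarith
  · intro x hx
    have h1 := hparam x (openSquare_subset_square (hball hx)) hx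
    have h2 : δ ≤ rimDist F.q (F.param x) + dist (F.param x₀) (F.param x) :=
      Metric.infDist_le_infDist_add_dist
    rw [dist_comm] at h2
    exact ⟨by nlinarith, h1⟩
  · intro z hz
    have h1 := hsupp z hz
    have h2 : rimDist F.q z ≤ δ + dist z (F.param x₀) := Metric.infDist_le_infDist_add_dist
    have h3 : D * h ≤ L * L * D * h := by gcongr
    exact ⟨by nlinarith, h1.trans h3⟩

/-! ### A single wavelet coefficient in the interior of a patch -/

section Coefficient

variable {r ρ₀ h : ℝ} {i : Fin S.I} {x₀ : ℝ × ℝ} {ψ : E3 → ℂ}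

theorem kappa_mem_closure_face (i : Fin S.I) {x : ℝ × ℝ} (hx : x ∈ square) :
    (S.patch i).kappa x ∈ closure (S.patch i).face := by
  rw [Patch.closure_face]
  exact mem_image_of_mem _ ((S.patch i).param_bij.mapsTo hx)

theorem apply_kappa_eq_zero {i : Fin S.I} {x : ℝ × ℝ} (hx : x ∈ square)
    (h : (S.patch i).kappa x ∉ S.supp ψ) : ψ ((S.patch i).kappa x) = 0 := by
  by_contra h0
  exact h (subset_closure ⟨S.closure_face_subset_bdry i (kappa_mem_closure_face i hx), h0⟩)

theorem pairing_eq_of_supp_subset (h : S.supp ψ ⊆ (S.patch i).face) (w : E3 → ℂ) :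
    S.pairing w ψ =
      ∫ x in square, w ((S.patch i).kappa x) * star (ψ ((S.patch i).kappa x)) := by
  refine Finset.sum_eq_single i (fun l _ hl => ?_) (fun h => absurd (Finset.mem_univ i) h)
  refine setIntegral_eq_zero_of_forall_eq_zero fun x hx => ?_
  rw [apply_kappa_eq_zero hx fun hs =>
    (S.disjoint_face_closure_face hl.symm).le_bot ⟨h hs, kappa_mem_closure_face l hx⟩]
  simp

theorem continuous_eval_polynomial (P : MvPolynomial (Fin 2) ℂ) :
    Continuous fun x : ℝ × ℝ => MvPolynomial.eval ![(x.1 : ℂ), (x.2 : ℂ)] P := by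
  refine (MvPolynomial.continuous_eval P).comp (continuous_pi fun a => ?_)
  fin_cases a
  · exact Complex.continuous_ofReal.comp continuous_fst
  · exact Complex.continuous_ofReal.comp continuous_snd

/-- Vanishing moments allow replacing `w ∘ κ` by its distance to polynomials of degree less than
`k`; the support confines the integral to a small square, where the polynomial approximation and
Cauchy–Schwarz apply. -/
theorem IsInterior.enorm_pairing_sq_le (hI : S.IsInterior r ρ₀ h (S.supp ψ) i x₀) (hr : 0 < r * h)
    {k : ℕ} (hk : 1 ≤ k) (hκ : S.ParamSmooth k) (hψ : MemLp ψ 2 S.σ)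
    (hmom : ∀ P : MvPolynomial (Fin 2) ℂ, P.totalDegree < k →
      ∫ x in square, MvPolynomial.eval ![(x.1 : ℂ), (x.2 : ℂ)] P *
        star (ψ ((S.patch i).kappa x)) = 0) {w : E3 → ℂ} (hw : S.PwSmooth w) :
    ‖S.pairing w ψ‖ₑ ^ 2 ≤ (4 * ENNReal.ofReal (2 * (r * h)) ^ (2 * k) *
      ∫⁻ x in Metric.closedBall x₀ (r * h),
        ‖iteratedFDeriv ℝ k (fun x => w ((S.patch i).kappa x)) x‖ₑ ^ 2) *
      eLpNorm (fun x => ψ ((S.patch i).kappa x)) 2 (volume.restrict square) ^ 2 := by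
  set Q := Metric.closedBall x₀ (r * h) with hQ
  set H : ℝ × ℝ → ℂ := fun x => w ((S.patch i).kappa x) with hH
  set η : ℝ × ℝ → ℂ := fun x => ψ ((S.patch i).kappa x) with hη
  obtain ⟨P, hPd, hP⟩ := exists_polynomial_lintegral_le isOpen_openSquare hk
    (hw.contDiffOn_kappa hκ i) hr hI.closedBall_subset
  set p : ℝ × ℝ → ℂ := fun x => MvPolynomial.eval ![(x.1 : ℂ), (x.2 : ℂ)] P with hp
  have hpc : Continuous p := continuous_eval_polynomial P
  have hηL : MemLp η 2 (volume.restrict square) := S.memLp_comp_kappa hψ i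
  have hHL : MemLp H 2 (volume.restrict square) := S.memLp_comp_kappa hw.memLp i
  have hfin : IsFiniteMeasure ((volume : Measure (ℝ × ℝ)).restrict square) :=
    ⟨by simpa using isCompact_square.measure_lt_top⟩
  have hpL : MemLp p 2 (volume.restrict square) := by
    obtain ⟨M, hM⟩ := isCompact_square.exists_bound_of_continuousOn hpc.continuousOn
    exact MemLp.of_bound hpc.aestronglyMeasurable M
      (ae_restrict_of_forall_mem measurableSet_square hM)
  have hQs : Q ⊆ square := hI.closedBall_subset.trans openSquare_subset_square
  have hQm : MeasurableSet Q := Metric.isClosed_closedBall.measurableSet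
  have e1 : S.pairing w ψ = ∫ x in square, (H x - p x) * star (η x) := by
    rw [pairing_eq_of_supp_subset hI.subset_face]
    have h1 := hHL.integrable_mul hηL.star
    have h2 := hpL.integrable_mul hηL.star
    have h3 := integral_sub h1 h2
    simp only [Pi.mul_apply, Pi.star_apply] at h3
    rw [hmom P hPd, sub_zero] at h3
    rw [← h3]
    simp only [sub_mul]
  have e2 : ‖S.pairing w ψ‖ₑ ≤ ∫⁻ x in Q, ‖H x - p x‖ₑ * ‖η x‖ₑ := by
    rw [e1]
    refine (enorm_integral_le_lintegral_enorm _).trans (le_of_eq ?_)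
    rw [← lintegral_indicator measurableSet_square, ← lintegral_indicator hQm]
    congr 1
    ext x
    by_cases hx : x ∈ Q
    · rw [indicator_of_mem hx, indicator_of_mem (hQs hx), enorm_mul]
      simp [← ofReal_norm]
    · rw [indicator_of_notMem hx, Set.indicator_apply_eq_zero]
      intro hxs
      have : η x = 0 := apply_kappa_eq_zero hxs fun h' => hx (hI.mem_closedBall x hxs h')
      simp [this]
  have hle : (volume : Measure (ℝ × ℝ)).restrict Q ≤ volume.restrict square :=
    Measure.restrict_mono hQs le_rfl
  have m1 : AEMeasurable (fun x => ‖H x - p x‖ₑ) (volume.restrict Q) :=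
    ((hHL.1.mono_measure hle).sub (hpL.1.mono_measure hle)).enorm
  have m2 : AEMeasurable (fun x => ‖η x‖ₑ) (volume.restrict Q) := (hηL.1.mono_measure hle).enorm
  calc _ ≤ (∫⁻ x in Q, ‖H x - p x‖ₑ * ‖η x‖ₑ) ^ 2 := pow_le_pow_left' e2 2
    _ ≤ _ := lintegral_mul_sq_le m1 m2
    _ ≤ _ := by
      rw [eLpNorm_two_sq]
      exact mul_le_mul' hP (lintegral_mono_set hQs)

/-- On the square the rim distance is at least `δ / 2`, so the weight may be inserted at the price
of a power of `δ`. -/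
theorem IsInterior.lintegral_le (hI : S.IsInterior r ρ₀ h (S.supp ψ) i x₀) (hh : 0 < h) {e : ℝ}
    (he : 0 ≤ e) (f : ℝ × ℝ → ℝ≥0∞) :
    ∫⁻ x in Metric.closedBall x₀ (r * h), f x ^ 2 ≤
      ENNReal.ofReal (2 ^ (2 * e) * rimDist (S.patch i).q ((S.patch i).param x₀) ^ (-(2 * e))) *
        ∫⁻ x in Metric.closedBall x₀ (r * h), (ENNReal.ofReal
          (rimDist (S.patch i).q ((S.patch i).param x) ^ e) * f x) ^ 2 := by
  set δ := rimDist (S.patch i).q ((S.patch i).param x₀) with hδ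
  have hδ0 : 0 < δ := hh.trans_le hI.le_rimDist
  rw [← lintegral_const_mul' _ _ ENNReal.ofReal_ne_top]
  refine setLIntegral_mono' Metric.isClosed_closedBall.measurableSet fun x hx => ?_
  have h1 := (hI.rimDist_param x hx).1
  set d := rimDist (S.patch i).q ((S.patch i).param x) with hd
  have hd0 : 0 < d := by linarith
  have h2 : δ ^ (2 * e) ≤ 2 ^ (2 * e) * d ^ (2 * e) := by
    rw [← Real.mul_rpow (by norm_num) hd0.le]
    exact Real.rpow_le_rpow hδ0.le h1 (by linarith)
  have h3 : (1 : ℝ) ≤ 2 ^ (2 * e) * δ ^ (-(2 * e)) * (d ^ e) ^ 2 := by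
    rw [← Real.rpow_natCast (d ^ e), ← Real.rpow_mul hd0.le, Nat.cast_ofNat, mul_comm e 2,
      mul_right_comm, Real.rpow_neg hδ0.le, ← div_eq_mul_inv, one_le_div (by positivity)]
    exact h2
  calc f x ^ 2 = 1 * f x ^ 2 := (one_mul _).symm
    _ ≤ ENNReal.ofReal (2 ^ (2 * e) * δ ^ (-(2 * e)) * (d ^ e) ^ 2) * f x ^ 2 := by
      gcongr
      exact ENNReal.one_le_ofReal.2 h3
    _ = _ := by
      rw [ENNReal.ofReal_mul (by positivity), ENNReal.ofReal_pow (by positivity), mul_pow, mul_assoc]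

end Coefficient

/-! ### Sums over the interior wavelets of a patch -/

namespace WaveletBasis

variable {d : ℕ} (Ψ : S.WaveletBasis d)

/-- The part of the support of a dual wavelet in a patch, in the plane of the patch. -/
def planeSupp (j : ℕ) (i : Fin S.I) (ξ : Fin (Ψ.num j)) : Set ℂ :=
  quad (S.patch i).q ∩ (S.patch i).chart ⁻¹' S.supp (Ψ.ψd j ξ)

theorem measurableSet_planeSupp (j : ℕ) (i : Fin S.I) (ξ : Fin (Ψ.num j)) :
    MeasurableSet (Ψ.planeSupp j i ξ) :=
  (isOpen_quad _).measurableSet.inter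
    ((S.patch i).measurableEmbedding_chart.measurable isClosed_closure.measurableSet)

theorem volume_planeSupp {j : ℕ} {i : Fin S.I} {ξ : Fin (Ψ.num j)}
    (h : S.supp (Ψ.ψd j ξ) ⊆ (S.patch i).face) :
    volume (Ψ.planeSupp j i ξ) = S.σ (S.supp (Ψ.ψd j ξ)) := by
  have hm : MeasurableSet (S.supp (Ψ.ψd j ξ)) := isClosed_closure.measurableSet
  rw [← lintegral_indicator_one hm, S.lintegral_σ, Finset.sum_eq_single i]
  · rw [← lintegral_indicator_one (Ψ.measurableSet_planeSupp j i ξ),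
      ← lintegral_indicator (isOpen_quad _).measurableSet]
    congr 1
    ext z
    by_cases h1 : z ∈ quad (S.patch i).q <;>
      by_cases h2 : (S.patch i).chart z ∈ S.supp (Ψ.ψd j ξ) <;> simp [planeSupp, h1, h2]
  · intro l _ hl
    refine (setLIntegral_congr_fun (isOpen_quad _).measurableSet (g := fun _ => 0)
      fun z hz => ?_).trans lintegral_zero
    refine Set.indicator_of_notMem (fun hs => ?_) _
    exact (S.disjoint_face_closure_face hl.symm).le_bot
      ⟨h hs, subset_closure (mem_image_of_mem _ hz)⟩
  · exact fun h => absurd (Finset.mem_univ i) h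

theorem exists_planeSupp_overlap : ∃ N : ℕ, ∀ j ≥ Ψ.j₀, ∀ i (s : Finset (Fin (Ψ.num j))) z,
    {ξ | ξ ∈ s ∧ z ∈ Ψ.planeSupp j i ξ}.ncard ≤ N := by
  obtain ⟨N, hN⟩ := Ψ.overlap
  refine ⟨N, fun j hj i s z => ?_⟩
  by_cases hz : z ∈ quad (S.patch i).q
  · refine (Set.ncard_le_ncard ?_ (Set.toFinite _)).trans
      (hN j hj _ (S.face_subset_bdry i (mem_image_of_mem _ hz)))
    exact fun ξ hξ => hξ.2.2
  · have : {ξ | ξ ∈ s ∧ z ∈ Ψ.planeSupp j i ξ} = ∅ := by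
      ext ξ
      simp only [Set.mem_ofPred_eq, Set.mem_empty_iff_false, iff_false]
      exact fun h => hz h.2.1
    simp [this]

/-- The balls around the parameters of the interior grid points have finite overlap. -/
theorem exists_closedBall_overlap (r ρ₀ : ℝ) (i : Fin S.I) : ∃ M : ℕ, ∀ j ≥ Ψ.j₀,
    ∀ (s : Finset (Fin (Ψ.num j))) (x₀ : Fin (Ψ.num j) → ℝ × ℝ),
      (∀ ξ ∈ s, S.IsInterior r ρ₀ ((1 / 2) ^ j) (S.supp (Ψ.ψd j ξ)) i (x₀ ξ)) →
      ∀ x, {ξ | ξ ∈ s ∧ x ∈ Metric.closedBall (x₀ ξ) (r * (1 / 2) ^ j)}.ncard ≤ M := by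
  classical
  obtain ⟨N, hN⟩ := Ψ.exists_planeSupp_overlap
  obtain ⟨c, C, hc, harea⟩ := Ψ.supp_area
  refine ⟨⌈N * ((2 * ρ₀) ^ 2 * Real.pi) / c⌉₊, fun j hj s x₀ hI x => ?_⟩
  set h : ℝ := (1 / 2) ^ j with hh
  have hh0 : 0 < h := by positivity
  set T := s.filter fun ξ => x ∈ Metric.closedBall (x₀ ξ) (r * h) with hT
  rw [show {ξ | ξ ∈ s ∧ x ∈ Metric.closedBall (x₀ ξ) (r * h)} = ↑T by ext; simp [hT],
    Set.ncard_coe_finset]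
  rcases T.eq_empty_or_nonempty with hTe | ⟨ξ₀, hξ₀⟩
  · simp [hTe]
  have hρ₀ : 0 ≤ ρ₀ * h := dist_nonneg.trans
    ((hI ξ₀ (Finset.mem_filter.1 hξ₀).1).rimDist_param x (Finset.mem_filter.1 hξ₀).2).2
  -- Area comparison: all wavelets whose square contains `x` have their supports in one disc of
  -- radius `2 ρ₀ h`, each of area at least `c h²`, with bounded overlap. Hence their number is
  -- bounded.
  have h1 : ∑ ξ ∈ T, volume (Ψ.planeSupp j i ξ) ≤
      N * volume (Metric.closedBall ((S.patch i).param x) (2 * (ρ₀ * h))) := by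
    have := sum_setLIntegral_le (μ := volume) (s := T) (A := Ψ.planeSupp j i)
      (U := Metric.closedBall ((S.patch i).param x) (2 * (ρ₀ * h)))
      (fun ξ _ => Ψ.measurableSet_planeSupp j i ξ) (fun ξ hξ z hz => ?_)
      (fun z => hN j hj i T z) (fun _ => 1)
    · simpa using this
    · have hξ' := Finset.mem_filter.1 hξ
      have h2 := ((hI ξ hξ'.1).rimDist_param x hξ'.2).2
      have h3 := ((hI ξ hξ'.1).rimDist_le z hz.2).2
      rw [Metric.mem_closedBall]
      calc dist z ((S.patch i).param x) ≤ _ := dist_triangle_right _ _ ((S.patch i).param (x₀ ξ))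
        _ ≤ _ := by linarith
  have h2 : (T.card : ℝ≥0∞) * ENNReal.ofReal (c * (1 / 2) ^ (2 * j)) ≤
      ∑ ξ ∈ T, volume (Ψ.planeSupp j i ξ) := by
    rw [← nsmul_eq_mul]
    refine Finset.card_nsmul_le_sum _ _ _ fun ξ hξ => ?_
    rw [Ψ.volume_planeSupp (hI ξ (Finset.mem_filter.1 hξ).1).subset_face]
    exact (harea j hj ξ).1
  have h3 := h2.trans h1
  rw [Complex.volume_closedBall, ← ENNReal.ofReal_natCast, ← ENNReal.ofReal_natCast,
    ← ENNReal.ofReal_mul (by positivity), ← ENNReal.ofReal_pow (by positivity),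
    show ((NNReal.pi : ℝ≥0) : ℝ≥0∞) = ENNReal.ofReal Real.pi from
      (ENNReal.ofReal_coe_nnreal (p := NNReal.pi)).symm,
    ← ENNReal.ofReal_mul (by positivity), ← ENNReal.ofReal_mul (by positivity),
    ENNReal.ofReal_le_ofReal_iff (by positivity)] at h3
  have h4 : (T.card : ℝ) ≤ N * ((2 * ρ₀) ^ 2 * Real.pi) / c := by
    rw [le_div_iff₀ hc]
    have h5 : (0 : ℝ) < h ^ 2 := by positivity
    rw [pow_mul', ← hh] at h3
    nlinarith
  exact_mod_cast h4.trans (Nat.le_ceil _)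

/-- Each term is at most a constant times `h ^ (-2)` times the integral of `max (rimDist) h ^ (-e)`
over the support, which has area at least `c h²`. Finite overlap and the integral bound `h ^ (1 -
e)` give the exponent `-1 - e`. -/
theorem exists_sum_rimDist_rpow_le (r ρ₀ : ℝ) (i : Fin S.I) {e : ℝ} (he : 1 < e) : ∃ C : ℝ≥0,
    ∀ j ≥ Ψ.j₀, ∀ (s : Finset (Fin (Ψ.num j))) (x₀ : Fin (Ψ.num j) → ℝ × ℝ),
      (∀ ξ ∈ s, S.IsInterior r ρ₀ ((1 / 2) ^ j) (S.supp (Ψ.ψd j ξ)) i (x₀ ξ)) →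
      ∑ ξ ∈ s, ENNReal.ofReal (rimDist (S.patch i).q ((S.patch i).param (x₀ ξ)) ^ (-e)) ≤
        C * ENNReal.ofReal (((1 / 2 : ℝ) ^ j) ^ (-1 - e)) := by
  obtain ⟨N, hN⟩ := Ψ.exists_planeSupp_overlap
  obtain ⟨c, C, hc, harea⟩ := Ψ.supp_area
  obtain ⟨C₁, hC₁⟩ := exists_lintegral_rimDist_le (S.patch i).ccw_left (S.patch i).ccw_right he
  refine ⟨(2 ^ e / c).toNNReal * (N * C₁), fun j hj s x₀ hI => ?_⟩
  set h : ℝ := (1 / 2) ^ j with hh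
  have hh0 : 0 < h := by positivity
  set q := (S.patch i).q with hq
  set f : ℂ → ℝ≥0∞ := fun z => ENNReal.ofReal (max (rimDist q z) h ^ (-e)) with hf
  have h1 : ∀ ξ ∈ s, ENNReal.ofReal (rimDist q ((S.patch i).param (x₀ ξ)) ^ (-e)) ≤
      ENNReal.ofReal (2 ^ e / (c * h ^ 2)) * ∫⁻ z in Ψ.planeSupp j i ξ, f z := by
    intro ξ hξ
    have hi := hI ξ hξ
    set δ := rimDist q ((S.patch i).param (x₀ ξ)) with hδ
    have hδ0 : 0 < δ := hh0.trans_le hi.le_rimDist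
    have h2 : ∀ z ∈ Ψ.planeSupp j i ξ, ENNReal.ofReal ((2 * δ) ^ (-e)) ≤ f z := by
      intro z hz
      refine ENNReal.ofReal_le_ofReal ?_
      refine Real.rpow_le_rpow_of_nonpos (lt_max_of_lt_right hh0) (max_le ?_ ?_) (by linarith)
      · exact (hi.rimDist_le z hz.2).1
      · linarith [hi.le_rimDist]
    have h3 : ENNReal.ofReal ((2 * δ) ^ (-e)) * ENNReal.ofReal (c * h ^ 2) ≤
        ∫⁻ z in Ψ.planeSupp j i ξ, f z := by
      calc _ ≤ ENNReal.ofReal ((2 * δ) ^ (-e)) * volume (Ψ.planeSupp j i ξ) := by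
            gcongr
            rw [Ψ.volume_planeSupp hi.subset_face, hh, ← pow_mul']
            exact (harea j hj ξ).1
        _ = ∫⁻ z in Ψ.planeSupp j i ξ, ENNReal.ofReal ((2 * δ) ^ (-e)) := by simp
        _ ≤ _ := setLIntegral_mono' (Ψ.measurableSet_planeSupp j i ξ) h2
    refine le_trans (le_of_eq ?_) (mul_le_mul_right h3 _)
    rw [← ENNReal.ofReal_mul (by positivity), ← ENNReal.ofReal_mul (by positivity)]
    congr 1
    rw [Real.mul_rpow (by norm_num) hδ0.le, Real.rpow_neg (by norm_num : (0 : ℝ) ≤ 2)]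
    have : (0 : ℝ) < 2 ^ e := by positivity
    field_simp
  calc _ ≤ ∑ ξ ∈ s, ENNReal.ofReal (2 ^ e / (c * h ^ 2)) * ∫⁻ z in Ψ.planeSupp j i ξ, f z :=
        Finset.sum_le_sum h1
    _ ≤ ENNReal.ofReal (2 ^ e / (c * h ^ 2)) * (N * ∫⁻ z in quad q, f z) := by
        rw [← Finset.mul_sum]
        gcongr
        exact sum_setLIntegral_le (fun ξ _ => Ψ.measurableSet_planeSupp j i ξ)
          (fun ξ _ => inter_subset_left) (fun z => hN j hj i s z) f
    _ ≤ ENNReal.ofReal (2 ^ e / (c * h ^ 2)) * (N * (C₁ * ENNReal.ofReal (h ^ (1 - e)))) := by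
        gcongr
        exact hC₁ h hh0
    _ = ENNReal.ofReal (2 ^ e / c) * (N * C₁) * (ENNReal.ofReal ((h ^ 2)⁻¹) *
          ENNReal.ofReal (h ^ (1 - e))) := by
        rw [← div_div, div_eq_mul_inv _ (h ^ 2), ENNReal.ofReal_mul (by positivity)]
        ring
    _ = _ := by
        rw [← ENNReal.ofReal_mul (by positivity), ← Real.rpow_natCast, ← Real.rpow_neg hh0.le,
          ← Real.rpow_add hh0, ENNReal.ofReal]
        push_cast
        congr 3
        ring

end WaveletBasis

/-! ### Interior wavelets -/

section Interior

variable {d : ℕ} (Ψ : S.WaveletBasis d) (R : S.Resolution)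

theorem WaveletBasis.memLp_dual {j : ℕ} (hj : j ≥ Ψ.j₀) (ξ : Fin (Ψ.num j)) :
    MemLp (Ψ.ψd j ξ) 2 S.σ :=
  Ψ.dual_riesz.1 (Sum.inr ⟨⟨j, hj⟩, ξ⟩)

theorem WaveletBasis.exists_enorm_pairing_sq_le {k : ℕ} (hk : 1 ≤ k) (hkd : k ≤ d)
    (hκ : S.ParamSmooth k) {e : ℝ} (he : 0 ≤ e) {r : ℝ} (hr : 0 < r) (ρ₀ : ℝ) : ∃ K : ℝ≥0,
    ∀ w, S.PwSmooth w → ∀ j ≥ Ψ.j₀, ∀ ξ i x₀,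
      S.IsInterior r ρ₀ ((1 / 2) ^ j) (S.supp (Ψ.ψd j ξ)) i x₀ →
      ‖S.pairing w (Ψ.ψd j ξ)‖ₑ ^ 2 ≤ K * ENNReal.ofReal (((1 / 2 : ℝ) ^ j) ^ (2 * k)) *
        (ENNReal.ofReal (rimDist (S.patch i).q ((S.patch i).param x₀) ^ (-(2 * e))) *
          ∫⁻ x in Metric.closedBall x₀ (r * (1 / 2) ^ j), (ENNReal.ofReal
            (rimDist (S.patch i).q ((S.patch i).param x) ^ e) *
              ‖iteratedFDeriv ℝ k (fun x => w ((S.patch i).kappa x)) x‖ₑ) ^ 2) := by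
  obtain ⟨C, hC⟩ := S.exists_eLpNorm_comp_kappa_le
  obtain ⟨_, D, _, hD⟩ := Ψ.normalized
  refine ⟨4 * (2 * r).toNNReal ^ (2 * k) * (2 ^ (2 * e) : ℝ).toNNReal * (C * D.toNNReal) ^ 2,
    fun w hw j hj ξ i x₀ hI => ?_⟩
  set h : ℝ := (1 / 2) ^ j with hh
  have hh0 : 0 < h := by positivity
  have hψ := Ψ.memLp_dual hj ξ
  have h1 := hI.enorm_pairing_sq_le (mul_pos hr hh0) hk hκ hψ
    (fun P hP => Ψ.moments j hj ξ i hI.subset_face P (hP.trans_le hkd)) hw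
  have h2 := hI.lintegral_le hh0 he
    (fun x => ‖iteratedFDeriv ℝ k (fun x => w ((S.patch i).kappa x)) x‖ₑ)
  have h3 : eLpNorm (fun x => Ψ.ψd j ξ ((S.patch i).kappa x)) 2 (volume.restrict square) ≤
      C * ENNReal.ofReal D := (hC _ hψ i).trans (by gcongr; exact (hD j hj ξ).2)
  refine h1.trans ((mul_le_mul' (mul_le_mul_right h2 _) (pow_le_pow_left' h3 2)).trans
    (le_of_eq ?_))
  have hδ0 : 0 < rimDist (S.patch i).q ((S.patch i).param x₀) := hh0.trans_le hI.le_rimDist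
  rw [← mul_assoc 2 r h, ENNReal.ofReal_mul (by positivity : 0 ≤ 2 * r), mul_pow _ _ (2 * k),
    ENNReal.ofReal_mul (by positivity : (0 : ℝ) ≤ 2 ^ (2 * e)),
    ENNReal.ofReal_pow hh0.le]
  simp only [ENNReal.ofReal]
  push_cast
  ring

theorem sq_rpow_half (t : ℝ≥0∞) (τ : ℝ) : (t ^ 2) ^ (τ / 2) = t ^ τ := by
  rw [← ENNReal.rpow_natCast, ← ENNReal.rpow_mul]
  congr 1
  push_cast
  ring

/-- Hölder's inequality separates the powers of `δ` from the local energies. The powers of `h`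
combine to `k τ - (1 + e) (2 - τ) / 2 = ρ τ - 1 + τ / 2`, because `e (2 - τ) / 2 = (k - ρ) τ`. -/
theorem WaveletBasis.exists_patch_sum_le {k : ℕ} (hk : 1 ≤ k) (hkd : k ≤ d)
    (hκ : S.ParamSmooth k) {ρ : ℝ} (hρ : 0 ≤ ρ) (hρk : ρ ≤ k) {τ : ℝ} (hτ0 : 0 < τ) (hτ2 : τ < 2)
    (he : 1 < ((k : ℝ) - ρ) * τ * (2 / (2 - τ))) {r : ℝ} (hr : 0 < r) (ρ₀ : ℝ) (i : Fin S.I) :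
    ∃ C : ℝ≥0, ∀ w, S.PwSmooth w → ∀ B : ℝ≥0∞, (∀ v a b, 1 ≤ a + b → a + b ≤ k →
        weightedDerivNorm (S.angle i v) ρ ρ a b
          (S.facewise (fun x => (R.φ (S.vert i v) x : ℂ) * w x) i v) ≤ B) →
      ∀ j ≥ Ψ.j₀, ∀ (s : Finset (Fin (Ψ.num j))) (x₀ : Fin (Ψ.num j) → ℝ × ℝ),
      (∀ ξ ∈ s, S.IsInterior r ρ₀ ((1 / 2) ^ j) (S.supp (Ψ.ψd j ξ)) i (x₀ ξ)) →
      ∑ ξ ∈ s, ‖S.pairing w (Ψ.ψd j ξ)‖ₑ ^ τ ≤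
        C * ENNReal.ofReal (((1 / 2 : ℝ) ^ j) ^ (ρ * τ - 1 + τ / 2)) * B ^ τ := by
  set e := ((k : ℝ) - ρ) * τ * (2 / (2 - τ)) with he'
  have hκ0 : 0 ≤ (k : ℝ) - ρ := by linarith
  have h2τ : 0 < 2 - τ := by linarith
  obtain ⟨K, hK⟩ := Ψ.exists_enorm_pairing_sq_le hk hkd hκ hκ0 hr ρ₀
  obtain ⟨M, hM⟩ := Ψ.exists_closedBall_overlap r ρ₀ i
  obtain ⟨C₁, hC₁⟩ := Ψ.exists_sum_rimDist_rpow_le r ρ₀ i he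
  obtain ⟨C₂, hC₂⟩ := R.exists_lintegral_kappa_le hk hκ hρ hρk i
  refine ⟨K ^ (τ / 2) * C₁ ^ ((2 - τ) / 2) * (M * C₂) ^ (τ / 2),
    fun w hw B hB j hj s x₀ hI => ?_⟩
  set h : ℝ := (1 / 2) ^ j with hh
  have hh0 : 0 < h := by positivity
  set δ : Fin (Ψ.num j) → ℝ := fun ξ => rimDist (S.patch i).q ((S.patch i).param (x₀ ξ)) with hδ
  have hδ0 : ∀ ξ ∈ s, 0 < δ ξ := fun ξ hξ => hh0.trans_le (hI ξ hξ).le_rimDist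
  set G : ℝ × ℝ → ℝ≥0∞ := fun x => (ENNReal.ofReal
    (rimDist (S.patch i).q ((S.patch i).param x) ^ ((k : ℝ) - ρ)) *
      ‖iteratedFDeriv ℝ k (fun x => w ((S.patch i).kappa x)) x‖ₑ) ^ 2 with hG
  set a : Fin (Ψ.num j) → ℝ≥0∞ := fun ξ => ∫⁻ x in Metric.closedBall (x₀ ξ) (r * h), G x with ha
  have hsum_a : ∑ ξ ∈ s, a ξ ≤ M * (C₂ * B ^ 2) := by
    refine (sum_setLIntegral_le (fun ξ _ => Metric.isClosed_closedBall.measurableSet)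
      (fun ξ hξ => (hI ξ hξ).closedBall_subset) (hM j hj s x₀ hI) G).trans ?_
    gcongr
    exact hC₂ w hw B hB
  -- The exponent `2 / τ` turns `a ξ ^ (τ / 2)` into the energy `a ξ`, which is summable by finite
  -- overlap; its conjugate turns the power of `δ` into `δ ^ (-e)`.
  have hpq : (2 / (2 - τ)).HolderConjugate (2 / τ) := by
    rw [Real.holderConjugate_iff]
    refine ⟨(one_lt_div h2τ).2 (by linarith), ?_⟩
    rw [inv_div, inv_div]
    ring
  have hterm : ∀ ξ ∈ s, ‖S.pairing w (Ψ.ψd j ξ)‖ₑ ^ τ ≤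
      (K * ENNReal.ofReal (h ^ (2 * k))) ^ (τ / 2) *
        (ENNReal.ofReal (δ ξ ^ (-(((k : ℝ) - ρ) * τ))) * a ξ ^ (τ / 2)) := by
    intro ξ hξ
    have h1 : ‖S.pairing w (Ψ.ψd j ξ)‖ₑ ^ 2 ≤ K * ENNReal.ofReal (h ^ (2 * k)) *
        (ENNReal.ofReal (δ ξ ^ (-(2 * ((k : ℝ) - ρ)))) * a ξ) :=
      hK w hw j hj ξ i (x₀ ξ) (hI ξ hξ)
    have hτ' : 0 ≤ τ / 2 := by positivity
    rw [← sq_rpow_half]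
    refine (ENNReal.rpow_le_rpow h1 hτ').trans (le_of_eq ?_)
    rw [ENNReal.mul_rpow_of_nonneg _ _ hτ', ENNReal.mul_rpow_of_nonneg _ (a ξ) hτ',
      ENNReal.ofReal_rpow_of_pos (Real.rpow_pos_of_pos (hδ0 ξ hξ) _),
      ← Real.rpow_mul (hδ0 ξ hξ).le]
    congr 5
    ring
  have hf : ∀ ξ ∈ s, ENNReal.ofReal (δ ξ ^ (-(((k : ℝ) - ρ) * τ))) ^ (2 / (2 - τ)) =
      ENNReal.ofReal (δ ξ ^ (-e)) := by
    intro ξ hξ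
    rw [ENNReal.ofReal_rpow_of_pos (Real.rpow_pos_of_pos (hδ0 ξ hξ) _),
      ← Real.rpow_mul (hδ0 ξ hξ).le, neg_mul]
  have hg : ∀ ξ, (a ξ ^ (τ / 2)) ^ (2 / τ) = a ξ := by
    intro ξ
    rw [← ENNReal.rpow_mul, div_mul_div_cancel₀ two_ne_zero, div_self hτ0.ne', ENNReal.rpow_one]
  calc _ ≤ ∑ ξ ∈ s, (K * ENNReal.ofReal (h ^ (2 * k))) ^ (τ / 2) *
        (ENNReal.ofReal (δ ξ ^ (-(((k : ℝ) - ρ) * τ))) * a ξ ^ (τ / 2)) := Finset.sum_le_sum hterm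
    _ ≤ (K * ENNReal.ofReal (h ^ (2 * k))) ^ (τ / 2) *
        ((∑ ξ ∈ s, ENNReal.ofReal (δ ξ ^ (-e))) ^ (1 / (2 / (2 - τ))) *
          (∑ ξ ∈ s, a ξ) ^ (1 / (2 / τ))) := by
        rw [← Finset.mul_sum]
        gcongr
        refine (ENNReal.inner_le_Lp_mul_Lq s _ _ hpq).trans (le_of_eq ?_)
        rw [Finset.sum_congr rfl hf]
        simp only [hg]
    _ ≤ (K * ENNReal.ofReal (h ^ (2 * k))) ^ (τ / 2) *
        ((C₁ * ENNReal.ofReal (h ^ (-1 - e))) ^ (1 / (2 / (2 - τ))) *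
          (M * (C₂ * B ^ 2)) ^ (1 / (2 / τ))) := by
        gcongr
        exact hC₁ j hj s x₀ hI
    _ = _ := by
        have e1 : 0 ≤ τ / 2 := by positivity
        have e2 : 0 ≤ (2 - τ) / 2 := by positivity
        rw [one_div_div, one_div_div, ← mul_assoc (M : ℝ≥0∞), ENNReal.mul_rpow_of_nonneg _ _ e1,
          ENNReal.mul_rpow_of_nonneg _ _ e2, ENNReal.mul_rpow_of_nonneg _ _ e1, sq_rpow_half,
          ENNReal.ofReal_rpow_of_pos (by positivity), ENNReal.ofReal_rpow_of_pos (by positivity)]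
        have e3 : ENNReal.ofReal ((h ^ (2 * k)) ^ (τ / 2)) *
            ENNReal.ofReal ((h ^ (-1 - e)) ^ ((2 - τ) / 2)) =
            ENNReal.ofReal (h ^ (ρ * τ - 1 + τ / 2)) := by
          rw [← ENNReal.ofReal_mul (by positivity), ← Real.rpow_natCast, ← Real.rpow_mul hh0.le,
            ← Real.rpow_mul hh0.le, ← Real.rpow_add hh0]
          congr 2
          rw [he']
          push_cast
          field_simp
          ring
        rw [← e3]
        push_cast [ENNReal.coe_rpow_of_nonneg _ e1, ENNReal.coe_rpow_of_nonneg _ e2]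
        ring

theorem WaveletBasis.exists_interior_sum_le {k : ℕ} (hk : 1 ≤ k) (hkd : k ≤ d)
    (hκ : S.ParamSmooth k) {ρ : ℝ} (hρ : 0 ≤ ρ) (hρk : ρ ≤ k) {τ : ℝ} (hτ0 : 0 < τ) (hτ2 : τ < 2)
    (he : 1 < ((k : ℝ) - ρ) * τ * (2 / (2 - τ))) {r : ℝ} (hr : 0 < r) (ρ₀ : ℝ) :
    ∃ C : ℝ≥0, ∀ w, S.PwSmooth w → ∀ B : ℝ≥0∞, (∀ i v a b, 1 ≤ a + b → a + b ≤ k →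
        weightedDerivNorm (S.angle i v) ρ ρ a b
          (S.facewise (fun x => (R.φ (S.vert i v) x : ℂ) * w x) i v) ≤ B) →
      ∀ j ≥ Ψ.j₀, ∀ s : Finset (Fin (Ψ.num j)),
      (∀ ξ ∈ s, ∃ i x₀, S.IsInterior r ρ₀ ((1 / 2) ^ j) (S.supp (Ψ.ψd j ξ)) i x₀) →
      ∑ ξ ∈ s, ‖S.pairing w (Ψ.ψd j ξ)‖ₑ ^ τ ≤
        C * ENNReal.ofReal (((1 / 2 : ℝ) ^ j) ^ (ρ * τ - 1 + τ / 2)) * B ^ τ := by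
  classical
  choose C hC using Ψ.exists_patch_sum_le R hk hkd hκ hρ hρk hτ0 hτ2 he hr ρ₀
  refine ⟨∑ i, C i, fun w hw B hB j hj s hs => ?_⟩
  rcases s.eq_empty_or_nonempty with rfl | ⟨ξ₀, hξ₀⟩
  · simp
  have : Nonempty (Fin S.I) := ⟨(hs ξ₀ hξ₀).choose⟩
  choose! i x₀ hI using hs
  rw [← Finset.sum_fiberwise s i]
  push_cast
  rw [Finset.sum_mul, Finset.sum_mul]
  refine Finset.sum_le_sum fun l _ => hC l w hw B (hB l) j hj _ x₀ fun ξ hξ => ?_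
  obtain ⟨h1, rfl⟩ := Finset.mem_filter.1 hξ
  exact hI ξ h1

/-- The estimate for interior wavelets, for a function in the closure of the patchwise smooth ones. -/
theorem WaveletBasis.exists_interior_sum_le_of_memX {k : ℕ} (hk : 1 ≤ k) (hkd : k ≤ d)
    (hκ : S.ParamSmooth k) {ρ : ℝ} (hρ : 0 ≤ ρ) (hρk : ρ ≤ k) {τ : ℝ} (hτ0 : 0 < τ) (hτ2 : τ < 2)
    (he : 1 < ((k : ℝ) - ρ) * τ * (2 / (2 - τ))) {r : ℝ} (hr : 0 < r) (ρ₀ : ℝ) :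
    ∃ C : ℝ≥0, ∀ u, R.MemX k ρ u → ∀ j ≥ Ψ.j₀, ∀ s : Finset (Fin (Ψ.num j)),
      (∀ ξ ∈ s, ∃ i x₀, S.IsInterior r ρ₀ ((1 / 2) ^ j) (S.supp (Ψ.ψd j ξ)) i x₀) →
      ∑ ξ ∈ s, ‖S.pairing u (Ψ.ψd j ξ)‖ₑ ^ τ ≤
        C * ENNReal.ofReal (((1 / 2 : ℝ) ^ j) ^ (ρ * τ - 1 + τ / 2)) * R.xNorm k ρ u ^ τ := by
  obtain ⟨C, hC⟩ := Ψ.exists_interior_sum_le R hk hkd hκ hρ hρk hτ0 hτ2 he hr ρ₀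
  obtain ⟨C₁, hC₁⟩ := R.exists_eLpNorm_le_xNorm
  obtain ⟨C₂, hC₂⟩ := S.exists_enorm_pairing_le
  refine ⟨C, fun u hu j hj s hs => ?_⟩
  obtain ⟨ε, _, hε0, hε⟩ := exists_seq_strictAnti_tendsto' (zero_lt_one' ℝ≥0∞)
  -- The constants do not depend on the approximants and `s` is finite, so both sides pass to the
  -- limit: the left by continuity of the pairing, the right because the error norm tends to zero.
  choose w hw hwε using fun n => hu.2.2 (ε n) (hε0 n).1
  have hX : Filter.Tendsto (fun n => R.xNorm k ρ (u - w n)) Filter.atTop (nhds 0) :=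
    tendsto_of_tendsto_of_tendsto_of_le_of_le tendsto_const_nhds hε (fun _ => zero_le)
      fun n => (hwε n).le
  have hpair : ∀ ξ, Filter.Tendsto (fun n => S.pairing (w n) (Ψ.ψd j ξ)) Filter.atTop
      (nhds (S.pairing u (Ψ.ψd j ξ))) := by
    intro ξ
    have hψ := Ψ.memLp_dual hj ξ
    rw [tendsto_iff_edist_tendsto_0]
    have h1 : Filter.Tendsto (fun n => C₂ * (C₁ * R.xNorm k ρ (u - w n) *
        eLpNorm (Ψ.ψd j ξ) 2 S.σ)) Filter.atTop (nhds (C₂ * (C₁ * 0 *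
        eLpNorm (Ψ.ψd j ξ) 2 S.σ))) := by
      refine ENNReal.Tendsto.const_mul (ENNReal.Tendsto.mul_const
        (ENNReal.Tendsto.const_mul hX (Or.inr ENNReal.coe_ne_top)) (Or.inr hψ.2.ne))
        (Or.inr ENNReal.coe_ne_top)
    rw [mul_zero, zero_mul, mul_zero] at h1
    refine tendsto_of_tendsto_of_tendsto_of_le_of_le tendsto_const_nhds h1 (fun _ => zero_le)
      fun n => ?_
    rw [edist_comm, edist_eq_enorm_sub, ← S.pairing_sub hu.1 (hw n).memLp hψ]
    have hm := hu.1.sub (hw n).memLp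
    refine (hC₂ _ _ hm hψ).trans ?_
    gcongr
    exact hC₁ _ hm k ρ
  have hL : Filter.Tendsto (fun n => ∑ ξ ∈ s, ‖S.pairing (w n) (Ψ.ψd j ξ)‖ₑ ^ τ) Filter.atTop
      (nhds (∑ ξ ∈ s, ‖S.pairing u (Ψ.ψd j ξ)‖ₑ ^ τ)) :=
    tendsto_finsetSum _ fun ξ _ => ((ENNReal.continuous_rpow_const.tendsto _).comp
      ((continuous_enorm.tendsto _).comp (hpair ξ)))
  have hRt : Filter.Tendsto (fun n => C * ENNReal.ofReal (((1 / 2 : ℝ) ^ j) ^ (ρ * τ - 1 + τ / 2)) *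
      (R.xNorm k ρ u + R.xNorm k ρ (u - w n)) ^ τ) Filter.atTop
      (nhds (C * ENNReal.ofReal (((1 / 2 : ℝ) ^ j) ^ (ρ * τ - 1 + τ / 2)) *
        (R.xNorm k ρ u + 0) ^ τ)) :=
    ENNReal.Tendsto.const_mul ((ENNReal.continuous_rpow_const.tendsto _).comp
      (tendsto_const_nhds.add hX)) (Or.inr (by finiteness))
  rw [add_zero] at hRt
  exact le_of_tendsto_of_tendsto' hL hRt fun n => hC (w n) (hw n) _
    (fun i v a b h1 h2 => weightedDerivNorm_facewise_le R ρ u (w n) i v h1 h2) j hj s hs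

end Interior

end Surface

/-! ### Wavelets near the skeleton, sequence norms, and the embedding -/

theorem exists_tsum_dyadic_le {a : ℝ} (ha : 0 < a) (j₀ : ℕ) : ∃ C : ℝ≥0,
    ∑' j : Ici j₀, ENNReal.ofReal (((1 / 2 : ℝ) ^ (j : ℕ)) ^ a) ≤ C := by
  have h1 : ENNReal.ofReal ((1 / 2 : ℝ) ^ a) < 1 :=
    ENNReal.ofReal_lt_one.2 (Real.rpow_lt_one (by norm_num) (by norm_num) ha)
  have h2 : ∑' j : Ici j₀, ENNReal.ofReal (((1 / 2 : ℝ) ^ (j : ℕ)) ^ a) ≤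
      (1 - ENNReal.ofReal ((1 / 2 : ℝ) ^ a))⁻¹ := by
    rw [← ENNReal.tsum_geometric]
    refine le_trans (le_of_eq ?_) (ENNReal.tsum_comp_le_tsum_of_injective
      (Subtype.val_injective (p := (· ∈ Ici j₀))) fun n => ENNReal.ofReal ((1 / 2 : ℝ) ^ a) ^ n)
    refine tsum_congr fun j => ?_
    rw [← ENNReal.ofReal_pow (by positivity), ← Real.rpow_natCast, ← Real.rpow_natCast,
      ← Real.rpow_mul (by norm_num), ← Real.rpow_mul (by norm_num), mul_comm]
  refine ⟨_, h2.trans (ENNReal.coe_toNNReal ?_).ge⟩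
  exact ENNReal.inv_ne_top.2 (tsub_pos_of_lt h1).ne'

/-- Power mean inequality with exponent `p / τ ≥ 1`, applied to the numbers `t a ^ τ`. -/
theorem sum_rpow_le_card_mul {ι : Type*} (s : Finset ι) (t : ι → ℝ≥0∞) {τ p : ℝ} (hτ : 0 < τ)
    (hτp : τ ≤ p) :
    ∑ a ∈ s, t a ^ τ ≤ (s.card : ℝ≥0∞) ^ (1 - τ / p) * (∑ a ∈ s, t a ^ p) ^ (τ / p) := by
  have hp : 0 < p := hτ.trans_le hτp
  have h := ENNReal.rpow_sum_le_const_mul_sum_rpow s (fun a => t a ^ τ) ((one_le_div hτ).2 hτp)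
  simp only [← ENNReal.rpow_mul, mul_div_cancel₀ p hτ.ne'] at h
  have h2 := ENNReal.rpow_le_rpow h (by positivity : 0 ≤ τ / p)
  rw [← ENNReal.rpow_mul, div_mul_div_cancel₀ hτ.ne', div_self hp.ne', ENNReal.rpow_one,
    ENNReal.mul_rpow_of_nonneg _ _ (by positivity), ← ENNReal.rpow_mul] at h2
  refine h2.trans (le_of_eq ?_)
  congr 2
  field_simp

namespace Surface

variable {S : Surface}

theorem isCompact_supp (u : E3 → ℂ) : IsCompact (S.supp u) :=
  S.isCompact_bdry.of_isClosed_subset isClosed_closure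
    (closure_minimal (fun _ hx => hx.1) S.isCompact_bdry.isClosed)

theorem inter_nonempty_of_setDist_eq_zero {A B : Set E3} (hA : IsCompact A) (hB : IsClosed B)
    (h : setDist A B = 0) : (A ∩ B).Nonempty := by
  rcases A.eq_empty_or_nonempty with rfl | hne
  · simp [setDist] at h
  obtain ⟨x, hx, hmin⟩ := hA.exists_isMinOn hne
    (f := fun x => Metric.infEDist x B) Metric.continuous_infEDist.continuousOn
  have h1 : Metric.infEDist x B ≤ setDist A B := le_iInf₂ fun y hy => hmin hy
  rw [h, nonpos_iff_eq_zero] at h1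
  exact ⟨x, hx, hB.closure_eq ▸ Metric.mem_closure_iff_infEDist_zero.2 h1⟩

namespace WaveletBasis

variable {d : ℕ} (Ψ : S.WaveletBasis d)

/-- The number of dual wavelets close to the skeleton. -/
theorem exists_card_near_le {A : ℝ} (hA : 0 < A) : ∃ C : ℝ, 0 ≤ C ∧ ∀ j ≥ Ψ.j₀,
    ({ξ | ¬ ENNReal.ofReal (A * (1 / 2) ^ j) <
      setDist (S.supp (Ψ.ψd j ξ)) S.skeleton}.ncard : ℝ) ≤ C * 2 ^ j := by
  obtain ⟨C₁, hC₁⟩ := Ψ.near_upper A hA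
  obtain ⟨C₂, hC₂⟩ := Ψ.touching
  refine ⟨|C₁| + |C₂|, by positivity, fun j hj => ?_⟩
  have h1 : {ξ | ¬ ENNReal.ofReal (A * (1 / 2) ^ j) <
      setDist (S.supp (Ψ.ψd j ξ)) S.skeleton} ⊆
      {ξ | 0 < setDist (S.supp (Ψ.ψd j ξ)) S.skeleton ∧
        setDist (S.supp (Ψ.ψd j ξ)) S.skeleton ≤ ENNReal.ofReal (A * (1 / 2) ^ j)} ∪
      {ξ | (S.supp (Ψ.ψd j ξ) ∩ S.skeleton).Nonempty} := by
    intro ξ hξ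
    -- Distance zero means a genuine intersection, the support being compact and the skeleton
    -- closed; these wavelets are counted separately from those at positive distance.
    rcases eq_or_ne (setDist (S.supp (Ψ.ψd j ξ)) S.skeleton) 0 with h | h
    · exact Or.inr (inter_nonempty_of_setDist_eq_zero (isCompact_supp _) S.isClosed_skeleton h)
    · exact Or.inl ⟨pos_iff_ne_zero.2 h, not_lt.1 hξ⟩
  have h2 := (Set.ncard_le_ncard h1 (Set.toFinite _)).trans (Set.ncard_union_le _ _)
  have h3 : (_ : ℝ) ≤ _ := Nat.cast_le.2 h2
  push_cast at h3
  have h4 : C₁ * 2 ^ j ≤ |C₁| * 2 ^ j := by gcongr; exact le_abs_self _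
  have h5 : C₂ * 2 ^ j ≤ |C₂| * 2 ^ j := by gcongr; exact le_abs_self _
  linarith [hC₁ j hj, hC₂ j hj]

/-- For `t < 1` the `L_t`-quasi-norm has no triangle inequality with constant one, so the sum is
estimated in `L₂` after passing from `L_t` to `L₂` on the finite measure space. -/
theorem exists_eLpNorm_proj_le {t : ℝ} (ht0 : 0 < t) (ht2 : t ≤ 2) : ∃ C : ℝ≥0, ∀ u,
    MemLp u 2 S.σ → eLpNorm (Ψ.proj u) (ENNReal.ofReal t) S.σ ≤ C * eLpNorm u 2 S.σ := by
  obtain ⟨C, hC⟩ := S.exists_enorm_pairing_le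
  have hg : ∀ a, MemLp (Ψ.gen a) 2 S.σ := fun a => Ψ.primal_riesz.1 (Sum.inl a)
  have hd : ∀ a, MemLp (Ψ.dgen a) 2 S.σ := fun a => Ψ.dual_riesz.1 (Sum.inl a)
  have hle : ENNReal.ofReal t ≤ 2 := by
    rw [← ENNReal.ofReal_ofNat]
    exact ENNReal.ofReal_le_ofReal ht2
  set V : ℝ≥0∞ := S.σ univ ^ (1 / (ENNReal.ofReal t).toReal - 1 / (2 : ℝ≥0∞).toReal) with hV
  have hV' : V ≠ ⊤ := by
    refine ENNReal.rpow_ne_top_of_nonneg ?_ (measure_ne_top _ _)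
    rw [ENNReal.toReal_ofReal ht0.le, ENNReal.toReal_ofNat, sub_nonneg]
    exact one_div_le_one_div_of_le ht0 ht2
  set D : ℝ≥0∞ := (∑ a, C * eLpNorm (Ψ.dgen a) 2 S.σ * eLpNorm (Ψ.gen a) 2 S.σ) * V with hD
  have hD' : D ≠ ⊤ := ENNReal.mul_ne_top (ENNReal.sum_ne_top.2 fun a _ => ENNReal.mul_ne_top
    (ENNReal.mul_ne_top ENNReal.coe_ne_top (hd a).2.ne) (hg a).2.ne) hV'
  refine ⟨D.toNNReal, fun u hu => ?_⟩
  have hsm : ∀ a ∈ Finset.univ, AEStronglyMeasurable (S.pairing u (Ψ.dgen a) • Ψ.gen a) S.σ :=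
    fun a _ => (hg a).1.const_smul _
  have hm : AEStronglyMeasurable (Ψ.proj u) S.σ := Finset.aestronglyMeasurable_sum _ hsm
  calc _ ≤ eLpNorm (Ψ.proj u) 2 S.σ * V := eLpNorm_le_eLpNorm_mul_rpow_measure_univ hle hm
    _ ≤ (∑ a, eLpNorm (S.pairing u (Ψ.dgen a) • Ψ.gen a) 2 S.σ) * V := by
        gcongr
        exact eLpNorm_sum_le hsm (by norm_num)
    _ ≤ (∑ a, (C * eLpNorm (Ψ.dgen a) 2 S.σ * eLpNorm (Ψ.gen a) 2 S.σ) * eLpNorm u 2 S.σ) * V := by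
        gcongr with a
        rw [eLpNorm_const_smul]
        calc _ ≤ (C * (eLpNorm u 2 S.σ * eLpNorm (Ψ.dgen a) 2 S.σ)) * eLpNorm (Ψ.gen a) 2 S.σ := by
              gcongr
              exact hC u _ hu (hd a)
          _ = _ := by ring
    _ = _ := by
        rw [ENNReal.coe_toNNReal hD', hD, ← Finset.sum_mul]
        ring

theorem besovNorm_eq {p : ℝ} (hp : 0 < p) (s : ℝ) (u : E3 → ℂ) :
    Ψ.besovNorm s p (ENNReal.ofReal p) u = eLpNorm (Ψ.proj u) (ENNReal.ofReal p) S.σ +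
      (∑' j : Ici Ψ.j₀, ENNReal.ofReal ((2 : ℝ) ^ ((j : ℕ) * (s + 2 * (1 / 2 - 1 / p)) * p)) *
        Ψ.levelSum p u j) ^ (1 / p) := by
  rw [besovNorm, if_neg ENNReal.ofReal_ne_top, ENNReal.toReal_ofReal hp.le, div_self hp.ne']
  simp only [ENNReal.rpow_one]

theorem tsum_levelSum_le {p : ℝ} (hp : 0 < p) (s : ℝ) (u : E3 → ℂ) :
    ∑' j : Ici Ψ.j₀, ENNReal.ofReal ((2 : ℝ) ^ ((j : ℕ) * (s + 2 * (1 / 2 - 1 / p)) * p)) *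
      Ψ.levelSum p u j ≤ Ψ.besovNorm s p (ENNReal.ofReal p) u ^ p := by
  have h : (∑' j : Ici Ψ.j₀, ENNReal.ofReal ((2 : ℝ) ^ ((j : ℕ) * (s + 2 * (1 / 2 - 1 / p)) * p)) *
      Ψ.levelSum p u j) ^ (1 / p) ≤ Ψ.besovNorm s p (ENNReal.ofReal p) u := by
    rw [Ψ.besovNorm_eq hp]
    exact le_add_self
  have h2 := ENNReal.rpow_le_rpow h hp.le
  rwa [← ENNReal.rpow_mul, one_div_mul_cancel hp.ne', ENNReal.rpow_one] at h2

theorem levelSum_le {p : ℝ} (hp : 0 < p) (s : ℝ) (u : E3 → ℂ) {j : ℕ} (hj : j ≥ Ψ.j₀) :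
    Ψ.levelSum p u j ≤ ENNReal.ofReal (((1 / 2 : ℝ) ^ j) ^ ((s + 2 * (1 / 2 - 1 / p)) * p)) *
      Ψ.besovNorm s p (ENNReal.ofReal p) u ^ p := by
  have h := (ENNReal.le_tsum (f := fun j : Ici Ψ.j₀ =>
    ENNReal.ofReal ((2 : ℝ) ^ ((j : ℕ) * (s + 2 * (1 / 2 - 1 / p)) * p)) *
      Ψ.levelSum p u j) ⟨j, hj⟩).trans (Ψ.tsum_levelSum_le hp s u)
  refine le_trans (le_of_eq ?_) (mul_le_mul_right h _)
  rw [← mul_assoc, ← ENNReal.ofReal_mul (by positivity), ← Real.rpow_natCast, one_div,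
    Real.inv_rpow (by norm_num), Real.inv_rpow (by positivity), ← Real.rpow_mul (by norm_num),
    ← mul_assoc, inv_mul_cancel₀ (by positivity), ENNReal.ofReal_one, one_mul]

/-- The contribution of a set of few wavelets, by Hölder's inequality. -/
theorem sum_le_of_card_le {s p τ : ℝ} (hτ : 0 < τ) (hτp : τ ≤ p) {C : ℝ} (hC : 0 ≤ C)
    (u : E3 → ℂ) {j : ℕ} (hj : j ≥ Ψ.j₀) {T : Finset (Fin (Ψ.num j))}
    (hT : (T.card : ℝ) ≤ C * 2 ^ j) :
    ∑ ξ ∈ T, ‖S.pairing u (Ψ.ψd j ξ)‖ₑ ^ τ ≤ (C ^ (1 - τ / p)).toNNReal *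
      ENNReal.ofReal (((1 / 2 : ℝ) ^ j) ^ (τ * (s + 1 - 1 / p) - 1)) *
        Ψ.besovNorm s p (ENNReal.ofReal p) u ^ τ := by
  have hp : 0 < p := hτ.trans_le hτp
  have h0 : 0 ≤ 1 - τ / p := by rw [sub_nonneg, div_le_one hp]; exact hτp
  have h1 : 0 ≤ τ / p := by positivity
  set B := Ψ.besovNorm s p (ENNReal.ofReal p) u with hB
  set h : ℝ := (1 / 2) ^ j with hh
  have hh0 : 0 < h := by positivity
  have h2j : (2 : ℝ) ^ j = h ^ (-1 : ℝ) := by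
    rw [Real.rpow_neg_one, hh, one_div, inv_pow, inv_inv]
  have hsub : ∑ ξ ∈ T, ‖S.pairing u (Ψ.ψd j ξ)‖ₑ ^ p ≤ Ψ.levelSum p u j :=
    Finset.sum_le_sum_of_subset (Finset.subset_univ T)
  have hcard : (T.card : ℝ≥0∞) ≤ ENNReal.ofReal (C * h ^ (-1 : ℝ)) := by
    rw [← ENNReal.ofReal_natCast, ← h2j]
    exact ENNReal.ofReal_le_ofReal hT
  calc _ ≤ (T.card : ℝ≥0∞) ^ (1 - τ / p) *
        (∑ ξ ∈ T, ‖S.pairing u (Ψ.ψd j ξ)‖ₑ ^ p) ^ (τ / p) := sum_rpow_le_card_mul _ _ hτ hτp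
    _ ≤ ENNReal.ofReal (C * h ^ (-1 : ℝ)) ^ (1 - τ / p) *
        (ENNReal.ofReal (h ^ ((s + 2 * (1 / 2 - 1 / p)) * p)) * B ^ p) ^ (τ / p) :=
      mul_le_mul' (ENNReal.rpow_le_rpow hcard h0)
        (ENNReal.rpow_le_rpow (hsub.trans (Ψ.levelSum_le hp s u hj)) h1)
    _ = _ := by
      rw [ENNReal.mul_rpow_of_nonneg _ _ h1, ENNReal.ofReal_rpow_of_nonneg (by positivity) h0,
        ENNReal.ofReal_rpow_of_nonneg (by positivity) h1, ← ENNReal.rpow_mul,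
        Real.mul_rpow hC (by positivity), ENNReal.ofReal_mul (by positivity),
        mul_div_cancel₀ τ hp.ne', ← mul_assoc, mul_assoc (ENNReal.ofReal (C ^ (1 - τ / p))),
        ← ENNReal.ofReal_mul (by positivity), ← Real.rpow_mul hh0.le, ← Real.rpow_mul hh0.le,
        ← Real.rpow_add hh0]
      congr 4
      field_simp
      ring

/-- The case in which the sequence space on the left is the smaller one. -/
theorem tsum_levelSum_le_of_le {s p τ : ℝ} (hp : 0 < p) (hpτ : p ≤ τ)
    (hsp : 1 / p ≤ s / 2 + 1 / 2) (u : E3 → ℂ) :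
    ∑' j : Ici Ψ.j₀, Ψ.levelSum τ u j ≤ Ψ.besovNorm s p (ENNReal.ofReal p) u ^ τ := by
  set B := Ψ.besovNorm s p (ENNReal.ofReal p) u with hB
  have h1 : ∑' j : Ici Ψ.j₀, Ψ.levelSum p u j ≤ B ^ p := by
    refine le_trans (ENNReal.tsum_le_tsum fun j => ?_) (Ψ.tsum_levelSum_le hp s u)
    refine le_mul_of_one_le_left zero_le ?_
    rw [ENNReal.one_le_ofReal]
    -- Admissibility says precisely that the weight exponent is nonnegative, so dropping the weights
    -- only decreases the norm.
    have h2 : 0 ≤ s + 2 * (1 / 2 - 1 / p) := by linarith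
    exact Real.one_le_rpow (by norm_num) (by positivity)
  have hle : ∀ (j : Ici Ψ.j₀) ξ, ‖S.pairing u (Ψ.ψd j ξ)‖ₑ ≤ B := by
    intro j ξ
    have h3 : ‖S.pairing u (Ψ.ψd j ξ)‖ₑ ^ p ≤ B ^ p :=
      (Finset.single_le_sum (f := fun ξ => ‖S.pairing u (Ψ.ψd j ξ)‖ₑ ^ p) (fun _ _ => zero_le)
        (Finset.mem_univ ξ)).trans ((ENNReal.le_tsum (f := fun j : Ici Ψ.j₀ =>
          Ψ.levelSum p u j) j).trans h1)
    exact (ENNReal.rpow_le_rpow_iff hp).1 h3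
  -- Nesting of `ℓ_p` in `ℓ_τ`: every coefficient is at most `B`, so the surplus power `τ - p` is
  -- estimated by `B`.
  have hpow : ∀ x : ℝ≥0∞, x ^ τ = x ^ (τ - p) * x ^ p := fun x => by
    rw [← ENNReal.rpow_add_of_nonneg _ _ (by linarith) hp.le, sub_add_cancel]
  calc _ ≤ ∑' j : Ici Ψ.j₀, B ^ (τ - p) * Ψ.levelSum p u j := by
        refine ENNReal.tsum_le_tsum fun j => ?_
        rw [levelSum, levelSum, Finset.mul_sum]
        refine Finset.sum_le_sum fun ξ _ => ?_
        rw [hpow]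
        gcongr
        exact hle j ξ
    _ ≤ B ^ (τ - p) * B ^ p := by
        rw [ENNReal.tsum_mul_left]
        gcongr
    _ = _ := (hpow B).symm

variable (R : S.Resolution)

/-- The case in which the sequence space on the left is the larger one. -/
theorem exists_tsum_levelSum_le_of_lt {k : ℕ} (hk : 1 ≤ k) (hkd : k ≤ d) (hκ : S.ParamSmooth k)
    {ρ : ℝ} (hρ : 0 < ρ) (hρk : ρ < k) {s p : ℝ} (hp2 : p ≤ 2) {α τ : ℝ} (hτ0 : 0 < τ)
    (hτ : 1 / τ = α / 2 + 1 / 2) (hτp : τ < p) (h1 : α < 2 * ρ) (h2 : α < 2 * (k - ρ))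
    (h3 : α < 2 * (s - (1 / p - 1 / 2))) : ∃ C : ℝ≥0, ∀ u, R.MemX k ρ u →
      ∑' j : Ici Ψ.j₀, Ψ.levelSum τ u j ≤
        C * max (Ψ.besovNorm s p (ENNReal.ofReal p) u) (R.xNorm k ρ u) ^ τ := by
  classical
  have hτ2 : τ < 2 := hτp.trans_le hp2
  have hατ : τ * α = 2 - τ := by
    have : τ * (1 / τ) = 1 := mul_one_div_cancel hτ0.ne'
    rw [hτ] at this
    linarith
  -- Since `2 - τ = τ α`, this is the condition `α < 2 (k - ρ)`.
  have he : 1 < ((k : ℝ) - ρ) * τ * (2 / (2 - τ)) := by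
    have h0 : 0 < 2 - τ := by linarith
    rw [← mul_div_assoc, one_lt_div h0]
    nlinarith
  obtain ⟨A, r, ρ₀, hA, hr, -, hint⟩ := Ψ.exists_isInterior
  obtain ⟨C₁, hC₁⟩ := Ψ.exists_interior_sum_le_of_memX R hk hkd hκ hρ.le hρk.le hτ0 hτ2 he hr ρ₀
  obtain ⟨C₂, hC₂0, hC₂⟩ := Ψ.exists_card_near_le hA
  -- After division by `τ` the two exponents are `ρ - α / 2` and `s - (1 / p - 1 / 2) - α / 2`.
  have ha₁ : 0 < ρ * τ - 1 + τ / 2 := by nlinarith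
  have ha₂ : 0 < τ * (s + 1 - 1 / p) - 1 := by nlinarith
  obtain ⟨D₁, hD₁⟩ := exists_tsum_dyadic_le ha₁ Ψ.j₀
  obtain ⟨D₂, hD₂⟩ := exists_tsum_dyadic_le ha₂ Ψ.j₀
  refine ⟨C₁ * D₁ + (C₂ ^ (1 - τ / p)).toNNReal * D₂, fun u hu => ?_⟩
  set m := max (Ψ.besovNorm s p (ENNReal.ofReal p) u) (R.xNorm k ρ u) with hm
  have hlevel : ∀ j : Ici Ψ.j₀, Ψ.levelSum τ u j ≤
      C₁ * m ^ τ * ENNReal.ofReal (((1 / 2 : ℝ) ^ (j : ℕ)) ^ (ρ * τ - 1 + τ / 2)) +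
      (C₂ ^ (1 - τ / p)).toNNReal * m ^ τ *
        ENNReal.ofReal (((1 / 2 : ℝ) ^ (j : ℕ)) ^ (τ * (s + 1 - 1 / p) - 1)) := by
    rintro ⟨j, hj⟩
    rw [levelSum, ← Finset.sum_filter_add_sum_filter_not Finset.univ fun ξ =>
      ENNReal.ofReal (A * (1 / 2) ^ j) < setDist (S.supp (Ψ.ψd j ξ)) S.skeleton]
    refine add_le_add ?_ ?_
    · refine (hC₁ u hu j hj _ fun ξ hξ => hint j hj ξ (Finset.mem_filter.1 hξ).2).trans ?_
      rw [mul_right_comm]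
      gcongr
      exact le_max_right _ _
    · refine (Ψ.sum_le_of_card_le (s := s) hτ0 hτp.le hC₂0 u hj ?_).trans ?_
      · refine le_trans (le_of_eq ?_) (hC₂ j hj)
        rw [← Set.ncard_coe_finset]
        simp
      · rw [mul_right_comm]
        gcongr
        exact le_max_left _ _
  refine (ENNReal.tsum_le_tsum hlevel).trans ?_
  rw [ENNReal.tsum_add, ENNReal.tsum_mul_left, ENNReal.tsum_mul_left]
  calc _ ≤ C₁ * m ^ τ * D₁ + (C₂ ^ (1 - τ / p)).toNNReal * m ^ τ * D₂ := by gcongr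
    _ = _ := by push_cast; ring

/-- The embedding, as an estimate. -/
theorem exists_besovNorm_le {k : ℕ} (hk : 1 ≤ k) (hkd : k ≤ d) (hκ : S.ParamSmooth k)
    {ρ : ℝ} (hρ : 0 < ρ) (hρk : ρ < k) {s p : ℝ} (hp0 : 0 < p) (hp2 : p ≤ 2)
    (hsp : 1 / p ≤ s / 2 + 1 / 2) {α τ : ℝ} (hτ0 : 0 < τ) (hτ2 : τ ≤ 2)
    (hτ : 1 / τ = α / 2 + 1 / 2) (h1 : α < 2 * ρ) (h2 : α < 2 * (k - ρ))
    (h3 : α < 2 * (s - (1 / p - 1 / 2))) : ∃ C : ℝ≥0, ∀ u, R.MemX k ρ u →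
      Ψ.besovNorm α τ (ENNReal.ofReal τ) u ≤
        C * max (Ψ.besovNorm s p (ENNReal.ofReal p) u) (R.xNorm k ρ u) := by
  have hsum : ∃ C : ℝ≥0, ∀ u, R.MemX k ρ u → ∑' j : Ici Ψ.j₀, Ψ.levelSum τ u j ≤
      C * max (Ψ.besovNorm s p (ENNReal.ofReal p) u) (R.xNorm k ρ u) ^ τ := by
    rcases le_or_gt p τ with h | h
    · refine ⟨1, fun u _ => (Ψ.tsum_levelSum_le_of_le hp0 h hsp u).trans ?_⟩
      rw [ENNReal.coe_one, one_mul]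
      exact ENNReal.rpow_le_rpow (le_max_left _ _) hτ0.le
    · exact Ψ.exists_tsum_levelSum_le_of_lt R hk hkd hκ hρ hρk hp2 hτ0 hτ h h1 h2 h3
  obtain ⟨C₁, hC₁⟩ := hsum
  obtain ⟨C₂, hC₂⟩ := Ψ.exists_eLpNorm_proj_le hτ0 hτ2
  obtain ⟨C₃, hC₃⟩ := R.exists_eLpNorm_le_xNorm
  refine ⟨C₂ * C₃ + C₁ ^ (1 / τ), fun u hu => ?_⟩
  have hτ' : 0 ≤ 1 / τ := by positivity
  set m := max (Ψ.besovNorm s p (ENNReal.ofReal p) u) (R.xNorm k ρ u) with hm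
  -- The level weights are trivial, so only the plain sum of the `τ`-th powers of the coefficients
  -- remains.
  have hw : α + 2 * (1 / 2 - 1 / τ) = 0 := by rw [hτ]; ring
  rw [Ψ.besovNorm_eq hτ0, hw]
  simp only [mul_zero, zero_mul, Real.rpow_zero, ENNReal.ofReal_one, one_mul]
  calc _ ≤ C₂ * (C₃ * m) + (C₁ * m ^ τ) ^ (1 / τ) := by
        refine add_le_add ((hC₂ u hu.1).trans ?_) (ENNReal.rpow_le_rpow (hC₁ u hu) hτ')
        gcongr
        exact (hC₃ u hu.1 k ρ).trans (by gcongr; exact le_max_right _ _)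
    _ = _ := by
        rw [ENNReal.mul_rpow_of_nonneg _ _ hτ', ← ENNReal.rpow_mul, mul_one_div_cancel hτ0.ne',
          ENNReal.rpow_one]
        push_cast [ENNReal.coe_rpow_of_nonneg _ hτ']
        ring

end WaveletBasis

end Surface

end PolySurf

end

theorem mainTheorem1 (S : PolySurf.Surface) (R : S.Resolution) (d : ℕ) (Ψ : S.WaveletBasis d)
    (k : ℕ) (hk : 1 ≤ k) (hkd : k ≤ d) (hκ : S.ParamSmooth k)
    (ρ : ℝ) (hρ : 0 < ρ) (hρk : ρ < k)
    (s p : ℝ) (hs : 0 < s) (hadm : PolySurf.Admissible s p (ENNReal.ofReal p))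
    (α τ : ℝ) (hτ : 1 / τ = α / 2 + 1 / 2) (hα : 0 ≤ α)
    (hα' : α < 2 * min (min ρ (k - ρ)) (s - (1 / p - 1 / 2))) :
    PolySurf.Admissible α τ (ENNReal.ofReal τ) ∧
    (∀ u, Ψ.MemBesov s p (ENNReal.ofReal p) u → R.MemX k ρ u →
      Ψ.MemBesov α τ (ENNReal.ofReal τ) u) ∧
    ∃ C : ℝ≥0, ∀ u, Ψ.MemBesov s p (ENNReal.ofReal p) u → R.MemX k ρ u →
      Ψ.besovNorm α τ (ENNReal.ofReal τ) u ≤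
        C * max (Ψ.besovNorm s p (ENNReal.ofReal p) u) (R.xNorm k ρ u) := by
  have hτ0 : 0 < τ := one_div_pos.1 (by rw [hτ]; positivity)
  have hτ2 : τ ≤ 2 := (one_div_le_one_div two_pos hτ0).1 (by rw [hτ]; linarith)
  obtain ⟨hp1, hsp, -, -⟩ := hadm
  have hp0 : 0 < p := one_div_pos.1 (by linarith)
  have hp2 : p ≤ 2 := (one_div_le_one_div two_pos hp0).1 hp1
  have h1 : min (min ρ (k - ρ)) (s - (1 / p - 1 / 2)) ≤ ρ :=
    (min_le_left _ _).trans (min_le_left _ _)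
  have h2 : min (min ρ (k - ρ)) (s - (1 / p - 1 / 2)) ≤ k - ρ :=
    (min_le_left _ _).trans (min_le_right _ _)
  have h3 : min (min ρ (k - ρ)) (s - (1 / p - 1 / 2)) ≤ s - (1 / p - 1 / 2) := min_le_right _ _
  obtain ⟨C, hC⟩ := Ψ.exists_besovNorm_le R hk hkd hκ hρ hρk hp0 hp2 hsp hτ0 hτ2 hτ
    (by linarith) (by linarith) (by linarith)
  refine ⟨⟨by rw [hτ]; linarith, hτ.le, ENNReal.ofReal_pos.2 hτ0, fun _ => ?_⟩,
    fun u hB hX => ⟨hX.1, (hC u hX).trans_lt ?_⟩, C, fun u _ hX => hC u hX⟩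
  · rw [← ENNReal.ofReal_ofNat]
    exact ENNReal.ofReal_le_ofReal hτ2
  · exact ENNReal.mul_lt_top ENNReal.coe_lt_top (max_lt hB.2 hX.2.1)
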